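/- Let $\mathbb F\in\{\mathbb R,\mathbb C\}$, let $d\ge 2$ be an integer, let $\gamma\in\mathbb R\setminus\{0\}$, and write $\hat u(\xi)=\int_{\mathbb R^d}e^{-2\pi i x\cdot\xi}u(x)\,dx$ for the Fourier transform, extended to tempered distributions. For $\sigma,r,\delta\in\mathbb R$ let $X^{\sigma}_{r,\delta}=X^{\sigma}_{r,\delta}(\mathbb R^d;\mathbb F)$ be the space of $\mathbb F$-valued tempered distributions $u$ with $\hat u\in L^1_{\mathrm{loc}}$ and $$\|u\|_{X^\sigma_{r,\delta}}^2=\int_{|\xi|<1}\frac{\xi_1^2+|\xi|^{2\delta}}{|\xi|^{2r}}|\hat u(\xi)|^2\,d\xi+\int_{|\xi|\ge1}(1+|\xi|^2)^{\sigma}|\hat u(\xi)|^2\,d\xi<\infty .$$ Let $(H^s\cap\dot H^{-r})(\mathbb R^d;\mathbb F)$ be the space of $\mathbb F$-valued tempered distributions $f$ with $\hat f\in L^1_{\mathrm{loc}}$ and $\|f\|^2=\int_{\mathbb R^d}\big((1+|\xi|^2)^s+|\xi|^{-2r}\big)|\hat f(\xi)|^2\,d\xi<\infty$. For $a\in\mathbb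 R$, $(-\Delta)^{a}$ is the Fourier multiplier with symbol $(2\pi|\xi|)^{2a}$. Let $s\ge 0$, $0\le r\le 1$ and $\delta>1$ satisfy $d>1+\delta-2r$ and $s>d/2$; if $d=2$, suppose also that $\delta\le2$. Let $0<R\le\infty$, and let $\zeta,\psi:B(0,R)\to\mathbb F$, $B(0,R)\subseteq\mathbb F$, be given by power series about $0$ that converge in $B(0,R)$, with $\zeta(0)=\psi(0)=0$ and $\zeta'(0),\psi'(0)\in\mathbb R\setminus\{0\}$. Then there exist an open neighbourhood $\mathcal U$ of $0$ in $(H^s\cap\dot H^{-r})(\mathbb R^d;\mathbb F)$ (in particular $\mathcal U\neq\varnothing$) and an open neighbourhood $\mathcal V$ of $0$ in $X^{s+\delta}_{r,\delta}(\mathbb R^d;\mathbb F)$ such that for each $f\in\mathcal U$ there is exactly one $u\in\mathcal V$ that takes values in $B(0,R)$ and satisfies $$-\gamma\,\partial_1[\zeta(u)]-(-\Delta)^{\delta/2-1}\,\mathrm{div}\big[(1+\psi(u))\nabla u\big]=f .$$ Moreover, the induced map $\mathcal U\ni f\mapsto u\in X^{s+\delta}_{r,\delta}(\mathbb R^d;\mathbb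 F)$ is analytic over $\mathbb F$. -/

import Mathlib

open MeasureTheory Filter Topology
open scoped SchwartzMap FourierTransform LineDeriv ENNReal

noncomputable section

namespace AnisoSobolev

/-- Euclidean space `ℝᵈ`. -/
abbrev Eu (d : ℕ) := EuclideanSpace ℝ (Fin d)

/-- The tempered distribution `T` is the function `g`: `g` is locally integrable, and `T` acts on
Schwartz functions by absolutely convergent integration against `g`. -/
structure Represents {d : ℕ} (T : 𝓢'(Eu d, ℂ)) (g : Eu d → ℂ) : Prop where
  locInt : LocallyIntegrable g volume
  integrable : ∀ φ : 𝓢(Eu d, ℂ), Integrable (fun x => φ x * g x) volume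
  apply_eq : ∀ φ : 𝓢(Eu d, ℂ), T φ = ∫ x, φ x * g x

/-- `T` is a `𝕜`-valued tempered distribution (`𝕜 = ℝ` or `ℂ`, embedded in `ℂ`): its values on
real-valued Schwartz functions lie in `𝕜`. -/
def IsValuedIn (𝕜 : Type*) [RCLike 𝕜] [NormedAlgebra 𝕜 ℂ] {d : ℕ} (T : 𝓢'(Eu d, ℂ)) : Prop :=
  ∀ φ : 𝓢(Eu d, ℂ), (∀ x, (φ x).im = 0) → T φ ∈ Set.range (algebraMap 𝕜 ℂ)

/-- A measurable weight on the frequency space, positive almost everywhere. -/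
structure FourierWeight (d : ℕ) where
  toFun : Eu d → ℝ
  measurable : Measurable toFun
  pos_ae : ∀ᵐ ξ, 0 < toFun ξ

theorem Represents.ae_eq {d : ℕ} {T : 𝓢'(Eu d, ℂ)} {g h : Eu d → ℂ}
    (hg : Represents T g) (hh : Represents T h) : g =ᵐ[volume] h := by
  refine ae_eq_of_integral_contDiff_smul_eq hg.locInt hh.locInt ?_
  intro ψ hψ hc
  have hc' : HasCompactSupport (fun x => (ψ x : ℂ)) := hc.comp_left (g := fun t : ℝ => (t : ℂ)) rfl
  have hs' : ContDiff ℝ (⊤ : ℕ∞) (fun x => (ψ x : ℂ)) := Complex.ofRealCLM.contDiff.comp hψ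
  have h1 := hg.apply_eq (hc'.toSchwartzMap hs')
  have h2 := hh.apply_eq (hc'.toSchwartzMap hs')
  rw [h1] at h2
  simpa [Complex.real_smul] using h2

theorem Represents.add {d : ℕ} {T S : 𝓢'(Eu d, ℂ)} {g h : Eu d → ℂ}
    (hg : Represents T g) (hh : Represents S h) : Represents (T + S) (g + h) where
  locInt := hg.locInt.add hh.locInt
  integrable φ := by
    have := (hg.integrable φ).add (hh.integrable φ)
    refine this.congr (Eventually.of_forall fun x => ?_)
    simp [mul_add]
  apply_eq φ := by
    have := integral_add (hg.integrable φ) (hh.integrable φ)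
    rw [← hg.apply_eq, ← hh.apply_eq] at this
    calc (T + S) φ = T φ + S φ := rfl
      _ = _ := this.symm
      _ = _ := by simp [mul_add]

theorem Represents.smul {𝕜 : Type*} [RCLike 𝕜] [NormedAlgebra 𝕜 ℂ] {d : ℕ} {T : 𝓢'(Eu d, ℂ)}
    {g : Eu d → ℂ} (c : 𝕜) (hg : Represents T g) : Represents (c • T) (c • g) where
  locInt := hg.locInt.smul c
  integrable φ := by
    refine ((hg.integrable φ).smul c).congr (Eventually.of_forall fun x => ?_)
    simp
  apply_eq φ := by
    calc (c • T) φ = c • T φ := rfl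
      _ = _ := by rw [hg.apply_eq, ← integral_smul]; simp

theorem Represents.zero {d : ℕ} : Represents (0 : 𝓢'(Eu d, ℂ)) 0 where
  locInt := locallyIntegrable_zero
  integrable φ := by simp
  apply_eq φ := by simp

theorem fourier_smul_field {𝕜 : Type*} [RCLike 𝕜] [NormedAlgebra 𝕜 ℂ] {d : ℕ} (c : 𝕜)
    (T : 𝓢'(Eu d, ℂ)) : 𝓕 (c • T) = c • 𝓕 T := by
  ext φ
  rfl

/-- The `𝕜`-valued tempered distributions `u` whose Fourier transform is a locally integrable
function with `∫ w(ξ) |û(ξ)|² dξ < ∞`, i.e. `√w û ∈ L²`. -/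
def fourierSubmodule (𝕜 : Type*) [RCLike 𝕜] [NormedAlgebra 𝕜 ℂ] {d : ℕ} (w : FourierWeight d) :
    Submodule 𝕜 (𝓢'(Eu d, ℂ)) where
  carrier := {u | IsValuedIn 𝕜 u ∧ ∃ g : Eu d → ℂ, Represents (𝓕 u) g ∧
    MemLp (fun ξ => √(w.toFun ξ) • g ξ) 2 volume}
  add_mem' := by
    rintro u v ⟨hu, g, hg, hg2⟩ ⟨hv, h, hh, hh2⟩
    refine ⟨?_, g + h, ?_, ?_⟩
    · intro φ hφ
      obtain ⟨a, ha⟩ := hu φ hφ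
      obtain ⟨b, hb⟩ := hv φ hφ
      refine ⟨a + b, ?_⟩
      calc _ = u φ + v φ := by rw [map_add, ha, hb]
        _ = _ := rfl
    · rw [FourierTransform.fourier_add]
      exact hg.add hh
    · refine (hg2.add hh2).ae_eq (Eventually.of_forall fun x => ?_)
      simp
  zero_mem' := by
    refine ⟨fun φ _ => ⟨0, by simp⟩, 0, ?_, by simp⟩
    have h0 : 𝓕 (0 : 𝓢'(Eu d, ℂ)) = 0 := by ext φ; rfl
    rw [h0]
    exact Represents.zero
  smul_mem' := by
    rintro c u ⟨hu, g, hg, hg2⟩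
    refine ⟨?_, c • g, ?_, ?_⟩
    · intro φ hφ
      obtain ⟨a, ha⟩ := hu φ hφ
      refine ⟨c * a, ?_⟩
      calc _ = c • u φ := by rw [map_mul, ha, Algebra.smul_def]
        _ = _ := rfl
    · rw [fourier_smul_field]
      exact hg.smul c
    · refine (hg2.const_smul c).ae_eq (Eventually.of_forall fun x => ?_)
      simp

/-- The space of `fourierSubmodule`, with the norm `(∫ w(ξ) |û(ξ)|² dξ)^{1/2}`
(see `FourierSpace.norm_sq_eq`). -/
def FourierSpace (𝕜 : Type*) [RCLike 𝕜] [NormedAlgebra 𝕜 ℂ] {d : ℕ} (w : FourierWeight d) :=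
  ↥(fourierSubmodule 𝕜 w)

namespace FourierSpace

variable {𝕜 : Type*} [RCLike 𝕜] [NormedAlgebra 𝕜 ℂ] {d : ℕ} {w : FourierWeight d}

instance : AddCommGroup (FourierSpace 𝕜 w) :=
  inferInstanceAs (AddCommGroup ↥(fourierSubmodule 𝕜 w))

instance : Module 𝕜 (FourierSpace 𝕜 w) :=
  inferInstanceAs (Module 𝕜 ↥(fourierSubmodule 𝕜 w))

/-- The underlying tempered distribution. -/
def toDistr (u : FourierSpace 𝕜 w) : 𝓢'(Eu d, ℂ) := u.1

/-- The Fourier transform of `u` as a function. -/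
def hat (u : FourierSpace 𝕜 w) : Eu d → ℂ := u.2.2.choose

theorem hat_represents (u : FourierSpace 𝕜 w) : Represents (𝓕 u.toDistr) u.hat :=
  u.2.2.choose_spec.1

theorem hat_memLp (u : FourierSpace 𝕜 w) :
    MemLp (fun ξ => √(w.toFun ξ) • u.hat ξ) 2 volume :=
  u.2.2.choose_spec.2

/-- The map `u ↦ √w û` into `L²`. -/
def toL2 (𝕜 : Type*) [RCLike 𝕜] [NormedAlgebra 𝕜 ℂ] {d : ℕ} (w : FourierWeight d) :
    FourierSpace 𝕜 w →ₗ[𝕜] Lp ℂ 2 (volume : Measure (Eu d)) where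
  toFun u := u.hat_memLp.toLp _
  map_add' u v := by
    rw [← MemLp.toLp_add, MemLp.toLp_eq_toLp_iff]
    have h : Represents (𝓕 (u + v).toDistr) (u.hat + v.hat) := by
      have h1 : (u + v).toDistr = u.toDistr + v.toDistr := rfl
      rw [h1, FourierTransform.fourier_add]
      exact u.hat_represents.add v.hat_represents
    filter_upwards [(u + v).hat_represents.ae_eq h] with x hx
    simp [hx]
  map_smul' c u := by
    rw [RingHom.id_apply, ← MemLp.toLp_const_smul, MemLp.toLp_eq_toLp_iff]
    have h : Represents (𝓕 (c • u).toDistr) (c • u.hat) := by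
      have h1 : (c • u).toDistr = c • u.toDistr := rfl
      rw [h1, fourier_smul_field]
      exact u.hat_represents.smul c
    filter_upwards [(c • u).hat_represents.ae_eq h] with x hx
    simp [hx]

theorem toL2_injective : Function.Injective (toL2 𝕜 w) := by
  rw [injective_iff_map_eq_zero]
  intro u hu
  have h0 : (fun ξ => √(w.toFun ξ) • u.hat ξ) =ᵐ[volume] 0 :=
    by
    have h := u.hat_memLp.coeFn_toLp
    have h' : u.hat_memLp.toLp _ = 0 := hu
    rw [h'] at h
    exact h.symm.trans (Lp.coeFn_zero _ _ _)
  have h1 : u.hat =ᵐ[volume] 0 := by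
    filter_upwards [h0, w.pos_ae] with x hx hw
    have : √(w.toFun x) ≠ 0 := (Real.sqrt_pos.2 hw).ne'
    simpa [this] using hx
  have h2 : 𝓕 u.toDistr = 0 := by
    ext φ
    rw [u.hat_represents.apply_eq]
    have : (fun x => φ x * u.hat x) =ᵐ[volume] 0 := by
      filter_upwards [h1] with x hx
      simp [hx]
    rw [integral_congr_ae this]
    simp
  have h3 : u.toDistr = 0 := by
    have h4 := congrArg 𝓕⁻ h2
    rw [FourierTransform.fourierInv_fourier_eq] at h4
    rw [h4]
    ext φ
    rfl
  exact Subtype.ext h3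

instance : NormedAddCommGroup (FourierSpace 𝕜 w) :=
  NormedAddCommGroup.induced _ _ (toL2 𝕜 w) toL2_injective

instance : NormedSpace 𝕜 (FourierSpace 𝕜 w) :=
  NormedSpace.induced 𝕜 _ _ (toL2 𝕜 w)

theorem norm_sq_eq (u : FourierSpace 𝕜 w) {g : Eu d → ℂ} (hg : Represents (𝓕 u.toDistr) g) :
    ‖u‖ ^ 2 = ∫ ξ, w.toFun ξ * ‖g ξ‖ ^ 2 := by
  have h1 : ‖u‖ = ‖u.hat_memLp.toLp _‖ := rfl
  rw [h1, ← real_inner_self_eq_norm_sq, L2.inner_def]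
  refine integral_congr_ae ?_
  filter_upwards [u.hat_memLp.coeFn_toLp, u.hat_represents.ae_eq hg, w.pos_ae] with x hx hy hw
  rw [hx, hy, real_inner_self_eq_norm_sq, norm_smul, mul_pow, Real.norm_eq_abs, sq_abs,
    Real.sq_sqrt hw.le]

end FourierSpace

/-- `ω_{s,r,δ}(ξ) = (ξ₁² + |ξ|^{2δ}) / |ξ|^{2r}` for `|ξ| < 1` and `(1 + |ξ|²)^s` for `|ξ| ≥ 1`. -/
def omega {d : ℕ} [NeZero d] (s r δ : ℝ) : FourierWeight d where
  toFun ξ := if ‖ξ‖ < 1 then ((ξ 0) ^ 2 + ‖ξ‖ ^ (2 * δ)) / ‖ξ‖ ^ (2 * r)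
    else (1 + ‖ξ‖ ^ 2) ^ s
  measurable := by
    refine Measurable.ite (measurableSet_lt (by fun_prop) (by fun_prop)) ?_ ?_ <;> fun_prop
  pos_ae := by
    have h : ∀ᵐ ξ : Eu d, ξ ≠ 0 := by
      simp [ae_iff]
    filter_upwards [h] with ξ hξ
    have hp : 0 < ‖ξ‖ := norm_pos_iff.2 hξ
    split_ifs <;> positivity

/-- The weight `(1 + |ξ|²)^s + |ξ|^{-2r}` of `H^s ∩ Ḣ^{-r}`. -/
def hsWeight {d : ℕ} (s r : ℝ) : FourierWeight d where
  toFun ξ := (1 + ‖ξ‖ ^ 2) ^ s + ‖ξ‖ ^ (-2 * r)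
  measurable := by fun_prop
  pos_ae := Eventually.of_forall fun ξ => by positivity

/-- The anisotropic Sobolev space `X^s_{r,δ}(ℝᵈ; 𝕜)`. -/
abbrev XSpace (𝕜 : Type*) [RCLike 𝕜] [NormedAlgebra 𝕜 ℂ] (d : ℕ) [NeZero d] (s r δ : ℝ) :=
  FourierSpace 𝕜 (omega (d := d) s r δ)

/-- The space `(H^s ∩ Ḣ^{-r})(ℝᵈ; 𝕜)`, with
`‖f‖² = ∫ (1 + |ξ|²)^s |f̂|² + ∫ |ξ|^{-2r} |f̂|²`. -/
abbrev HSpace (𝕜 : Type*) [RCLike 𝕜] [NormedAlgebra 𝕜 ℂ] (d : ℕ) (s r : ℝ) :=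
  FourierSpace 𝕜 (hsWeight (d := d) s r)

/-- The `j`-th standard basis vector. -/
abbrev stdVec {d : ℕ} (j : Fin d) : Eu d := EuclideanSpace.single j 1

/-- `W = (-Δ)^a T`: the Fourier transforms of `T` and `W` are locally integrable functions and
`Ŵ(ξ) = (2π|ξ|)^{2a} T̂(ξ)`. -/
def IsFracLaplacian {d : ℕ} (a : ℝ) (T W : 𝓢'(Eu d, ℂ)) : Prop :=
  ∃ g : Eu d → ℂ, Represents (𝓕 T) g ∧
    Represents (𝓕 W) (fun ξ => (((2 * Real.pi * ‖ξ‖) ^ (2 * a) : ℝ) : ℂ) * g ξ)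

/-- The tempered distribution `u` solves
`-γ ∂₁[ζ(u)] - (-Δ)^{δ/2-1} div[(1 + ψ(u)) ∇u] = f`.
Here `u` is a continuous function `U` with values in the ball `B(0,R)` on which `ζ` and `ψ` are
defined, `∇u` is a locally integrable vector field `G`, `ζ(u)` and the components of
`(1 + ψ(u)) ∇u` are formed pointwise and are tempered distributions `Z` and `V j`, the outer
derivatives are distributional, and `W = (-Δ)^{δ/2-1} div V`. -/
def Solves {𝕜 : Type*} [RCLike 𝕜] [NormedAlgebra 𝕜 ℂ] {d : ℕ} [NeZero d] (γ δ : ℝ) (R : ℝ≥0∞)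
    (ζ ψ : 𝕜 → 𝕜) (f u : 𝓢'(Eu d, ℂ)) : Prop :=
  ∃ (U : Eu d → 𝕜) (G : Fin d → Eu d → 𝕜) (Z W : 𝓢'(Eu d, ℂ)) (V : Fin d → 𝓢'(Eu d, ℂ)),
    Continuous U ∧ (∀ x, ‖U x‖ₑ < R) ∧
    Represents u (fun x => algebraMap 𝕜 ℂ (U x)) ∧
    (∀ j, Represents (∂_{stdVec j} u) (fun x => algebraMap 𝕜 ℂ (G j x))) ∧
    Represents Z (fun x => algebraMap 𝕜 ℂ (ζ (U x))) ∧
    (∀ j, Represents (V j) (fun x => algebraMap 𝕜 ℂ ((1 + ψ (U x)) * G j x))) ∧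
    IsFracLaplacian (δ / 2 - 1) (∑ j, ∂_{stdVec j} (V j)) W ∧
    -(γ : ℂ) • ∂_{stdVec (0 : Fin d)} Z - W = f

end AnisoSobolev

end

noncomputable section

namespace AnisoSobolev

/-! ### Integrals of product functions -/

/-! Choose `Ψ` with `Ψ' = ψ` and `Ψ(0) = 0`. Then (1 + ψ(u))∇u = ∇(u + Ψ(u)), and the equation reads
N(u) = f with N(u) = -γ∂₁ζ(u) + (-Δ)^{δ/2}(u + Ψ(u)); `solves_iff` makes this passage rigorous. The
derivative of N at 0 is the Fourier multiplier with symbol -2πiγζ'(0)ξ₁ + (2π|ξ|)^δ. One part is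
imaginary and the other real, so the squared modulus is comparable to ξ₁² + |ξ|^{2δ}, and the weight
of X is comparable to this quantity times the weight of H^s ∩ Ḣ^{-r}. Hence the derivative is an
isomorphism (`exists_linearEquiv`), and the analytic inverse function theorem
(`exists_analytic_inverse`) yields the solution map.

Analyticity of N rests on X being an algebra under pointwise multiplication (`exists_mul`), on which
power series act (`exists_comp_powerSeries`). On the Fourier side this is a weighted L² bound for
convolutions (`lintegral_sq_omega_conv_le`). For ξ = η + ζ one has, up to a constant, ω(ξ) ≤ ω(η) +
ω(ζ) + (K(ξ,η) + K(ξ,ζ)) ω(η) ω(ζ) (`omega_add_le`). The first two terms are handled by Young's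
inequality, because ∫ 1/ω < ∞ puts û in L¹. The kernel K accounts for two comparable frequencies
that nearly cancel, when |ξ|^{-2r} is not controlled by |η|^{-2r}. Cauchy–Schwarz reduces its
contribution to sup_η ∫ K(ξ,η) dξ < ∞ (`lintegral_kernel_le`). There the integral in ξ₁ is that of a
Cauchy density, of mass π/|η|^δ, and the transverse variables are left to power counting, which uses
d > 1 + δ - 2r and, when d = 2, also δ ≤ 2. -/

theorem lintegral_fin_prod {n : ℕ} (g : Fin n → ℝ → ℝ≥0∞) (hg : ∀ i, Measurable (g i)) :
    ∫⁻ x : Fin n → ℝ, ∏ i, g i (x i) = ∏ i, ∫⁻ t, g i t := by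
  induction n with
  | zero => simp [volume_pi]
  | succ n ih =>
    have h := (volume_preserving_piFinSuccAbove (fun _ : Fin (n + 1) => ℝ) 0).symm
    have hm : Measurable fun x : Fin n → ℝ => ∏ i, g i.succ (x i) :=
      Finset.measurable_prod _ fun i _ => (hg _).comp (measurable_pi_apply i)
    rw [← h.lintegral_comp_emb (MeasurableEquiv.measurableEmbedding _), Measure.volume_eq_prod]
    simp only [Fin.prod_univ_succ]
    rw [← ih _ fun i => hg _, ← lintegral_prod_mul (hg 0).aemeasurable hm.aemeasurable]
    refine lintegral_congr fun x => ?_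
    simp [MeasurableEquiv.piFinSuccAbove]

theorem lintegral_le_prod {d : ℕ} (F : Eu d → ℝ≥0∞) (g : Fin d → ℝ → ℝ≥0∞)
    (hg : ∀ i, Measurable (g i)) (hF : ∀ᵐ x, F x ≤ ∏ i, g i (x i)) :
    ∫⁻ x, F x ≤ ∏ i, ∫⁻ t, g i t := by
  rw [← lintegral_fin_prod g hg]
  refine (lintegral_mono_ae hF).trans_eq ?_
  exact (PiLp.volume_preserving_ofLp (Fin d)).lintegral_comp
    (Finset.measurable_prod _ fun i _ => (hg _).comp (measurable_pi_apply i))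

/-- The low-frequency integrals are bounded in this form: the anisotropic first coordinate has its
own majorant, and the transverse coordinates share one. -/
theorem lintegral_le_slab {d : ℕ} [NeZero d] (F : Eu d → ℝ≥0∞) (g h : ℝ → ℝ≥0∞)
    (hg : Measurable g) (hh : Measurable h)
    (hF : ∀ᵐ x : Eu d, F x ≤ g (x 0) * ∏ j ∈ Finset.univ.erase 0, h (x j)) :
    ∫⁻ x, F x ≤ (∫⁻ t, g t) * (∫⁻ t, h t) ^ (d - 1) := by
  have key := lintegral_le_prod F (fun j => if j = 0 then g else h)
    (fun j => by split_ifs <;> assumption) (by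
      filter_upwards [hF] with x hx
      refine hx.trans_eq ?_
      rw [← Finset.mul_prod_erase Finset.univ _ (Finset.mem_univ (0 : Fin d)), if_pos rfl]
      congr 1
      exact Finset.prod_congr rfl fun j hj => by rw [if_neg (Finset.ne_of_mem_erase hj)])
  refine key.trans_eq ?_
  rw [← Finset.mul_prod_erase Finset.univ _ (Finset.mem_univ (0 : Fin d)), if_pos rfl]
  congr 1
  rw [Finset.prod_congr rfl fun j hj => by rw [if_neg (Finset.ne_of_mem_erase hj)]]
  simp

theorem ae_coord_ne_zero {d : ℕ} : ∀ᵐ x : Eu d, ∀ i, x i ≠ 0 := by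
  rw [ae_all_iff]
  intro i
  have := (PiLp.volume_preserving_ofLp (Fin d)).quasiMeasurePreserving.ae
    ((volume_pi (α := fun _ : Fin d => ℝ)) ▸
      Measure.ae_eval_ne (fun _ : Fin d => (volume : Measure ℝ)) i 0)
  exact this

theorem lintegral_comp_abs (g : ℝ → ℝ≥0∞) :
    ∫⁻ t : ℝ, g |t| = 2 * ∫⁻ t in Set.Ioi (0 : ℝ), g t := by
  have h1 : ∫⁻ t in Set.Ioi (0 : ℝ), g |t| = ∫⁻ t in Set.Ioi (0 : ℝ), g t :=
    setLIntegral_congr_fun measurableSet_Ioi fun t ht => by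
      simp only [abs_of_pos (Set.mem_Ioi.1 ht)]
  have h2 : ∫⁻ t in Set.Iic (0 : ℝ), g |t| = ∫⁻ t in Set.Ioi (0 : ℝ), g |t| := by
    have := (Measure.measurePreserving_neg (volume : Measure ℝ)).setLIntegral_comp_preimage_emb
      (Homeomorph.neg ℝ).measurableEmbedding (fun t => g |t|) (Set.Ici 0)
    simp only [abs_neg, Set.neg_preimage, Set.neg_Ici, neg_zero] at this
    rw [this]
    exact setLIntegral_congr Ioi_ae_eq_Ici.symm
  rw [← lintegral_add_compl (fun t => g |t|) measurableSet_Ioi, Set.compl_Ioi, h2, h1, two_mul]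

theorem lintegral_abs_rpow_of_abs_lt (p : ℝ) (hp : -1 < p) (R : ℝ) (hR : 0 ≤ R) :
    ∫⁻ t : ℝ, (if |t| < R then ENNReal.ofReal (|t| ^ p) else 0) =
      ENNReal.ofReal (2 * (R ^ (p + 1) / (p + 1))) := by
  rw [lintegral_comp_abs (fun t => if t < R then ENNReal.ofReal (t ^ p) else 0)]
  have h1 : ∫⁻ t in Set.Ioi (0 : ℝ), (if t < R then ENNReal.ofReal (t ^ p) else 0) =
      ∫⁻ t in Set.Ioo 0 R, ENNReal.ofReal (t ^ p) := by
    have : (fun t : ℝ => if t < R then ENNReal.ofReal (t ^ p) else 0) =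
        (Set.Iio R).indicator fun t => ENNReal.ofReal (t ^ p) := by
      ext t; simp [Set.indicator_apply]
    rw [this, setLIntegral_indicator measurableSet_Iio, Set.inter_comm, Set.Ioi_inter_Iio]
  have hi : IntegrableOn (fun t : ℝ => t ^ p) (Set.Ioc 0 R) :=
    (intervalIntegrable_iff_integrableOn_Ioc_of_le hR).1
      (intervalIntegral.intervalIntegrable_rpow' hp)
  rw [h1, setLIntegral_congr Ioo_ae_eq_Ioc, ← ofReal_integral_eq_lintegral_ofReal hi
    ((ae_restrict_mem measurableSet_Ioc).mono fun t ht => Real.rpow_nonneg ht.1.le _),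
    ← intervalIntegral.integral_of_le hR, integral_rpow (Or.inl hp),
    Real.zero_rpow (by linarith), sub_zero, ENNReal.ofReal_mul (by norm_num)]
  simp

theorem lintegral_abs_rpow_of_le_abs (p : ℝ) (hp : p < -1) (R : ℝ) (hR : 0 < R) :
    ∫⁻ t : ℝ, (if R ≤ |t| then ENNReal.ofReal (|t| ^ p) else 0) =
      ENNReal.ofReal (2 * (R ^ (p + 1) / (-(p + 1)))) := by
  rw [lintegral_comp_abs (fun t => if R ≤ t then ENNReal.ofReal (t ^ p) else 0)]
  have h1 : ∫⁻ t in Set.Ioi (0 : ℝ), (if R ≤ t then ENNReal.ofReal (t ^ p) else 0) =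
      ∫⁻ t in Set.Ici R, ENNReal.ofReal (t ^ p) := by
    have : (fun t : ℝ => if R ≤ t then ENNReal.ofReal (t ^ p) else 0) =
        (Set.Ici R).indicator fun t => ENNReal.ofReal (t ^ p) := by
      ext t; simp [Set.indicator_apply]
    rw [this, setLIntegral_indicator measurableSet_Ici, Set.inter_eq_left.2]
    exact fun t ht => hR.trans_le ht
  rw [h1, setLIntegral_congr Ioi_ae_eq_Ici.symm, ← ofReal_integral_eq_lintegral_ofReal
    (integrableOn_Ioi_rpow_of_lt hp hR)
    ((ae_restrict_mem measurableSet_Ioi).mono fun t ht => Real.rpow_nonneg (hR.trans ht).le _),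
    integral_Ioi_rpow_of_lt hp hR, ENNReal.ofReal_mul (by norm_num)]
  rw [div_neg, neg_div]
  simp

theorem lintegral_cauchy (a h : ℝ) (hh : 0 < h) :
    ∫⁻ t : ℝ, ENNReal.ofReal (1 / ((t - a) ^ 2 + h ^ 2)) = ENNReal.ofReal (Real.pi / h) := by
  rw [lintegral_sub_right_eq_self (fun t => ENNReal.ofReal (1 / (t ^ 2 + h ^ 2))) a]
  have h1 : ∀ t : ℝ, 1 / (t ^ 2 + h ^ 2) = (1 / h ^ 2) * (1 + (t / h) ^ 2)⁻¹ := fun t => by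
    field_simp
    ring
  simp only [h1]
  rw [← ofReal_integral_eq_lintegral_ofReal
    ((integrable_inv_one_add_sq.comp_div hh.ne').const_mul _) (Eventually.of_forall fun t => by
      dsimp; positivity), integral_const_mul,
    Measure.integral_comp_div (fun t : ℝ => (1 + t ^ 2)⁻¹), integral_univ_inv_one_add_sq,
    abs_of_pos hh, smul_eq_mul]
  congr 1
  field_simp

/-! ### Integrability of the inverse weight -/

theorem abs_coord_le_norm {d : ℕ} (ξ : Eu d) (j : Fin d) : |ξ j| ≤ ‖ξ‖ := by
  simpa using PiLp.norm_apply_le ξ j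

/-- Since `|ξ j| ≤ ‖ξ‖` and `e ≤ 0`, the power can be shared equally among the d - 1 transverse
coordinates, leaving the first one free for a singular factor of its own. Each transverse exponent
exceeds -1 exactly when e > -(d - 1). -/
theorem norm_rpow_le_prod {d : ℕ} [NeZero d] (hd : 2 ≤ d) {e : ℝ} (he : e ≤ 0) (ξ : Eu d)
    (hξ : ∀ i, ξ i ≠ 0) :
    ‖ξ‖ ^ e ≤ ∏ j ∈ Finset.univ.erase (0 : Fin d), |ξ j| ^ (e / ((d : ℝ) - 1)) := by
  have hd' : (2 : ℝ) ≤ d := by exact_mod_cast hd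
  have h0 : ξ ≠ 0 := fun h => hξ 0 (by simp [h])
  have hn : 0 < ‖ξ‖ := norm_pos_iff.2 h0
  calc ‖ξ‖ ^ e = ∏ _j ∈ Finset.univ.erase (0 : Fin d), ‖ξ‖ ^ (e / ((d : ℝ) - 1)) := by
        rw [Finset.prod_const, Finset.card_erase_of_mem (Finset.mem_univ _), Finset.card_univ,
          Fintype.card_fin, ← Real.rpow_natCast, ← Real.rpow_mul hn.le,
          Nat.cast_sub (by omega), Nat.cast_one, div_mul_cancel₀ _ (by linarith)]
    _ ≤ _ := by
        refine Finset.prod_le_prod (fun _ _ => by positivity) fun j _ => ?_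
        exact Real.rpow_le_rpow_of_nonpos (abs_pos.2 (hξ j)) (abs_coord_le_norm ξ j)
          (div_nonpos_of_nonpos_of_nonneg he (by linarith))

/-- At `θ = 1 / 2` the last inequality is the hypothesis; its strictness leaves room for a slightly
smaller `θ`. -/
theorem exists_lt_half {x y δ : ℝ} (hδ : 0 < δ) (h : x + δ < y) :
    ∃ θ, 0 ≤ θ ∧ θ < 1 / 2 ∧ x + 2 * δ * (1 - θ) < y := by
  refine ⟨max 0 (1 / 2 - (y - x - δ) / (4 * δ)), le_max_left _ _, ?_, ?_⟩
  · refine max_lt (by norm_num) ?_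
    have : 0 < (y - x - δ) / (4 * δ) := by apply div_pos <;> linarith
    linarith
  · have h1 := le_max_right 0 (1 / 2 - (y - x - δ) / (4 * δ))
    have h2 : 2 * δ * (1 - (1 / 2 - (y - x - δ) / (4 * δ))) = δ + (y - x - δ) / 2 := by
      field_simp
      ring
    have h3 : 2 * δ * (1 - max 0 (1 / 2 - (y - x - δ) / (4 * δ))) ≤
        2 * δ * (1 - (1 / 2 - (y - x - δ) / (4 * δ))) := by gcongr
    linarith

/-- `⟨ξ⟩²/ω` is integrable. -/
theorem lintegral_one_add_norm_sq_div_omega_lt_top {d : ℕ} [NeZero d] (hd : 2 ≤ d) {t r δ : ℝ}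
    (hδ : 0 < δ) (hdim : 1 + δ - 2 * r < d) (ht : (d : ℝ) / 2 + 1 < t) :
    ∫⁻ ξ : Eu d, ENNReal.ofReal ((1 + ‖ξ‖ ^ 2) / (omega (d := d) t r δ).toFun ξ) < ⊤ := by
  have hd' : (2 : ℝ) ≤ d := by exact_mod_cast hd
  -- `θ < 1/2` makes `|ξ 0| ^ (-2θ)` locally integrable. The remaining power of `‖ξ‖` must be
  -- integrable in d - 1 dimensions; in the limit θ → 1/2 this condition is `hdim`.
  obtain ⟨θ, hθ0, hθ, hθd⟩ := exists_lt_half (x := 1 - 2 * r) (y := d) hδ (by linarith)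
  -- Capped at 0 because `norm_rpow_le_prod` needs a nonpositive exponent; for `‖ξ‖ < 1`, lowering
  -- the exponent only enlarges the power.
  set e : ℝ := min (2 * r - 2 * δ * (1 - θ)) 0 with he
  have he0 : e ≤ 0 := min_le_right _ _
  have he1 : -((d : ℝ) - 1) < e := lt_min (by linarith) (by linarith)
  have he2 : -1 < e / ((d : ℝ) - 1) := by rw [lt_div_iff₀ (by linarith)]; linarith
  set g : ℝ → ℝ≥0∞ := fun x => if |x| < 1 then ENNReal.ofReal (|x| ^ (-2 * θ)) else 0 with hg
  set h : ℝ → ℝ≥0∞ :=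
    fun x => if |x| < 1 then ENNReal.ofReal (|x| ^ (e / ((d : ℝ) - 1))) else 0 with hh
  have hgm : Measurable g := Measurable.ite (measurableSet_lt (by fun_prop) (by fun_prop))
    (by fun_prop) (by fun_prop)
  have hhm : Measurable h := Measurable.ite (measurableSet_lt (by fun_prop) (by fun_prop))
    (by fun_prop) (by fun_prop)
  set F : Eu d → ℝ≥0∞ := fun ξ => if ‖ξ‖ < 1 then
    ENNReal.ofReal (|ξ 0| ^ (-2 * θ) * ‖ξ‖ ^ e) else 0 with hF
  have hFm : Measurable F := Measurable.ite (measurableSet_lt (by fun_prop) (by fun_prop))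
    (by fun_prop) (by fun_prop)
  have hint : ∫⁻ ξ, F ξ < ⊤ := by
    refine (lintegral_le_slab F g h hgm hhm ?_).trans_lt ?_
    · filter_upwards [ae_coord_ne_zero (d := d)] with ξ hξ
      simp only [hF]
      split_ifs with h1
      · have h2 : ∀ j, |ξ j| < 1 := fun j => (abs_coord_le_norm ξ j).trans_lt h1
        simp only [hg, hh, h2, if_true]
        rw [← ENNReal.ofReal_prod_of_nonneg (fun _ _ => by positivity),
          ← ENNReal.ofReal_mul (by positivity)]
        gcongr
        exact norm_rpow_le_prod hd he0 ξ hξ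
      · exact zero_le
    · rw [lintegral_abs_rpow_of_abs_lt _ (by linarith) _ zero_le_one,
        lintegral_abs_rpow_of_abs_lt _ he2 _ zero_le_one]
      exact ENNReal.mul_lt_top ENNReal.ofReal_lt_top (ENNReal.pow_lt_top ENNReal.ofReal_lt_top)
  have hint2 : ∫⁻ ξ : Eu d, ENNReal.ofReal ((1 + ‖ξ‖ ^ 2) ^ (-(2 * (t - 1)) / 2)) < ⊤ :=
    (integrable_rpow_neg_one_add_norm_sq (E := Eu d) (μ := volume) (r := 2 * (t - 1))
      (by simp; linarith)).lintegral_lt_top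
  calc _ ≤ ∫⁻ ξ : Eu d, ENNReal.ofReal 2 * F ξ + ENNReal.ofReal ((1 + ‖ξ‖ ^ 2) ^ (-(2 * (t - 1)) / 2)) := by
        refine lintegral_mono_ae ?_
        filter_upwards [ae_coord_ne_zero (d := d)] with ξ hξ
        have hn : 0 < ‖ξ‖ := norm_pos_iff.2 fun h => hξ 0 (by simp [h])
        have h0 : 0 < |ξ 0| := abs_pos.2 (hξ 0)
        simp only [omega, hF]
        split_ifs with h1
        · refine le_add_right ?_
          rw [← ENNReal.ofReal_mul (by norm_num)]
          gcongr
          -- The sum dominates the weighted geometric mean of its two terms.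
          have hs : |ξ 0| ^ (2 * θ) * ‖ξ‖ ^ (2 * δ * (1 - θ)) ≤ ξ 0 ^ 2 + ‖ξ‖ ^ (2 * δ) := by
            set S := ξ 0 ^ 2 + ‖ξ‖ ^ (2 * δ) with hS
            have hS0 : 0 < S := by positivity
            have hx : |ξ 0| ^ (2 * θ) ≤ S ^ θ := by
              rw [Real.rpow_mul (abs_nonneg _)]
              gcongr
              rw [Real.rpow_two, sq_abs]
              linarith [Real.rpow_nonneg hn.le (2 * δ)]
            have hy : ‖ξ‖ ^ (2 * δ * (1 - θ)) ≤ S ^ (1 - θ) := by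
              rw [Real.rpow_mul hn.le]
              gcongr
              · linarith
              · linarith [sq_nonneg (ξ 0)]
            calc _ ≤ S ^ θ * S ^ (1 - θ) := by gcongr
              _ = S := by rw [← Real.rpow_add hS0]; simp
          have hee : ‖ξ‖ ^ (2 * r - 2 * δ * (1 - θ)) ≤ ‖ξ‖ ^ e :=
            Real.rpow_le_rpow_of_exponent_ge hn h1.le (min_le_left _ _)
          calc (1 + ‖ξ‖ ^ 2) / ((ξ 0 ^ 2 + ‖ξ‖ ^ (2 * δ)) / ‖ξ‖ ^ (2 * r))
              ≤ 2 / ((|ξ 0| ^ (2 * θ) * ‖ξ‖ ^ (2 * δ * (1 - θ))) / ‖ξ‖ ^ (2 * r)) := by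
                gcongr
                nlinarith
            _ = 2 * (|ξ 0| ^ (-2 * θ) * ‖ξ‖ ^ (2 * r - 2 * δ * (1 - θ))) := by
                rw [Real.rpow_sub hn, neg_mul, Real.rpow_neg h0.le]
                field_simp
            _ ≤ _ := by gcongr
        · refine le_add_left ?_
          gcongr
          have h2 : (0 : ℝ) < 1 + ‖ξ‖ ^ 2 := by positivity
          rw [show -(2 * (t - 1)) / 2 = 1 - t by ring, Real.rpow_sub h2, Real.rpow_one]
    _ = ENNReal.ofReal 2 * (∫⁻ ξ, F ξ) + _ := by
        rw [lintegral_add_left (hFm.const_mul _), lintegral_const_mul _ hFm]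
    _ < ⊤ := ENNReal.add_lt_top.2 ⟨ENNReal.mul_lt_top (by simp) hint, hint2⟩

/-! ### The kernel of the high-high to low interaction -/

/-- The square of the kernel that controls the contribution to the frequency `ξ` of two
frequencies `η` and `ξ - η` much larger than `ξ`. -/
def kernel {d : ℕ} [NeZero d] (r δ : ℝ) (ξ η : Eu d) : ℝ :=
  if ‖η‖ < 1 ∧ ‖ξ‖ < ‖η‖ then
    ‖η‖ ^ (4 * r) * (‖ξ‖ ^ (-2 * r) * min 1 (ξ 0 ^ 2 / ‖η‖ ^ (2 * δ))) /
      ((ξ 0 - η 0) ^ 2 + ‖η‖ ^ (2 * δ))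
  else 0

theorem kernel_nonneg {d : ℕ} [NeZero d] (r δ : ℝ) (ξ η : Eu d) : 0 ≤ kernel r δ ξ η := by
  unfold kernel
  split_ifs <;> positivity

theorem measurable_kernel {d : ℕ} [NeZero d] (r δ : ℝ) :
    Measurable fun p : Eu d × Eu d => kernel r δ p.1 p.2 := by
  unfold kernel
  have hS : MeasurableSet {p : Eu d × Eu d | ‖p.2‖ < 1 ∧ ‖p.1‖ < ‖p.2‖} :=
    MeasurableSet.inter (s₁ := {p : Eu d × Eu d | ‖p.2‖ < 1})
      (s₂ := {p : Eu d × Eu d | ‖p.1‖ < ‖p.2‖})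
      (measurableSet_lt (by fun_prop) (by fun_prop)) (measurableSet_lt (by fun_prop) (by fun_prop))
  refine Measurable.ite hS ?_ (by fun_prop)
  fun_prop

/-- min(1, y) ≤ y^b for every b in [0, 1]. The free exponent `b` decides how much vanishing in ξ₁ is
spent on the singularity |ξ|^{-2r}, at the price of a negative power of `ρ`. -/
theorem min_one_sq_div_le {x ρ δ b : ℝ} (hx : 0 < x) (hρ : 0 < ρ) (hb0 : 0 ≤ b) (hb1 : b ≤ 1) :
    min 1 (x ^ 2 / ρ ^ (2 * δ)) ≤ x ^ (2 * b) * ρ ^ (-2 * δ * b) := by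
  have hy : 0 < x ^ 2 / ρ ^ (2 * δ) := by positivity
  have h1 : (x ^ 2 / ρ ^ (2 * δ)) ^ b = x ^ (2 * b) * ρ ^ (-2 * δ * b) := by
    rw [Real.div_rpow (by positivity) (by positivity), ← Real.rpow_mul hρ.le, ← Real.rpow_two,
      ← Real.rpow_mul hx.le, neg_mul, neg_mul, Real.rpow_neg hρ.le]
    rfl
  rw [← h1]
  rcases le_total 1 (x ^ 2 / ρ ^ (2 * δ)) with h | h
  · exact (min_le_left _ _).trans (Real.one_le_rpow h hb0)
  · refine (min_le_right _ _).trans ?_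
    calc _ = (x ^ 2 / ρ ^ (2 * δ)) ^ (1 : ℝ) := (Real.rpow_one _).symm
      _ ≤ _ := Real.rpow_le_rpow_of_exponent_ge hy h hb1

/-- A bound for the mass of the kernel with a one-dimensional majorant. -/
theorem lintegral_kernel_le_of_bound {d : ℕ} [NeZero d] {r δ : ℝ} (η : Eu d) (hη : 0 < ‖η‖)
    (c : ℝ) (hc : 0 ≤ c) (h : ℝ → ℝ≥0∞) (hh : Measurable h)
    (hbd : ∀ ξ : Eu d, (∀ i, ξ i ≠ 0) → ‖ξ‖ < ‖η‖ →
      ENNReal.ofReal (‖ξ‖ ^ (-2 * r) * min 1 (ξ 0 ^ 2 / ‖η‖ ^ (2 * δ))) ≤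
        ENNReal.ofReal c * ∏ j ∈ Finset.univ.erase (0 : Fin d), h (ξ j)) :
    ∫⁻ ξ, ENNReal.ofReal (kernel r δ ξ η) ≤
      ENNReal.ofReal (‖η‖ ^ (4 * r) * c * (Real.pi / ‖η‖ ^ δ)) * (∫⁻ t, h t) ^ (d - 1) := by
  have hsq : ‖η‖ ^ (2 * δ) = (‖η‖ ^ δ) ^ 2 := by
    rw [mul_comm, Real.rpow_mul hη.le, Real.rpow_two]
  -- After `hbd`, the first coordinate occurs only in 1/((ξ₁ - η₁)² + |η|^{2δ}), whose integral is
  -- π/|η|^δ whatever η₁ is.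
  refine (lintegral_le_slab _ (fun t => ENNReal.ofReal (‖η‖ ^ (4 * r) * c) *
    ENNReal.ofReal (1 / ((t - η 0) ^ 2 + (‖η‖ ^ δ) ^ 2))) h (by fun_prop) hh ?_).trans_eq ?_
  · filter_upwards [ae_coord_ne_zero (d := d)] with ξ hξ
    rw [kernel]
    split_ifs with h1
    · calc _ = ENNReal.ofReal (‖η‖ ^ (4 * r)) *
            ENNReal.ofReal (‖ξ‖ ^ (-2 * r) * min 1 (ξ 0 ^ 2 / ‖η‖ ^ (2 * δ))) *
            ENNReal.ofReal (1 / ((ξ 0 - η 0) ^ 2 + (‖η‖ ^ δ) ^ 2)) := by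
            rw [← ENNReal.ofReal_mul (by positivity), ← ENNReal.ofReal_mul (by positivity), ← hsq,
              mul_one_div]
        _ ≤ ENNReal.ofReal (‖η‖ ^ (4 * r)) *
            (ENNReal.ofReal c * ∏ j ∈ Finset.univ.erase (0 : Fin d), h (ξ j)) *
            ENNReal.ofReal (1 / ((ξ 0 - η 0) ^ 2 + (‖η‖ ^ δ) ^ 2)) := by
            gcongr
            exact hbd ξ hξ h1.2
        _ = _ := by
            rw [ENNReal.ofReal_mul (by positivity : (0 : ℝ) ≤ ‖η‖ ^ (4 * r))]
            ring
    · simp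
  · rw [lintegral_const_mul _ (by fun_prop), lintegral_cauchy _ _ (by positivity),
      ← ENNReal.ofReal_mul (by positivity)]

/-- With `b = r - a` in `min_one_sq_div_le`, the factor |ξ₁|^{2b} cancels part of |ξ|^{-2r} and
leaves |ξ|^{-2a}, integrable over the transverse cube |ξ_j| < |η| because 2a < d - 1. In `hexp`, 4r
comes from the kernel, -2δ(r - a) from the minimum, -δ from the Cauchy density and d - 1 - 2a from
the cube. -/
theorem lintegral_kernel_le_of_exponent {d : ℕ} [NeZero d] (hd : 2 ≤ d) {r δ a : ℝ}
    (ha0 : 0 ≤ a) (har : a ≤ r) (hr1 : r ≤ 1) (had : 2 * a < (d : ℝ) - 1)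
    (hexp : 0 ≤ 4 * r - 2 * δ * (r - a) - δ + (d - 1 - 2 * a)) :
    ∃ C : ℝ≥0∞, C ≠ ⊤ ∧ ∀ η : Eu d, 0 < ‖η‖ → ‖η‖ < 1 →
      ∫⁻ ξ, ENNReal.ofReal (kernel r δ ξ η) ≤ C := by
  have hd' : (2 : ℝ) ≤ d := by exact_mod_cast hd
  set x : ℝ := -(2 * a) / ((d : ℝ) - 1) with hx
  have hx1 : -1 < x := by rw [hx, lt_div_iff₀ (by linarith)]; linarith
  have hx0 : 0 < x + 1 := by linarith
  refine ⟨ENNReal.ofReal (Real.pi * (2 / (x + 1)) ^ (d - 1)), ENNReal.ofReal_ne_top,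
    fun η hη hη1 => ?_⟩
  refine (lintegral_kernel_le_of_bound η hη (‖η‖ ^ (-2 * δ * (r - a))) (by positivity)
    (fun t => if |t| < ‖η‖ then ENNReal.ofReal (|t| ^ x) else 0)
    (Measurable.ite (measurableSet_lt (by fun_prop) (by fun_prop)) (by fun_prop) (by fun_prop))
    ?_).trans ?_
  · intro ξ hξ hlt
    have hn : 0 < ‖ξ‖ := norm_pos_iff.2 fun h => hξ 0 (by simp [h])
    have h0 : 0 < |ξ 0| := abs_pos.2 (hξ 0)
    have h2 : ∀ j, |ξ j| < ‖η‖ := fun j => (abs_coord_le_norm ξ j).trans_lt hlt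
    simp only [h2, if_true]
    rw [← ENNReal.ofReal_prod_of_nonneg (fun _ _ => by positivity),
      ← ENNReal.ofReal_mul (by positivity)]
    refine ENNReal.ofReal_le_ofReal ?_
    have h3 := min_one_sq_div_le (δ := δ) h0 hη (b := r - a) (by linarith) (by linarith)
    rw [sq_abs] at h3
    have h4 : |ξ 0| ^ (2 * (r - a)) ≤ ‖ξ‖ ^ (2 * (r - a)) :=
      Real.rpow_le_rpow h0.le (abs_coord_le_norm ξ 0) (by linarith)
    calc _ ≤ ‖ξ‖ ^ (-2 * r) * (‖ξ‖ ^ (2 * (r - a)) * ‖η‖ ^ (-2 * δ * (r - a))) := by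
          gcongr
          exact h3.trans (by gcongr)
      _ = ‖η‖ ^ (-2 * δ * (r - a)) * ‖ξ‖ ^ (-(2 * a)) := by
          rw [← mul_assoc, ← Real.rpow_add hn, mul_comm]
          congr 2
          ring
      _ ≤ _ := by
          gcongr
          exact norm_rpow_le_prod hd (by linarith) ξ hξ
  · rw [lintegral_abs_rpow_of_abs_lt _ hx1 _ hη.le, ← ENNReal.ofReal_pow (by positivity),
      ← ENNReal.ofReal_mul (by positivity)]
    refine ENNReal.ofReal_le_ofReal ?_
    have h5 : (‖η‖ ^ (x + 1)) ^ (d - 1) = ‖η‖ ^ ((d : ℝ) - 1 - 2 * a) := by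
      rw [← Real.rpow_natCast, ← Real.rpow_mul hη.le, Nat.cast_sub (by omega), Nat.cast_one, hx]
      congr 1
      have : (d : ℝ) - 1 ≠ 0 := by linarith
      field_simp
      ring
    calc _ = ‖η‖ ^ (4 * r) * ‖η‖ ^ (-2 * δ * (r - a)) * ‖η‖ ^ (-δ) * ‖η‖ ^ ((d : ℝ) - 1 - 2 * a) *
          (Real.pi * (2 / (x + 1)) ^ (d - 1)) := by
          rw [← h5, Real.rpow_neg hη.le, div_pow, mul_pow, div_pow]
          ring
      _ = ‖η‖ ^ (4 * r - 2 * δ * (r - a) - δ + (d - 1 - 2 * a)) *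
          (Real.pi * (2 / (x + 1)) ^ (d - 1)) := by
          rw [← Real.rpow_add hη, ← Real.rpow_add hη, ← Real.rpow_add hη]
          congr 2
          ring
      _ ≤ 1 * (Real.pi * (2 / (x + 1)) ^ (d - 1)) := by
          gcongr
          exact Real.rpow_le_one hη.le hη1.le hexp
      _ = _ := one_mul _

/-- For r > 1/2 the power |ξ 1|^{-2r} is integrable at infinity but not at 0 in the single
transverse variable, so it is cut off at ρ = |η|^δ. Below ρ, the choice b = r in `min_one_sq_div_le`
gives the constant ρ^{-2r}. Both pieces contribute a multiple of ρ^{1-2r}; with |η|^{4r} and the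
Cauchy mass π/ρ the total is a multiple of |η|^{2r(2-δ)}, which is bounded because δ ≤ 2. -/
theorem lintegral_kernel_le_dim_two [NeZero 2] {r δ : ℝ} (hr : 1 / 2 < r) (hr1 : r ≤ 1)
    (hδ2 : δ ≤ 2) :
    ∃ C : ℝ≥0∞, C ≠ ⊤ ∧ ∀ η : Eu 2, 0 < ‖η‖ → ‖η‖ < 1 →
      ∫⁻ ξ, ENNReal.ofReal (kernel r δ ξ η) ≤ C := by
  have hr' : 0 < -(-2 * r + 1) := by linarith
  refine ⟨ENNReal.ofReal (Real.pi * (2 + 2 / (-(-2 * r + 1)))), ENNReal.ofReal_ne_top,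
    fun η hη hη1 => ?_⟩
  set ρ := ‖η‖ ^ δ with hρ
  have hρ0 : 0 < ρ := by positivity
  have hρe : ρ ^ (-2 * r) = ‖η‖ ^ (-2 * δ * r) := by
    rw [hρ, ← Real.rpow_mul hη.le]
    congr 1
    ring
  set h₁ : ℝ → ℝ≥0∞ := fun t => if |t| < ρ then ENNReal.ofReal (|t| ^ (0 : ℝ)) else 0 with hh1
  set h₂ : ℝ → ℝ≥0∞ := fun t => if ρ ≤ |t| then ENNReal.ofReal (|t| ^ (-2 * r)) else 0 with hh2
  have hm1 : Measurable h₁ :=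
    Measurable.ite (measurableSet_lt (by fun_prop) (by fun_prop)) (by fun_prop) (by fun_prop)
  have hm2 : Measurable h₂ :=
    Measurable.ite (measurableSet_le (by fun_prop) (by fun_prop)) (by fun_prop) (by fun_prop)
  refine (lintegral_kernel_le_of_bound η hη 1 zero_le_one
    (fun t => ENNReal.ofReal (ρ ^ (-2 * r)) * h₁ t + h₂ t) (by fun_prop) ?_).trans ?_
  · intro ξ hξ hlt
    have hn : 0 < ‖ξ‖ := norm_pos_iff.2 fun h => hξ 0 (by simp [h])
    have h0 : 0 < |ξ 0| := abs_pos.2 (hξ 0)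
    have he : Finset.univ.erase (0 : Fin 2) = {1} := by ext j; fin_cases j <;> simp
    rw [he, Finset.prod_singleton, ENNReal.ofReal_one, one_mul]
    rcases lt_or_ge |ξ 1| ρ with h | h
    · simp only [hh1, hh2, h, not_le.2 h, if_true, if_false, Real.rpow_zero, ENNReal.ofReal_one,
        mul_one, add_zero]
      gcongr
      have h3 := min_one_sq_div_le (δ := δ) h0 hη (b := r) (by linarith) (by linarith)
      rw [sq_abs] at h3
      have h4 : |ξ 0| ^ (2 * r) ≤ ‖ξ‖ ^ (2 * r) :=
        Real.rpow_le_rpow h0.le (abs_coord_le_norm ξ 0) (by linarith)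
      calc _ ≤ ‖ξ‖ ^ (-2 * r) * (‖ξ‖ ^ (2 * r) * ‖η‖ ^ (-2 * δ * r)) := by
            gcongr
            exact h3.trans (by gcongr)
        _ = _ := by
            rw [← mul_assoc, ← Real.rpow_add hn, hρe]
            simp
    · simp only [hh1, hh2, h, not_lt.2 h, if_true, if_false, mul_zero, zero_add]
      gcongr
      calc _ ≤ |ξ 1| ^ (-2 * r) * 1 := by
            gcongr ?_ * ?_
            · exact Real.rpow_le_rpow_of_nonpos (abs_pos.2 (hξ 1)) (abs_coord_le_norm ξ 1)
                (by linarith)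
            · exact min_le_left _ _
        _ = _ := mul_one _
  · rw [lintegral_add_left (by fun_prop), lintegral_const_mul _ hm1,
      lintegral_abs_rpow_of_abs_lt _ (by norm_num) _ hρ0.le,
      lintegral_abs_rpow_of_le_abs _ (by linarith) _ hρ0, ← ENNReal.ofReal_mul (by positivity),
      ← ENNReal.ofReal_add (by positivity) (by positivity), ← ENNReal.ofReal_pow (by positivity),
      ← ENNReal.ofReal_mul (by positivity)]
    refine ENNReal.ofReal_le_ofReal ?_
    have h6 : ρ ^ (-2 * r + 1) = ρ ^ (-2 * r) * ρ := by rw [Real.rpow_add hρ0, Real.rpow_one]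
    calc _ = ‖η‖ ^ (4 * r) * ρ ^ (-2 * r) * (Real.pi * (2 + 2 / (-(-2 * r + 1)))) := by
          rw [h6, ← hρ]
          simp only [zero_add, Real.rpow_one, div_one, Nat.add_one_sub_one, pow_one, mul_one]
          field_simp
      _ = ‖η‖ ^ (2 * r * (2 - δ)) * (Real.pi * (2 + 2 / (-(-2 * r + 1)))) := by
          rw [hρe, ← Real.rpow_add hη]
          congr 2
          ring
      _ ≤ 1 * (Real.pi * (2 + 2 / (-(-2 * r + 1)))) := by
          gcongr
          exact Real.rpow_le_one hη.le hη1.le (mul_nonneg (by linarith) (by linarith))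
      _ = _ := one_mul _

/-- If 2r < d - 1, take `a = r`: the exponent is then 2r + d - 1 - δ, positive by `hdim`. As r ≤ 1,
the only remaining cases are (d, r) = (2, 1/2) and (3, 1), both with 2r = d - 1, where `a` has to
lie slightly below `r`. -/
theorem exists_exponent {d : ℕ} (hd : 2 ≤ d) {r δ : ℝ} (hr0 : 0 ≤ r) (hr1 : r ≤ 1) (hδ : 1 < δ)
    (hdim : 1 + δ - 2 * r < d) (h2 : ¬ (d = 2 ∧ 1 / 2 < r)) :
    ∃ a, 0 ≤ a ∧ a ≤ r ∧ 2 * a < (d : ℝ) - 1 ∧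
      0 ≤ 4 * r - 2 * δ * (r - a) - δ + (d - 1 - 2 * a) := by
  have hd' : (2 : ℝ) ≤ d := by exact_mod_cast hd
  by_cases h : 2 * r < (d : ℝ) - 1
  · exact ⟨r, hr0, le_rfl, h, by linarith⟩
  have hrd : 2 * r = (d : ℝ) - 1 := by
    rcases Nat.lt_or_ge d 3 with h3 | h3
    · obtain rfl : d = 2 := by omega
      have := not_lt.1 fun hh => h2 ⟨rfl, hh⟩
      push_cast at h ⊢
      linarith
    · have : (3 : ℝ) ≤ d := by exact_mod_cast h3
      linarith
  have hr2 : 1 / 2 ≤ r := by linarith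
  -- Replacing `a = r` by `r - ε` changes the exponent by 2ε - 2δε. The second entry keeps it
  -- nonnegative, the first keeps `r - ε ≥ 0`.
  set ε := min (1 / 2) ((2 * r + d - 1 - δ) / (2 * δ)) with hε
  have hpos : 0 < 2 * r + d - 1 - δ := by linarith
  have hε0 : 0 < ε := lt_min (by norm_num) (by positivity)
  have hε1 : ε ≤ 1 / 2 := min_le_left _ _
  have hε2 : ε * (2 * δ) ≤ 2 * r + d - 1 - δ :=
    (le_div_iff₀ (by linarith)).1 (min_le_right _ _)
  refine ⟨r - ε, by linarith, by linarith, by linarith, ?_⟩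
  nlinarith

theorem lintegral_kernel_le {d : ℕ} [NeZero d] (hd : 2 ≤ d) {r δ : ℝ} (hr0 : 0 ≤ r) (hr1 : r ≤ 1)
    (hδ : 1 < δ) (hdim : 1 + δ - 2 * r < d) (hd2 : d = 2 → δ ≤ 2) :
    ∃ C : ℝ≥0∞, C ≠ ⊤ ∧ ∀ η : Eu d, ∫⁻ ξ, ENNReal.ofReal (kernel r δ ξ η) ≤ C := by
  have key : ∃ C : ℝ≥0∞, C ≠ ⊤ ∧ ∀ η : Eu d, 0 < ‖η‖ → ‖η‖ < 1 →
      ∫⁻ ξ, ENNReal.ofReal (kernel r δ ξ η) ≤ C := by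
    by_cases h : d = 2 ∧ 1 / 2 < r
    · obtain ⟨rfl, hr⟩ := h
      exact lintegral_kernel_le_dim_two hr hr1 (hd2 rfl)
    · obtain ⟨a, ha0, har, had, hexp⟩ := exists_exponent hd hr0 hr1 hδ hdim h
      exact lintegral_kernel_le_of_exponent hd ha0 har hr1 had hexp
  obtain ⟨C, hC, h⟩ := key
  refine ⟨C, hC, fun η => ?_⟩
  by_cases h1 : 0 < ‖η‖ ∧ ‖η‖ < 1
  · exact h η h1.1 h1.2
  · have : ∀ ξ : Eu d, kernel r δ ξ η = 0 := fun ξ => by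
      rw [kernel, if_neg]
      exact fun h2 => h1 ⟨(norm_nonneg _).trans_lt h2.2, h2.1⟩
    simp [this]

/-! ### Subadditivity of the weight up to the kernel -/

section Weight

variable {d : ℕ} [NeZero d] {t r δ : ℝ}

theorem omega_of_lt (ξ : Eu d) (h : ‖ξ‖ < 1) :
    (omega (d := d) t r δ).toFun ξ = (ξ 0 ^ 2 + ‖ξ‖ ^ (2 * δ)) / ‖ξ‖ ^ (2 * r) := by
  simp [omega, h]

theorem omega_of_le (ξ : Eu d) (h : 1 ≤ ‖ξ‖) :
    (omega (d := d) t r δ).toFun ξ = (1 + ‖ξ‖ ^ 2) ^ t := by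
  simp [omega, not_lt.2 h]

theorem omega_nonneg (ξ : Eu d) : 0 ≤ (omega (d := d) t r δ).toFun ξ := by
  unfold omega
  dsimp only
  split_ifs <;> positivity

theorem coord_sq_le (ξ : Eu d) : ξ 0 ^ 2 ≤ ‖ξ‖ ^ 2 := by
  rw [← sq_abs]
  exact pow_le_pow_left₀ (abs_nonneg _) (abs_coord_le_norm ξ 0) 2

theorem one_le_mul_omega (ht : 0 ≤ t) (hr0 : 0 ≤ r) (hδ : 0 < δ) (η : Eu d)
    (h : 1 / 2 ≤ ‖η‖) : 1 ≤ (2 : ℝ) ^ (2 * δ) * (omega (d := d) t r δ).toFun η := by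
  have hn : 0 < ‖η‖ := by linarith
  have hQ : (1 : ℝ) ≤ 2 ^ (2 * δ) := Real.one_le_rpow (by norm_num) (by linarith)
  rcases lt_or_ge ‖η‖ 1 with h1 | h1
  · rw [omega_of_lt _ h1]
    have h2 : ‖η‖ ^ (2 * r) ≤ 1 := Real.rpow_le_one hn.le h1.le (by linarith)
    calc (1 : ℝ) = 2 ^ (2 * δ) * (1 / 2) ^ (2 * δ) := by
          rw [← Real.mul_rpow (by norm_num) (by norm_num)]
          norm_num
      _ ≤ 2 ^ (2 * δ) * ‖η‖ ^ (2 * δ) := by gcongr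
      _ ≤ _ := by
          gcongr
          rw [le_div_iff₀ (by positivity)]
          nlinarith [sq_nonneg (η 0), Real.rpow_nonneg hn.le (2 * δ)]
  · rw [omega_of_le _ h1]
    have : 1 ≤ (1 + ‖η‖ ^ 2) ^ t := Real.one_le_rpow (by nlinarith) ht
    nlinarith

theorem omega_le_of_one_le (ht : 0 ≤ t) (hr0 : 0 ≤ r) (hδ : 0 < δ) (ξ η : Eu d) (hξ : 1 ≤ ‖ξ‖)
    (h : ‖ξ‖ ≤ 2 * ‖η‖) : (omega (d := d) t r δ).toFun ξ ≤
      5 ^ t * 2 ^ (2 * δ) * (omega (d := d) t r δ).toFun η := by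
  have hQ : (1 : ℝ) ≤ 2 ^ (2 * δ) := Real.one_le_rpow (by norm_num) (by linarith)
  rw [omega_of_le _ hξ, mul_assoc]
  rcases lt_or_ge ‖η‖ 1 with h1 | h1
  · have h2 := one_le_mul_omega ht hr0 hδ η (by linarith)
    calc (1 + ‖ξ‖ ^ 2) ^ t ≤ 5 ^ t := by
          gcongr
          nlinarith
      _ ≤ _ := le_mul_of_one_le_right (by positivity) h2
  · rw [omega_of_le _ h1]
    calc (1 + ‖ξ‖ ^ 2) ^ t ≤ (5 * (1 + ‖η‖ ^ 2)) ^ t := by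
          gcongr
          nlinarith
      _ = 5 ^ t * (1 + ‖η‖ ^ 2) ^ t := Real.mul_rpow (by norm_num) (by positivity)
      _ ≤ _ := by
          gcongr
          exact le_mul_of_one_le_left (by positivity) hQ

/-- The isotropic part of the weight needs no kernel: its exponent 2δ - 2r is nonnegative, so the
larger of the two interacting frequencies controls it. -/
theorem norm_rpow_div_le (ht : 0 ≤ t) (hr0 : 0 ≤ r) (hrδ : r ≤ δ) (hδ : 0 < δ) (ξ η : Eu d)
    (hξ0 : 0 < ‖ξ‖) (hξ : ‖ξ‖ < 1) (h : ‖ξ‖ ≤ 2 * ‖η‖) :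
    ‖ξ‖ ^ (2 * δ) / ‖ξ‖ ^ (2 * r) ≤ 2 ^ (2 * δ) * (omega (d := d) t r δ).toFun η := by
  have hη : 0 < ‖η‖ := by linarith
  rw [← Real.rpow_sub hξ0]
  rcases lt_or_ge ‖η‖ 1 with h1 | h1
  · rw [omega_of_lt _ h1]
    calc ‖ξ‖ ^ (2 * δ - 2 * r) ≤ (2 * ‖η‖) ^ (2 * δ - 2 * r) := by
          gcongr
          linarith
      _ = 2 ^ (2 * δ - 2 * r) * (‖η‖ ^ (2 * δ) / ‖η‖ ^ (2 * r)) := by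
          rw [Real.mul_rpow (by norm_num) hη.le, Real.rpow_sub hη]
      _ ≤ _ := by
          gcongr
          · norm_num
          · linarith
          · linarith [sq_nonneg (η 0)]
  · exact (Real.rpow_le_one hξ0.le hξ.le (by linarith)).trans
      (one_le_mul_omega ht hr0 hδ η (by linarith))

/-- Write ξ = η + ζ. If |η| ≥ 1/2, the left side is at most 1 and ω(η) is bounded below; if |η| ≤
2|ξ|, then |ξ|^{-2r} ≤ 4|η|^{-2r}. In both cases ω(η) suffices. Otherwise |ζ| is comparable to |η|,
and the kernel is designed so that, after cancellation of |η|^{4r} and ζ₁² + |η|^{2δ}, its product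
with ω(η)ω(ζ) is at least a constant times |ξ|^{-2r} min(1, ξ₁²/|η|^{2δ}) (η₁² + |η|^{2δ}). -/
theorem coord_sq_div_le (ht : 0 ≤ t) (hr0 : 0 ≤ r) (hr1 : r ≤ 1) (hδ : 0 < δ) (η ζ : Eu d)
    (hξ0 : 0 < ‖η + ζ‖) (hξ : ‖η + ζ‖ < 1) (hη : 0 < ‖η‖)
    (h : (η + ζ) 0 ^ 2 ≤ 4 * η 0 ^ 2) :
    (η + ζ) 0 ^ 2 / ‖η + ζ‖ ^ (2 * r) ≤ 16 * 2 ^ (2 * δ) * ((omega (d := d) t r δ).toFun η +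
      kernel r δ (η + ζ) η *
        ((omega (d := d) t r δ).toFun η * (omega (d := d) t r δ).toFun ζ)) := by
  have hQ : (1 : ℝ) ≤ 2 ^ (2 * δ) := Real.one_le_rpow (by norm_num) (by linarith)
  have hk := kernel_nonneg r δ (η + ζ) η
  have hwη := omega_nonneg (t := t) (r := r) (δ := δ) η
  have hwζ := omega_nonneg (t := t) (r := r) (δ := δ) ζ
  have hk2 := mul_nonneg hk (mul_nonneg hwη hwζ)
  rcases le_or_gt (1 / 2) ‖η‖ with h1 | h1
  · have h2 : (η + ζ) 0 ^ 2 / ‖η + ζ‖ ^ (2 * r) ≤ 1 := by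
      rw [div_le_one (by positivity)]
      refine (coord_sq_le _).trans ?_
      rw [← Real.rpow_two]
      exact Real.rpow_le_rpow_of_exponent_ge hξ0 hξ.le (by linarith)
    have h3 := one_le_mul_omega ht hr0 hδ η h1
    nlinarith
  have hη1 : ‖η‖ < 1 := by linarith
  have hη0 : 0 < ‖η‖ ^ (2 * r) := by positivity
  rcases le_or_gt ‖η‖ (2 * ‖η + ζ‖) with h2 | h2
  · have h3 : ‖η‖ ^ (2 * r) ≤ 4 * ‖η + ζ‖ ^ (2 * r) := by
      calc ‖η‖ ^ (2 * r) ≤ (2 * ‖η + ζ‖) ^ (2 * r) := by gcongr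
        _ = 2 ^ (2 * r) * ‖η + ζ‖ ^ (2 * r) := Real.mul_rpow (by norm_num) hξ0.le
        _ ≤ 2 ^ (2 : ℝ) * ‖η + ζ‖ ^ (2 * r) := by
            gcongr
            · norm_num
            · linarith
        _ = _ := by norm_num
    have h4 : (η + ζ) 0 ^ 2 / ‖η + ζ‖ ^ (2 * r) ≤ 16 * (omega (d := d) t r δ).toFun η := by
      rw [omega_of_lt _ hη1]
      calc (η + ζ) 0 ^ 2 / ‖η + ζ‖ ^ (2 * r) ≤ 4 * η 0 ^ 2 / (‖η‖ ^ (2 * r) / 4) := by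
            gcongr
            linarith
        _ = 16 * (η 0 ^ 2 / ‖η‖ ^ (2 * r)) := by field_simp; ring
        _ ≤ _ := by
            gcongr
            linarith [Real.rpow_nonneg hη.le (2 * δ)]
    nlinarith
  · have hζ1 : ‖η‖ ≤ 2 * ‖ζ‖ := by
      have := norm_sub_le (η + ζ) ζ
      rw [add_sub_cancel_right] at this
      linarith
    have hζ2 : ‖ζ‖ ≤ 2 * ‖η‖ := by
      have := norm_sub_le (η + ζ) η
      rw [add_sub_cancel_left] at this
      linarith
    have hζ3 : ‖ζ‖ < 1 := by
      have := norm_sub_le (η + ζ) η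
      rw [add_sub_cancel_left] at this
      linarith
    have hζ0 : 0 < ‖ζ‖ := by linarith
    have hd1 : ‖ζ‖ ^ (2 * r) ≤ 4 * ‖η‖ ^ (2 * r) := by
      calc ‖ζ‖ ^ (2 * r) ≤ (2 * ‖η‖) ^ (2 * r) := by gcongr
        _ = 2 ^ (2 * r) * ‖η‖ ^ (2 * r) := Real.mul_rpow (by norm_num) hη.le
        _ ≤ 2 ^ (2 : ℝ) * ‖η‖ ^ (2 * r) := by
            gcongr
            · norm_num
            · linarith
        _ = _ := by norm_num
    have hd2 : ‖η‖ ^ (2 * δ) ≤ 2 ^ (2 * δ) * ‖ζ‖ ^ (2 * δ) := by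
      rw [← Real.mul_rpow (by norm_num) hζ0.le]
      gcongr
    have hN : 0 < ζ 0 ^ 2 + ‖η‖ ^ (2 * δ) := by positivity
    have hw : (ζ 0 ^ 2 + ‖η‖ ^ (2 * δ)) / (2 ^ (2 * δ) * (4 * ‖η‖ ^ (2 * r))) ≤
        (omega (d := d) t r δ).toFun ζ := by
      rw [omega_of_lt _ hζ3, ← div_div]
      gcongr
      rw [div_le_iff₀ (by positivity)]
      nlinarith [sq_nonneg (ζ 0)]
    have hk' : kernel r δ (η + ζ) η = ‖η‖ ^ (4 * r) *
        (‖η + ζ‖ ^ (-2 * r) * min 1 ((η + ζ) 0 ^ 2 / ‖η‖ ^ (2 * δ))) /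
        (ζ 0 ^ 2 + ‖η‖ ^ (2 * δ)) := by
      rw [kernel, if_pos ⟨hη1, by linarith⟩]
      congr 3
      simp
    -- If the minimum is 1, the hypothesis on first coordinates is used; otherwise the product with
    -- |η|^{2δ} is already the left side.
    have hmin : (η + ζ) 0 ^ 2 ≤
        4 * (min 1 ((η + ζ) 0 ^ 2 / ‖η‖ ^ (2 * δ)) * (η 0 ^ 2 + ‖η‖ ^ (2 * δ))) := by
      have hp : 0 < ‖η‖ ^ (2 * δ) := by positivity
      rcases le_total 1 ((η + ζ) 0 ^ 2 / ‖η‖ ^ (2 * δ)) with hm | hm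
      · rw [min_eq_left hm]
        linarith
      · rw [min_eq_right hm]
        have : (η + ζ) 0 ^ 2 / ‖η‖ ^ (2 * δ) * ‖η‖ ^ (2 * δ) = (η + ζ) 0 ^ 2 :=
          div_mul_cancel₀ _ hp.ne'
        have h5 : 0 ≤ (η + ζ) 0 ^ 2 / ‖η‖ ^ (2 * δ) := by positivity
        nlinarith [sq_nonneg (η 0), sq_nonneg ((η + ζ) 0)]
    have h4r : ‖η‖ ^ (4 * r) = ‖η‖ ^ (2 * r) * ‖η‖ ^ (2 * r) := by
      rw [← Real.rpow_add hη]
      congr 1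
      ring
    have hmain : (η + ζ) 0 ^ 2 / ‖η + ζ‖ ^ (2 * r) ≤ 16 * 2 ^ (2 * δ) *
        (kernel r δ (η + ζ) η *
          ((omega (d := d) t r δ).toFun η * (omega (d := d) t r δ).toFun ζ)) := by
      calc (η + ζ) 0 ^ 2 / ‖η + ζ‖ ^ (2 * r)
          ≤ 4 * (min 1 ((η + ζ) 0 ^ 2 / ‖η‖ ^ (2 * δ)) * (η 0 ^ 2 + ‖η‖ ^ (2 * δ))) /
            ‖η + ζ‖ ^ (2 * r) := by gcongr
        _ = 16 * 2 ^ (2 * δ) * (kernel r δ (η + ζ) η * ((omega (d := d) t r δ).toFun η *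
            ((ζ 0 ^ 2 + ‖η‖ ^ (2 * δ)) / (2 ^ (2 * δ) * (4 * ‖η‖ ^ (2 * r)))))) := by
            rw [hk', omega_of_lt _ hη1, h4r, neg_mul, Real.rpow_neg hξ0.le]
            field_simp
            ring
        _ ≤ _ := by gcongr
    have : 0 ≤ 16 * 2 ^ (2 * δ) * (omega (d := d) t r δ).toFun η := by positivity
    linarith [mul_add (16 * 2 ^ (2 * δ)) ((omega (d := d) t r δ).toFun η)
      (kernel r δ (η + ζ) η *
        ((omega (d := d) t r δ).toFun η * (omega (d := d) t r δ).toFun ζ))]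

/-- The larger of |η|, |ζ| and the larger of |η₁|, |ζ₁| may belong to different frequencies, so the
two parts of the weight are bounded separately and the kernel appears for both. In the constant, 5^t
serves |ξ| ≥ 1, while 16 + 1 serves the anisotropic and isotropic parts for |ξ| < 1. -/
theorem omega_add_le (ht : 0 ≤ t) (hr0 : 0 ≤ r) (hr1 : r ≤ 1) (hδ : 1 < δ) (η ζ : Eu d)
    (hη : 0 < ‖η‖) (hζ : 0 < ‖ζ‖) (hξ : 0 < ‖η + ζ‖) :
    (omega (d := d) t r δ).toFun (η + ζ) ≤ (5 ^ t + 17) * 2 ^ (2 * δ) *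
      ((omega (d := d) t r δ).toFun η + (omega (d := d) t r δ).toFun ζ +
      kernel r δ (η + ζ) η *
        ((omega (d := d) t r δ).toFun η * (omega (d := d) t r δ).toFun ζ) +
      kernel r δ (η + ζ) ζ *
        ((omega (d := d) t r δ).toFun η * (omega (d := d) t r δ).toFun ζ)) := by
  have hδ0 : 0 < δ := by linarith
  have hQ : (1 : ℝ) ≤ 2 ^ (2 * δ) := Real.one_le_rpow (by norm_num) (by linarith)
  have hP : (0 : ℝ) < 5 ^ t := by positivity
  set Q : ℝ := 2 ^ (2 * δ)
  have hwη := omega_nonneg (t := t) (r := r) (δ := δ) η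
  have hwζ := omega_nonneg (t := t) (r := r) (δ := δ) ζ
  have hk1 := mul_nonneg (kernel_nonneg r δ (η + ζ) η) (mul_nonneg hwη hwζ)
  have hk2 := mul_nonneg (kernel_nonneg r δ (η + ζ) ζ) (mul_nonneg hwη hwζ)
  have hnorm : ‖η + ζ‖ ≤ 2 * ‖η‖ ∨ ‖η + ζ‖ ≤ 2 * ‖ζ‖ := by
    have := norm_add_le η ζ
    rcases le_total ‖η‖ ‖ζ‖ with h | h
    · right; linarith
    · left; linarith
  have hcoord : (η + ζ) 0 ^ 2 ≤ 4 * η 0 ^ 2 ∨ (η + ζ) 0 ^ 2 ≤ 4 * ζ 0 ^ 2 := by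
    have : (η + ζ) 0 = η 0 + ζ 0 := rfl
    rw [this]
    rcases le_total (η 0 ^ 2) (ζ 0 ^ 2) with h | h
    · right; nlinarith [sq_nonneg (η 0 - ζ 0)]
    · left; nlinarith [sq_nonneg (η 0 - ζ 0)]
  set A := (omega (d := d) t r δ).toFun η
  set B := (omega (d := d) t r δ).toFun ζ
  set K₁ := kernel r δ (η + ζ) η * (A * B) with hK1
  set K₂ := kernel r δ (η + ζ) ζ * (A * B) with hK2
  have hcomm : kernel r δ (ζ + η) ζ * (B * A) = K₂ := by rw [hK2, add_comm, mul_comm A]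
  have hPQ : 0 < 5 ^ t * Q := by positivity
  rcases lt_or_ge ‖η + ζ‖ 1 with h1 | h1
  · have h2 : ‖η + ζ‖ ^ (2 * δ) / ‖η + ζ‖ ^ (2 * r) ≤ Q * (A + B) := by
      rcases hnorm with h | h
      · refine (norm_rpow_div_le ht hr0 (by linarith) hδ0 _ η hξ h1 h).trans ?_
        gcongr
        linarith
      · refine (norm_rpow_div_le ht hr0 (by linarith) hδ0 _ ζ hξ h1 h).trans ?_
        gcongr
        linarith
    have h3 : (η + ζ) 0 ^ 2 / ‖η + ζ‖ ^ (2 * r) ≤ 16 * Q * (A + B + K₁ + K₂) := by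
      rcases hcoord with h | h
      · refine (coord_sq_div_le ht hr0 hr1 hδ0 η ζ hξ h1 hη h).trans
          (mul_le_mul_of_nonneg_left ?_ (by positivity))
        linarith
      · have := coord_sq_div_le (t := t) ht hr0 hr1 hδ0 ζ η (by rwa [add_comm])
          (by rwa [add_comm]) hζ (by rwa [add_comm])
        rw [hcomm, add_comm ζ η] at this
        refine this.trans ?_
        gcongr
        linarith
    rw [omega_of_lt _ h1, add_div]
    nlinarith
  · rw [mul_assoc, add_mul]
    have h2 : (omega (d := d) t r δ).toFun (η + ζ) ≤ 5 ^ t * Q * (A + B) := by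
      rcases hnorm with h | h
      · refine (omega_le_of_one_le ht hr0 hδ0 _ η h1 h).trans ?_
        gcongr
        linarith
      · refine (omega_le_of_one_le ht hr0 hδ0 _ ζ h1 h).trans ?_
        gcongr
        linarith
    nlinarith

end Weight

/-! ### Weighted `L²` bounds for convolutions -/

theorem sq_lintegral_mul_le {α : Type*} [MeasurableSpace α] {μ : Measure α} {f g : α → ℝ≥0∞}
    (hf : AEMeasurable f μ) (hg : AEMeasurable g μ) :
    (∫⁻ x, f x * g x ∂μ) ^ 2 ≤ (∫⁻ x, f x ^ 2 ∂μ) * ∫⁻ x, g x ^ 2 ∂μ := by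
  have h := ENNReal.lintegral_mul_le_Lp_mul_Lq μ Real.HolderConjugate.two_two hf hg
  simp only [Pi.mul_apply, ENNReal.rpow_two] at h
  calc _ ≤ _ := pow_le_pow_left' h 2
    _ = _ := by
      rw [mul_pow, ← ENNReal.rpow_natCast, ← ENNReal.rpow_natCast, ← ENNReal.rpow_mul,
        ← ENNReal.rpow_mul]
      norm_num

variable {d : ℕ}

/-- Young's inequality L² * L¹ ⊂ L², by Cauchy–Schwarz on the splitting f g = (f √g) · √g. -/
theorem lintegral_sq_conv_le {f g : Eu d → ℝ≥0∞} (hf : Measurable f) (hg : Measurable g) :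
    ∫⁻ ξ, (∫⁻ η, f η * g (ξ - η)) ^ 2 ≤ (∫⁻ η, f η ^ 2) * (∫⁻ η, g η) ^ 2 := by
  have h1 : ∀ ξ, (∫⁻ η, f η * g (ξ - η)) ^ 2 ≤
      (∫⁻ η, f η ^ 2 * g (ξ - η)) * ∫⁻ η, g η := fun ξ => by
    have h2 : ∀ x : ℝ≥0∞, (x ^ (1 / 2 : ℝ)) ^ 2 = x := fun x => by
      rw [← ENNReal.rpow_two, ← ENNReal.rpow_mul]
      norm_num
    have := sq_lintegral_mul_le (μ := volume)
      (f := fun η => f η * g (ξ - η) ^ (1 / 2 : ℝ)) (g := fun η => g (ξ - η) ^ (1 / 2 : ℝ))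
      (by fun_prop) (by fun_prop)
    simp only [mul_assoc, mul_pow, h2] at this
    simp only [← sq, h2] at this
    rwa [lintegral_sub_left_eq_self g ξ] at this
  calc _ ≤ ∫⁻ ξ, (∫⁻ η, f η ^ 2 * g (ξ - η)) * ∫⁻ η, g η := lintegral_mono h1
    _ = (∫⁻ ξ, ∫⁻ η, f η ^ 2 * g (ξ - η)) * ∫⁻ η, g η := by
        refine lintegral_mul_const _ (Measurable.lintegral_prod_right' (f := fun p : Eu d × Eu d =>
          f p.2 ^ 2 * g (p.1 - p.2)) (by fun_prop))
    _ = (∫⁻ η, ∫⁻ ξ, f η ^ 2 * g (ξ - η)) * ∫⁻ η, g η := by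
        rw [lintegral_lintegral_swap (by fun_prop)]
    _ = _ := by
        have : ∀ η, ∫⁻ ξ, f η ^ 2 * g (ξ - η) = f η ^ 2 * ∫⁻ ξ, g ξ := fun η => by
          rw [lintegral_const_mul _ (by fun_prop), lintegral_sub_right_eq_self g η]
        simp only [this]
        rw [lintegral_mul_const _ (by fun_prop), sq (∫⁻ η, g η), mul_assoc]

/-- Cauchy–Schwarz keeps the kernel with `f` alone, so that after Tonelli only the integral of k² in
ξ at fixed η is needed. -/
theorem lintegral_sq_kernel_conv_le {k : Eu d → Eu d → ℝ≥0∞} {f g : Eu d → ℝ≥0∞} {C : ℝ≥0∞}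
    (hk : Measurable (Function.uncurry k)) (hf : Measurable f) (hg : Measurable g)
    (hC : ∀ η, ∫⁻ ξ, k ξ η ^ 2 ≤ C) :
    ∫⁻ ξ, (∫⁻ η, k ξ η * (f η * g (ξ - η))) ^ 2 ≤
      C * ((∫⁻ η, f η ^ 2) * ∫⁻ η, g η ^ 2) := by
  have hk' : Measurable fun p : Eu d × Eu d => k p.1 p.2 := hk
  have h1 : ∀ ξ, (∫⁻ η, k ξ η * (f η * g (ξ - η))) ^ 2 ≤
      (∫⁻ η, k ξ η ^ 2 * f η ^ 2) * ∫⁻ η, g η ^ 2 := fun ξ => by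
    have hm : Measurable fun η => k ξ η := hk'.comp (measurable_const.prodMk measurable_id)
    have := sq_lintegral_mul_le (μ := volume) (f := fun η => k ξ η * f η)
      (g := fun η => g (ξ - η)) (by fun_prop) (by fun_prop)
    simp only [mul_assoc, mul_pow] at this
    rwa [lintegral_sub_left_eq_self (fun η => g η ^ 2) ξ] at this
  calc _ ≤ ∫⁻ ξ, (∫⁻ η, k ξ η ^ 2 * f η ^ 2) * ∫⁻ η, g η ^ 2 := lintegral_mono h1
    _ = (∫⁻ ξ, ∫⁻ η, k ξ η ^ 2 * f η ^ 2) * ∫⁻ η, g η ^ 2 := by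
        refine lintegral_mul_const _ (Measurable.lintegral_prod_right' (f := fun p : Eu d × Eu d =>
          k p.1 p.2 ^ 2 * f p.2 ^ 2) (by fun_prop))
    _ = (∫⁻ η, ∫⁻ ξ, k ξ η ^ 2 * f η ^ 2) * ∫⁻ η, g η ^ 2 := by
        rw [lintegral_lintegral_swap (by fun_prop)]
    _ ≤ (∫⁻ η, C * f η ^ 2) * ∫⁻ η, g η ^ 2 := by
        gcongr with η
        have hm : Measurable fun ξ => k ξ η := hk'.comp (measurable_id.prodMk measurable_const)
        rw [lintegral_mul_const _ (by fun_prop)]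
        gcongr
        exact hC η
    _ = _ := by rw [lintegral_const_mul _ (by fun_prop), mul_assoc]

theorem sq_add_le_two_mul (a b : ℝ≥0∞) : (a + b) ^ 2 ≤ 2 * (a ^ 2 + b ^ 2) := by
  have := ENNReal.rpow_add_le_mul_rpow_add_rpow a b (p := 2) (by norm_num)
  norm_num at this
  exact this

theorem sq_add_four_le (a b c e : ℝ≥0∞) :
    (a + b + c + e) ^ 2 ≤ 8 * (a ^ 2 + b ^ 2 + c ^ 2 + e ^ 2) := by
  calc _ ≤ 2 * ((a + b + c) ^ 2 + e ^ 2) := sq_add_le_two_mul _ _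
    _ ≤ 2 * (2 * ((a + b) ^ 2 + c ^ 2) + e ^ 2) := by
        gcongr
        exact sq_add_le_two_mul _ _
    _ ≤ 2 * (2 * (2 * (a ^ 2 + b ^ 2) + c ^ 2) + e ^ 2) := by
        gcongr
        exact sq_add_le_two_mul _ _
    _ ≤ 2 * (2 * (2 * (a ^ 2 + b ^ 2) + 2 * c ^ 2) + 4 * e ^ 2) := by
        gcongr
        · exact le_mul_of_one_le_left zero_le (by norm_num)
        · exact le_mul_of_one_le_left zero_le (by norm_num)
    _ = _ := by ring

/-- `√w` as an extended nonnegative function. -/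
def FourierWeight.sqrt (w : FourierWeight d) (ξ : Eu d) : ℝ≥0∞ := ENNReal.ofReal √(w.toFun ξ)

theorem FourierWeight.measurable_sqrt (w : FourierWeight d) : Measurable w.sqrt :=
  w.measurable.sqrt.ennreal_ofReal

theorem FourierWeight.sqrt_ne_zero (w : FourierWeight d) : ∀ᵐ ξ, w.sqrt ξ ≠ 0 := by
  filter_upwards [w.pos_ae] with ξ hξ
  simpa [FourierWeight.sqrt] using hξ

theorem FourierWeight.inv_sqrt_sq (w : FourierWeight d) :
    ∀ᵐ ξ, (w.sqrt ξ)⁻¹ ^ 2 = ENNReal.ofReal (1 / w.toFun ξ) := by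
  filter_upwards [w.pos_ae] with ξ hξ
  rw [FourierWeight.sqrt, ← ENNReal.ofReal_inv_of_pos (Real.sqrt_pos.2 hξ),
    ← ENNReal.ofReal_pow (by positivity), inv_pow, Real.sq_sqrt hξ.le, one_div]

theorem sq_lintegral_le_of_weight (w : FourierWeight d) {h b : Eu d → ℝ≥0∞} (hh : Measurable h)
    (hb : Measurable b) :
    (∫⁻ ξ, h ξ * b ξ) ^ 2 ≤
      (∫⁻ ξ, h ξ ^ 2 * ENNReal.ofReal (1 / w.toFun ξ)) * ∫⁻ ξ, (w.sqrt ξ * b ξ) ^ 2 := by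
  have hm := w.measurable_sqrt
  calc (∫⁻ ξ, h ξ * b ξ) ^ 2 = (∫⁻ ξ, (h ξ * (w.sqrt ξ)⁻¹) * (w.sqrt ξ * b ξ)) ^ 2 := by
        congr 1
        refine lintegral_congr_ae ?_
        filter_upwards [w.sqrt_ne_zero] with ξ hξ
        rw [mul_assoc, ← mul_assoc (w.sqrt ξ)⁻¹, ENNReal.inv_mul_cancel hξ
          (by simp [FourierWeight.sqrt]), one_mul]
    _ ≤ _ := sq_lintegral_mul_le (by fun_prop) (by fun_prop)
    _ = _ := by
        congr 1
        refine lintegral_congr_ae ?_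
        filter_upwards [w.inv_sqrt_sq] with ξ hξ
        rw [mul_pow, hξ]

/-! ### The convolution algebra -/

theorem sqrt_omega_add_le [NeZero d] {t r δ : ℝ} (ht : 0 ≤ t) (hr0 : 0 ≤ r) (hr1 : r ≤ 1)
    (hδ : 1 < δ) (η ζ : Eu d) (hη : 0 < ‖η‖) (hζ : 0 < ‖ζ‖) (hξ : 0 < ‖η + ζ‖) :
    (omega t r δ).sqrt (η + ζ) ≤ ENNReal.ofReal √((5 ^ t + 17) * 2 ^ (2 * δ)) *
      ((omega t r δ).sqrt η + (omega t r δ).sqrt ζ +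
      ENNReal.ofReal √(kernel r δ (η + ζ) η) * ((omega t r δ).sqrt η * (omega t r δ).sqrt ζ) +
      ENNReal.ofReal √(kernel r δ (η + ζ) ζ) *
        ((omega t r δ).sqrt η * (omega t r δ).sqrt ζ)) := by
  have key := Real.sqrt_le_sqrt (omega_add_le (t := t) ht hr0 hr1 hδ η ζ hη hζ hξ)
  have hk1 := kernel_nonneg r δ (η + ζ) η
  have hk2 := kernel_nonneg r δ (η + ζ) ζ
  have hwη := omega_nonneg (t := t) (r := r) (δ := δ) η
  have hwζ := omega_nonneg (t := t) (r := r) (δ := δ) ζ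
  simp only [FourierWeight.sqrt]
  rw [← ENNReal.ofReal_mul (by positivity), ← ENNReal.ofReal_mul (by positivity),
    ← ENNReal.ofReal_mul (by positivity), ← ENNReal.ofReal_add (by positivity) (by positivity),
    ← ENNReal.ofReal_add (by positivity) (by positivity),
    ← ENNReal.ofReal_add (by positivity) (by positivity), ← ENNReal.ofReal_mul (by positivity)]
  refine ENNReal.ofReal_le_ofReal (key.trans ?_)
  rw [Real.sqrt_mul (by positivity), ← Real.sqrt_mul hwη, ← Real.sqrt_mul hk1,
    ← Real.sqrt_mul hk2]
  gcongr
  have hadd : ∀ x y : ℝ, √(x + y) ≤ √x + √y := fun x y => by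
    have h : ∀ z : ℝ, z ≤ √z ^ 2 := fun z => by
      rcases le_total 0 z with hz | hz
      · rw [Real.sq_sqrt hz]
      · exact hz.trans (sq_nonneg _)
    refine Real.sqrt_le_iff.2 ⟨by positivity, ?_⟩
    nlinarith [h x, h y, mul_nonneg (Real.sqrt_nonneg x) (Real.sqrt_nonneg y)]
  refine (hadd _ _).trans ?_
  gcongr
  refine (hadd _ _).trans ?_
  gcongr
  exact hadd _ _

/-- The weighted `L²` space is closed under convolution. -/
theorem lintegral_sq_omega_conv_le [NeZero d] (hd : 2 ≤ d) {t r δ : ℝ} (hr0 : 0 ≤ r) (hr1 : r ≤ 1)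
    (hδ : 1 < δ) (hdim : 1 + δ - 2 * r < d) (hd2 : d = 2 → δ ≤ 2) (ht : (d : ℝ) / 2 + 1 < t) :
    ∃ C : ℝ≥0∞, C ≠ ⊤ ∧ ∀ a b : Eu d → ℝ≥0∞, Measurable a → Measurable b →
      ∫⁻ ξ, ((omega t r δ).sqrt ξ * ∫⁻ η, a η * b (ξ - η)) ^ 2 ≤
        C * ((∫⁻ ξ, ((omega t r δ).sqrt ξ * a ξ) ^ 2) *
          ∫⁻ ξ, ((omega t r δ).sqrt ξ * b ξ) ^ 2) := by
  have ht0 : 0 ≤ t := by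
    have : (0 : ℝ) ≤ d := Nat.cast_nonneg d
    linarith
  obtain ⟨K, hK, hKb⟩ := lintegral_kernel_le hd hr0 hr1 hδ hdim hd2
  set S := ∫⁻ ξ : Eu d, ENNReal.ofReal (1 / (omega (d := d) t r δ).toFun ξ) with hSdef
  have hS : S < ⊤ := by
    refine lt_of_le_of_lt (lintegral_mono fun ξ => ENNReal.ofReal_le_ofReal ?_)
      (lintegral_one_add_norm_sq_div_omega_lt_top hd (by linarith) hdim ht)
    exact div_le_div_of_nonneg_right (by nlinarith [sq_nonneg ‖ξ‖]) (omega_nonneg ξ)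
  set C₁ := ENNReal.ofReal √((5 ^ t + 17) * 2 ^ (2 * δ)) with hC1
  obtain ⟨k, hk⟩ : ∃ k : Eu d → Eu d → ℝ≥0∞,
      k = fun ξ η => ENNReal.ofReal √(kernel r δ ξ η) := ⟨_, rfl⟩
  have hkm : Measurable (Function.uncurry k) := by
    rw [hk]
    exact (measurable_kernel r δ).sqrt.ennreal_ofReal
  have hk2 : ∀ η, ∫⁻ ξ, k ξ η ^ 2 ≤ K := fun η => by
    refine le_trans (le_of_eq (lintegral_congr fun ξ => ?_)) (hKb η)
    simp only [hk]
    rw [← ENNReal.ofReal_pow (by positivity), Real.sq_sqrt (kernel_nonneg _ _ _ _)]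
  have hW := (omega (d := d) t r δ).measurable_sqrt
  set W := (omega (d := d) t r δ).sqrt with hWdef
  refine ⟨C₁ ^ 2 * (8 * (S + S + K + K)), ?_, fun a b ha hb => ?_⟩
  · have hS' := hS.ne
    exact ENNReal.mul_ne_top (by simp [hC1]) (ENNReal.mul_ne_top (by simp) (by simp [hS', hK]))
  have hL1 : ∀ b : Eu d → ℝ≥0∞, Measurable b → (∫⁻ ξ, b ξ) ^ 2 ≤ S * ∫⁻ ξ, (W ξ * b ξ) ^ 2 :=
    fun b hb => by
      simpa only [one_pow, one_mul] using sq_lintegral_le_of_weight (omega t r δ) (h := fun _ => 1) measurable_const hb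
  set A := fun ξ => W ξ * a ξ with hA
  set B := fun ξ => W ξ * b ξ with hB
  have hAm : Measurable A := hW.mul ha
  have hBm : Measurable B := hW.mul hb
  -- `T₁`, `T₂` come from the additive terms of `sqrt_omega_add_le` and `T₃`, `T₄` from the kernel
  -- terms. In `T₂` and `T₄` the substitution η ↦ ξ - η has been made, so that the weighted factor,
  -- or the second argument of the kernel, sits at the integration variable.
  set T₁ := fun ξ => ∫⁻ η, A η * b (ξ - η)
  set T₂ := fun ξ => ∫⁻ η, B η * a (ξ - η)
  set T₃ := fun ξ => ∫⁻ η, k ξ η * (A η * B (ξ - η))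
  set T₄ := fun ξ => ∫⁻ η, k ξ η * (B η * A (ξ - η))
  have hT₁ : Measurable T₁ := Measurable.lintegral_prod_right'
    (f := fun p : Eu d × Eu d => A p.2 * b (p.1 - p.2)) (by fun_prop)
  have hT₂ : Measurable T₂ := Measurable.lintegral_prod_right'
    (f := fun p : Eu d × Eu d => B p.2 * a (p.1 - p.2)) (by fun_prop)
  have hk' : Measurable fun p : Eu d × Eu d => k p.1 p.2 := hkm
  have hT₃ : Measurable T₃ := Measurable.lintegral_prod_right'
    (f := fun p : Eu d × Eu d => k p.1 p.2 * (A p.2 * B (p.1 - p.2))) (by fun_prop)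
  have hT₄ : Measurable T₄ := Measurable.lintegral_prod_right'
    (f := fun p : Eu d × Eu d => k p.1 p.2 * (B p.2 * A (p.1 - p.2))) (by fun_prop)
  have hne : ∀ᵐ ξ : Eu d, ξ ≠ 0 := by simp [ae_iff]
  have hpt : ∀ᵐ ξ, W ξ * ∫⁻ η, a η * b (ξ - η) ≤ C₁ * (T₁ ξ + T₂ ξ + T₃ ξ + T₄ ξ) := by
    filter_upwards [hne] with ξ hξ
    have hne' : ∀ᵐ η : Eu d, η ≠ ξ := by simp [ae_iff]
    have hkξ : Measurable (k ξ) := hkm.of_uncurry_left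
    have e2 : T₂ ξ = ∫⁻ η, a η * B (ξ - η) := by
      rw [← lintegral_sub_left_eq_self _ ξ]
      simp [mul_comm, T₂]
    have e4 : T₄ ξ = ∫⁻ η, k ξ (ξ - η) * (A η * B (ξ - η)) := by
      rw [← lintegral_sub_left_eq_self _ ξ]
      simp [mul_comm, T₄]
    calc W ξ * ∫⁻ η, a η * b (ξ - η) = ∫⁻ η, W ξ * (a η * b (ξ - η)) := by
          rw [lintegral_const_mul _ (by fun_prop)]
      _ ≤ ∫⁻ η, C₁ * (A η * b (ξ - η) + a η * B (ξ - η) + k ξ η * (A η * B (ξ - η)) +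
            k ξ (ξ - η) * (A η * B (ξ - η))) := by
          refine lintegral_mono_ae ?_
          filter_upwards [hne, hne'] with η h1 h2
          have := sqrt_omega_add_le (t := t) ht0 hr0 hr1 hδ η (ξ - η) (norm_pos_iff.2 h1)
            (norm_pos_iff.2 (sub_ne_zero.2 h2.symm)) (by simpa using hξ)
          rw [add_sub_cancel] at this
          calc _ ≤ _ := mul_le_mul_left this _
            _ = _ := by
              simp only [hA, hB, hk, ← hWdef]
              ring
      _ = _ := by
          rw [e2, e4, lintegral_const_mul _ (by fun_prop), lintegral_add_left (by fun_prop),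
            lintegral_add_left (by fun_prop), lintegral_add_left (by fun_prop)]
  have b1 := (lintegral_sq_conv_le hAm hb).trans (mul_le_mul_right (hL1 b hb) _)
  have b2 := (lintegral_sq_conv_le hBm ha).trans (mul_le_mul_right (hL1 a ha) _)
  have b3 := lintegral_sq_kernel_conv_le hkm hAm hBm hk2
  have b4 := lintegral_sq_kernel_conv_le hkm hBm hAm hk2
  calc _ ≤ ∫⁻ ξ, C₁ ^ 2 * (8 * (T₁ ξ ^ 2 + T₂ ξ ^ 2 + T₃ ξ ^ 2 + T₄ ξ ^ 2)) := by
        refine lintegral_mono_ae ?_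
        filter_upwards [hpt] with ξ hξ
        calc _ ≤ _ := pow_le_pow_left' hξ 2
          _ ≤ _ := by
            rw [mul_pow]
            gcongr
            exact sq_add_four_le _ _ _ _
    _ = C₁ ^ 2 * (8 * ((∫⁻ ξ, T₁ ξ ^ 2) + (∫⁻ ξ, T₂ ξ ^ 2) + (∫⁻ ξ, T₃ ξ ^ 2) +
          ∫⁻ ξ, T₄ ξ ^ 2)) := by
        rw [lintegral_const_mul _ (by fun_prop), lintegral_const_mul _ (by fun_prop),
          lintegral_add_left (by fun_prop), lintegral_add_left (by fun_prop),
          lintegral_add_left (by fun_prop)]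
    _ ≤ C₁ ^ 2 * (8 * ((∫⁻ ξ, A ξ ^ 2) * (S * ∫⁻ ξ, B ξ ^ 2) +
          (∫⁻ ξ, B ξ ^ 2) * (S * ∫⁻ ξ, A ξ ^ 2) + K * ((∫⁻ ξ, A ξ ^ 2) * ∫⁻ ξ, B ξ ^ 2) +
          K * ((∫⁻ ξ, B ξ ^ 2) * ∫⁻ ξ, A ξ ^ 2))) := by
        gcongr
    _ = _ := by ring

/-! ### Distributions represented by functions on the Fourier side -/

section Represents

variable {d : ℕ}

theorem exists_represents_of_memLp {g : Eu d → ℂ} {p : ℝ≥0∞} [hp : Fact (1 ≤ p)]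
    (hg : MemLp g p volume) : ∃ T : 𝓢'(Eu d, ℂ), Represents (𝓕 T) g := by
  refine ⟨𝓕⁻ (Lp.toTemperedDistribution (hg.toLp g)), ?_⟩
  rw [FourierTransform.fourier_fourierInv_eq]
  refine ⟨hg.locallyIntegrable hp.out, fun φ => ?_, fun φ => ?_⟩
  · have := ENNReal.HolderConjugate.inv_one_sub_inv' hp.out
    exact MemLp.integrable_mul (φ.memLp (1 - p⁻¹)⁻¹ volume) hg
  · rw [Lp.toTemperedDistribution_apply]
    refine integral_congr_ae ?_
    filter_upwards [hg.coeFn_toLp] with x hx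
    rw [hx, smul_eq_mul]

theorem continuous_fourier_of_integrable {g : Eu d → ℂ} (hg : Integrable g) :
    Continuous (𝓕 g) :=
  VectorFourier.fourierIntegral_continuous Real.continuous_fourierChar
    (by exact continuous_inner) hg

theorem continuous_fourierInv_of_integrable {g : Eu d → ℂ} (hg : Integrable g) :
    Continuous (𝓕⁻ g) := by
  rw [Real.fourierInv_eq_fourier_comp_neg]
  exact continuous_fourier_of_integrable hg.comp_neg

theorem norm_fourierInv_le (g : Eu d → ℂ) (x : Eu d) : ‖𝓕⁻ g x‖ ≤ ∫ ξ, ‖g ξ‖ := by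
  rw [Real.fourierInv_eq]
  refine (norm_integral_le_integral_norm _).trans_eq ?_
  simp

/-- Bounded continuous functions are tempered distributions. -/
theorem represents_aux {g : Eu d → ℂ} (hg : Continuous g) {C : ℝ} (hC : ∀ x, ‖g x‖ ≤ C)
    {T : 𝓢'(Eu d, ℂ)} (hT : ∀ φ : 𝓢(Eu d, ℂ), T φ = ∫ x, φ x * g x) : Represents T g where
  locInt := hg.locallyIntegrable
  integrable φ := φ.integrable.mul_bdd hg.aestronglyMeasurable (Eventually.of_forall hC)
  apply_eq := hT

theorem Represents.apply_fourierInv {T : 𝓢'(Eu d, ℂ)} {g : Eu d → ℂ}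
    (h : Represents (𝓕 T) g) (φ : 𝓢(Eu d, ℂ)) : T φ = ∫ ξ, (𝓕⁻ φ) ξ * g ξ := by
  rw [← h.apply_eq, TemperedDistribution.fourier_apply, FourierTransform.fourier_fourierInv_eq]

theorem Represents.unique {T S : 𝓢'(Eu d, ℂ)} {g h : Eu d → ℂ}
    (hg : Represents T g) (hh : Represents S h) (hgh : g =ᵐ[volume] h) : T = S := by
  ext φ
  rw [hg.apply_eq, hh.apply_eq]
  refine integral_congr_ae ?_
  filter_upwards [hgh] with x hx
  rw [hx]

theorem Represents.congr {T : 𝓢'(Eu d, ℂ)} {g h : Eu d → ℂ}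
    (hg : Represents T g) (hgh : g =ᵐ[volume] h) : Represents T h where
  locInt := hg.locInt.congr hgh
  integrable φ := (hg.integrable φ).congr (by filter_upwards [hgh] with x hx; rw [hx])
  apply_eq φ := by
    rw [hg.apply_eq]
    refine integral_congr_ae ?_
    filter_upwards [hgh] with x hx
    rw [hx]

theorem fourier_injective {T S : 𝓢'(Eu d, ℂ)} (h : 𝓕 T = 𝓕 S) : T = S := by
  have h1 : 𝓕⁻ (𝓕 T) = T := FourierTransform.fourierInv_fourier_eq T
  rw [← h1, h, FourierTransform.fourierInv_fourier_eq]

theorem integral_fourierInv_mul_eq {f g : Eu d → ℂ} (hf : Integrable f) (hg : Integrable g) :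
    ∫ ξ, 𝓕⁻ f ξ * g ξ = ∫ x, f x * 𝓕⁻ g x := by
  have h := VectorFourier.integral_fourierIntegral_smul_eq_flip (L := innerₗ (Eu d))
    (μ := volume) (ν := volume) Real.continuous_fourierChar continuous_inner hf.comp_neg hg
  have h1 : (VectorFourier.fourierIntegral Real.fourierChar volume (innerₗ (Eu d)).flip g) =
      𝓕 g := by
    rw [flip_innerₗ]
    rfl
  have h2 : (VectorFourier.fourierIntegral Real.fourierChar volume (innerₗ (Eu d))
      fun x => f (-x)) = 𝓕⁻ f := by
    rw [Real.fourierInv_eq_fourier_comp_neg]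
    rfl
  rw [h1, h2] at h
  simp only [smul_eq_mul] at h
  rw [h, ← integral_neg_eq_self]
  simp [Real.fourierInv_eq_fourier_neg]

theorem Represents.fourierInv {T : 𝓢'(Eu d, ℂ)} {g : Eu d → ℂ}
    (h : Represents (𝓕 T) g) (hg : Integrable g) : Represents T (𝓕⁻ g) := by
  refine represents_aux (continuous_fourierInv_of_integrable hg) (norm_fourierInv_le g) fun φ => ?_
  rw [h.apply_fourierInv, SchwartzMap.fourierInv_coe]
  exact integral_fourierInv_mul_eq φ.integrable hg

/-- The factor ξ_j has temperate growth and can be moved onto the test function, which preserves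
integrability of the pairing. -/
theorem fourier_lineDeriv_represents {T : 𝓢'(Eu d, ℂ)} {g : Eu d → ℂ} (h : Represents (𝓕 T) g)
    (j : Fin d) :
    Represents (𝓕 (∂_{stdVec j} T)) (fun ξ => (2 * Real.pi * Complex.I * (ξ j : ℂ)) * g ξ) := by
  have hcont : Continuous fun ξ : Eu d => 2 * Real.pi * Complex.I * (ξ j : ℂ) := by fun_prop
  have hin : ∀ ξ : Eu d, inner ℝ ξ (stdVec j) = ξ j := fun ξ => by
    rw [EuclideanSpace.inner_single_right]
    simp
  have htg : (fun ξ : Eu d => ((inner ℝ ξ (stdVec j) : ℝ) : ℂ)).HasTemperateGrowth := by fun_prop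
  have hmul : ∀ (φ : 𝓢(Eu d, ℂ)) (ξ : Eu d),
      φ ξ * ((2 * Real.pi * Complex.I * (ξ j : ℂ)) * g ξ) = (2 * Real.pi * Complex.I) *
        ((SchwartzMap.smulLeftCLM ℂ (fun ξ : Eu d => ((inner ℝ ξ (stdVec j) : ℝ) : ℂ)) φ) ξ
          * g ξ) := fun φ ξ => by
    rw [SchwartzMap.smulLeftCLM_apply_apply htg, hin, smul_eq_mul]
    ring
  refine ⟨locallyIntegrable_iff.2 fun K hK =>
    (h.locInt.integrableOn_isCompact hK).continuousOn_mul hcont.continuousOn hK, ?_, ?_⟩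
  · intro φ
    simp only [hmul]
    exact (h.integrable _).const_mul _
  · intro φ
    simp only [hmul]
    rw [integral_const_mul, ← h.apply_eq, TemperedDistribution.fourier_lineDerivOp_eq]
    rfl

end Represents

/-! ### Real-valued distributions -/

section Valued

variable {d : ℕ} {𝕜 : Type*} [RCLike 𝕜] [NormedAlgebra 𝕜 ℂ]

theorem algebraMap_ofReal (a : ℝ) : algebraMap 𝕜 ℂ (a : 𝕜) = (a : ℂ) := by
  have := map_real_smul (algebraMap 𝕜 ℂ) (algebraMapCLM 𝕜 ℂ).continuous a 1
  rw [map_one] at this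
  simpa [Algebra.smul_def] using this

theorem norm_algebraMap_field (z : 𝕜) : ‖algebraMap 𝕜 ℂ z‖ = ‖z‖ := norm_algebraMap' ℂ z

variable (𝕜) in
-- The image of `𝕜` is a real subspace of ℂ containing ℝ, hence ℝ or ℂ: a single non-real element
-- spans ℂ together with 1. This dichotomy treats both fields at once.
theorem range_algebraMap_eq : (∀ z : ℂ, z ∈ Set.range (algebraMap 𝕜 ℂ)) ∨
    ∀ z : ℂ, z ∈ Set.range (algebraMap 𝕜 ℂ) ↔ z.im = 0 := by
  by_cases h : ∃ w : 𝕜, (algebraMap 𝕜 ℂ w).im ≠ 0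
  · left
    obtain ⟨w, hw⟩ := h
    intro z
    refine ⟨((z.re - z.im / (algebraMap 𝕜 ℂ w).im * (algebraMap 𝕜 ℂ w).re : ℝ) : 𝕜) +
      ((z.im / (algebraMap 𝕜 ℂ w).im : ℝ) : 𝕜) * w, ?_⟩
    rw [map_add, map_mul, algebraMap_ofReal, algebraMap_ofReal]
    apply Complex.ext
    · simp
    · simp [hw]
  · right
    push Not at h
    intro z
    refine ⟨fun ⟨w, hw⟩ => hw ▸ h w, fun hz => ⟨(z.re : 𝕜), ?_⟩⟩
    rw [algebraMap_ofReal]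
    exact Complex.ext (by simp) (by simp [hz])

variable (𝕜) in
/-- The Fourier-side condition for a distribution to be `𝕜`-valued. -/
def IsHermitian (g : Eu d → ℂ) : Prop :=
  (∀ z : ℂ, z ∈ Set.range (algebraMap 𝕜 ℂ)) ∨ ∀ᵐ ξ, g (-ξ) = starRingEnd ℂ (g ξ)

theorem ae_comp_neg {p : Eu d → Prop} (h : ∀ᵐ ξ, p ξ) : ∀ᵐ ξ, p (-ξ) :=
  (Measure.measurePreserving_neg volume).quasiMeasurePreserving.ae h

theorem IsHermitian.congr {g h : Eu d → ℂ} (hg : IsHermitian 𝕜 g) (hgh : g =ᵐ[volume] h) :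
    IsHermitian 𝕜 h := by
  refine hg.imp id fun hg => ?_
  filter_upwards [hg, hgh, ae_comp_neg hgh] with ξ h1 h2 h3
  rw [← h2, ← h3, h1]

theorem fourierInv_conj (φ : Eu d → ℂ) (ξ : Eu d) :
    starRingEnd ℂ (𝓕⁻ φ ξ) = 𝓕⁻ (fun x => starRingEnd ℂ (φ x)) (-ξ) := by
  rw [Real.fourierInv_eq', Real.fourierInv_eq', ← integral_conj]
  refine integral_congr_ae (Eventually.of_forall fun x => ?_)
  simp only [smul_eq_mul, map_mul, ← Complex.exp_conj, inner_neg_right]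
  congr 2
  simp [Complex.conj_ofNat]

/-- For a real test function, conjugating its inverse Fourier transform amounts to reflecting it.
Conjugating `T φ` therefore replaces `g` by its reflected conjugate. -/
theorem Represents.conj_apply {T : 𝓢'(Eu d, ℂ)} {g : Eu d → ℂ} (h : Represents (𝓕 T) g)
    {φ : 𝓢(Eu d, ℂ)} (hφ : ∀ x, (φ x).im = 0) :
    starRingEnd ℂ (T φ) = ∫ ξ, (𝓕⁻ φ) ξ * starRingEnd ℂ (g (-ξ)) := by
  rw [h.apply_fourierInv, ← integral_conj, ← integral_neg_eq_self]
  refine integral_congr_ae (Eventually.of_forall fun ξ => ?_)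
  dsimp only
  rw [map_mul]
  congr 1
  rw [SchwartzMap.fourierInv_coe, fourierInv_conj, neg_neg]
  refine congrArg (fun q : Eu d → ℂ => 𝓕⁻ q ξ) (funext fun x => ?_)
  exact Complex.conj_eq_iff_im.2 (hφ x)

theorem isValuedIn_of_isHermitian {T : 𝓢'(Eu d, ℂ)} {g : Eu d → ℂ} (h : Represents (𝓕 T) g)
    (hg : IsHermitian 𝕜 g) : IsValuedIn 𝕜 T := by
  intro φ hφ
  rcases hg with hg | hg
  · exact hg _
  rcases range_algebraMap_eq 𝕜 with hr | hr
  · exact hr _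
  rw [hr, ← Complex.conj_eq_iff_im, h.conj_apply hφ, h.apply_fourierInv]
  refine integral_congr_ae ?_
  filter_upwards [hg] with ξ hξ
  rw [hξ, Complex.conj_conj]

/-- When the image of `𝕜` is ℝ, `g` and its reflected conjugate pair equally with inverse transforms
of real test functions, hence of all test functions by splitting into real and imaginary parts. They
represent the same distribution, so they agree almost everywhere. -/
theorem isHermitian_of_isValuedIn {T : 𝓢'(Eu d, ℂ)} {g : Eu d → ℂ} (h : Represents (𝓕 T) g)
    (hT : IsValuedIn 𝕜 T) : IsHermitian 𝕜 g := by
  rcases range_algebraMap_eq 𝕜 with hr | hr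
  · exact Or.inl hr
  right
  set g' : Eu d → ℂ := fun ξ => starRingEnd ℂ (g (-ξ)) with hg'
  have hloc : LocallyIntegrable g' := by
    rw [locallyIntegrable_iff]
    intro K hK
    have h1 : IntegrableOn g (-K) := h.locInt.integrableOn_isCompact hK.neg
    have h2 := ((Measure.measurePreserving_neg (volume : Measure (Eu d))).integrableOn_comp_preimage
      (Homeomorph.neg (Eu d)).measurableEmbedding).2 h1
    simp only [Set.neg_preimage, neg_neg] at h2
    exact Complex.conjCLE.toContinuousLinearMap.integrable_comp h2
  have hint : ∀ φ : 𝓢(Eu d, ℂ), Integrable (fun ξ => φ ξ * g' ξ) := fun φ => by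
    have h1 := (h.integrable (SchwartzMap.compCLMOfContinuousLinearEquiv ℂ
      (ContinuousLinearEquiv.neg ℝ (M := Eu d)) φ)).comp_neg
    refine h1.mono (φ.continuous.aestronglyMeasurable.mul hloc.aestronglyMeasurable)
      (Eventually.of_forall fun ξ => ?_)
    simp [hg']
  have hreal : ∀ φ : 𝓢(Eu d, ℂ), (∀ x, (φ x).im = 0) →
      ∫ ξ, (𝓕⁻ φ) ξ * g ξ = ∫ ξ, (𝓕⁻ φ) ξ * g' ξ := fun φ hφ => by
    rw [← h.conj_apply hφ, ← h.apply_fourierInv, eq_comm, Complex.conj_eq_iff_im, ← hr]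
    exact hT φ hφ
  have hall : ∀ φ : 𝓢(Eu d, ℂ), ∫ ξ, (𝓕⁻ φ) ξ * g ξ = ∫ ξ, (𝓕⁻ φ) ξ * g' ξ := fun φ => by
    set A : 𝓢(Eu d, ℂ) := φ.postcompCLM (Complex.ofRealCLM ∘L Complex.reCLM) with hA
    set B : 𝓢(Eu d, ℂ) := φ.postcompCLM (Complex.ofRealCLM ∘L Complex.imCLM) with hB
    have hφ : φ = A + Complex.I • B := by
      ext x
      simp [hA, hB, mul_comm Complex.I, Complex.re_add_im]
    have hA' := hreal A fun x => by simp [hA]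
    have hB' := hreal B fun x => by simp [hB]
    have hsplit : ∀ q : Eu d → ℂ, (∀ φ : 𝓢(Eu d, ℂ), Integrable fun ξ => φ ξ * q ξ) →
        ∫ ξ, (𝓕⁻ φ) ξ * q ξ =
          (∫ ξ, (𝓕⁻ A) ξ * q ξ) + Complex.I * ∫ ξ, (𝓕⁻ B) ξ * q ξ := fun q hq => by
      rw [hφ, FourierTransform.fourierInv_add, FourierTransform.fourierInv_smul,
        ← integral_const_mul, ← integral_add (hq _) ((hq _).const_mul _)]
      refine integral_congr_ae (Eventually.of_forall fun ξ => ?_)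
      simp only [add_apply, smul_apply, smul_eq_mul]
      ring
    rw [hsplit g h.integrable, hsplit g' hint, hA', hB']
  have hrep : Represents (𝓕 T) g' := ⟨hloc, hint, fun φ => by
    have h1 : 𝓕⁻ (𝓕 φ) = φ := FourierTransform.fourierInv_fourier_eq φ
    rw [h.apply_eq, ← h1]
    exact hall _⟩
  filter_upwards [h.ae_eq hrep] with ξ hξ
  rw [hξ]
  simp [hg']

end Valued

/-! ### The spaces `FourierSpace` -/

/-- Every `g` with `√w g ∈ L²` is the Fourier transform of a tempered distribution. -/
def FourierWeight.Tempered {d : ℕ} (w : FourierWeight d) : Prop :=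
  ∀ g : Eu d → ℂ, MemLp (fun ξ => √(w.toFun ξ) • g ξ) 2 volume →
    ∃ T : 𝓢'(Eu d, ℂ), Represents (𝓕 T) g

theorem FourierWeight.aestronglyMeasurable_of_smul {d : ℕ} (w : FourierWeight d) {g : Eu d → ℂ}
    (hg : AEStronglyMeasurable (fun ξ => √(w.toFun ξ) • g ξ) volume) :
    AEStronglyMeasurable g volume := by
  have h1 : AEStronglyMeasurable (fun ξ => (√(w.toFun ξ))⁻¹ • (√(w.toFun ξ) • g ξ)) volume :=
    w.measurable.sqrt.inv.aestronglyMeasurable.smul hg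
  refine h1.congr ?_
  filter_upwards [w.pos_ae] with ξ hξ
  rw [smul_smul, inv_mul_cancel₀ (Real.sqrt_pos.2 hξ).ne', one_smul]

theorem FourierWeight.enorm_smul {d : ℕ} (w : FourierWeight d) (g : Eu d → ℂ) (ξ : Eu d) :
    ‖√(w.toFun ξ) • g ξ‖ₑ = w.sqrt ξ * ‖g ξ‖ₑ := by
  rw [_root_.enorm_smul, FourierWeight.sqrt, Real.enorm_of_nonneg (Real.sqrt_nonneg _)]

theorem FourierWeight.memLp_of_lintegral {d : ℕ} (w : FourierWeight d) {g : Eu d → ℂ}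
    (hg : AEStronglyMeasurable g volume) (h : ∫⁻ ξ, (w.sqrt ξ * ‖g ξ‖ₑ) ^ 2 < ⊤) :
    MemLp (fun ξ => √(w.toFun ξ) • g ξ) 2 volume := by
  refine ⟨w.measurable.sqrt.aestronglyMeasurable.smul hg, ?_⟩
  rw [eLpNorm_lt_top_iff_lintegral_rpow_enorm_lt_top (by norm_num) (by norm_num)]
  simp only [w.enorm_smul]
  simpa using h

theorem norm_le_mul_of_enorm_sq_le {E F : Type*} [SeminormedAddCommGroup E]
    [SeminormedAddCommGroup F] {x : E} {y : F} {c : ℝ≥0∞} (hc : c ≠ ⊤)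
    (h : ‖x‖ₑ ^ 2 ≤ c * ‖y‖ₑ ^ 2) : ‖x‖ ≤ √c.toReal * ‖y‖ := by
  have h1 := ENNReal.toReal_mono (ENNReal.mul_ne_top hc (by simp)) h
  simp only [ENNReal.toReal_pow, ENNReal.toReal_mul, toReal_enorm] at h1
  refine abs_le_of_sq_le_sq' ?_ (by positivity) |>.2
  rwa [mul_pow, Real.sq_sqrt ENNReal.toReal_nonneg]

namespace FourierSpace

variable {𝕜 : Type*} [RCLike 𝕜] [NormedAlgebra 𝕜 ℂ] {d : ℕ} {w : FourierWeight d}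

theorem ext_of_hat {u v : FourierSpace 𝕜 w} (h : u.hat =ᵐ[volume] v.hat) : u = v :=
  Subtype.ext (fourier_injective (u.hat_represents.unique v.hat_represents h))

theorem aestronglyMeasurable_hat (u : FourierSpace 𝕜 w) : AEStronglyMeasurable u.hat volume :=
  u.hat_represents.locInt.aestronglyMeasurable

theorem isHermitian_hat (u : FourierSpace 𝕜 w) : IsHermitian 𝕜 u.hat :=
  isHermitian_of_isValuedIn u.hat_represents u.2.1

theorem hat_add (u v : FourierSpace 𝕜 w) : (u + v).hat =ᵐ[volume] fun ξ => u.hat ξ + v.hat ξ := by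
  have h : Represents (𝓕 (u + v).toDistr) (u.hat + v.hat) := by
    have h1 : (u + v).toDistr = u.toDistr + v.toDistr := rfl
    rw [h1, FourierTransform.fourier_add]
    exact u.hat_represents.add v.hat_represents
  exact (u + v).hat_represents.ae_eq h

theorem hat_smul (c : 𝕜) (u : FourierSpace 𝕜 w) :
    (c • u).hat =ᵐ[volume] fun ξ => algebraMap 𝕜 ℂ c * u.hat ξ := by
  have h : Represents (𝓕 (c • u).toDistr) (c • u.hat) := by
    have h1 : (c • u).toDistr = c • u.toDistr := rfl
    rw [h1, fourier_smul_field]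
    exact u.hat_represents.smul c
  filter_upwards [(c • u).hat_represents.ae_eq h] with ξ hξ
  rw [hξ, Pi.smul_apply, Algebra.smul_def]

theorem enorm_sq_eq (u : FourierSpace 𝕜 w) {g : Eu d → ℂ} (hg : u.hat =ᵐ[volume] g) :
    ‖u‖ₑ ^ 2 = ∫⁻ ξ, (w.sqrt ξ * ‖g ξ‖ₑ) ^ 2 := by
  have h1 : ‖u‖ₑ = ‖u.hat_memLp.toLp _‖ₑ := rfl
  rw [h1, Lp.enorm_toLp, eLpNorm_eq_lintegral_rpow_enorm_toReal (by norm_num) (by norm_num),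
    ← ENNReal.rpow_natCast, ← ENNReal.rpow_mul]
  norm_num
  refine lintegral_congr_ae ?_
  filter_upwards [hg] with ξ hξ
  rw [← hξ, ← w.enorm_smul]
  simp

theorem exists_hat_eq (hw : w.Tempered) {g : Eu d → ℂ}
    (hg : MemLp (fun ξ => √(w.toFun ξ) • g ξ) 2 volume) (hh : IsHermitian 𝕜 g) :
    ∃ u : FourierSpace 𝕜 w, u.hat =ᵐ[volume] g := by
  obtain ⟨T, hT⟩ := hw g hg
  let u : FourierSpace 𝕜 w := ⟨T, isValuedIn_of_isHermitian hT hh, g, hT, hg⟩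
  exact ⟨u, u.hat_represents.ae_eq hT⟩

/-- u ↦ √w û is an isometry onto the Hermitian elements of L²: temperedness gives surjectivity, and
evenness of `w` preserves the symmetry. That set is closed, being either all of L² or the locus
where reflection and conjugation agree. -/
theorem completeSpace (hw : w.Tempered) (heven : ∀ ξ, w.toFun (-ξ) = w.toFun ξ) :
    CompleteSpace (FourierSpace 𝕜 w) := by
  have hiso : Isometry (toL2 𝕜 w) := AddMonoidHomClass.isometry_of_norm (toL2 𝕜 w) fun _ => rfl
  rw [completeSpace_iff_isComplete_range hiso.isUniformInducing]
  refine IsClosed.isComplete ?_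
  have hrange : Set.range (toL2 𝕜 w) = {G | IsHermitian 𝕜 (fun ξ => G ξ)} := by
    ext G
    constructor
    · rintro ⟨u, rfl⟩
      have h1 : IsHermitian 𝕜 (fun ξ => √(w.toFun ξ) • u.hat ξ) := by
        refine u.isHermitian_hat.imp id fun h => ?_
        filter_upwards [h] with ξ hξ
        simp [hξ, heven]
      exact h1.congr u.hat_memLp.coeFn_toLp.symm
    · intro hG
      have hG' : (fun ξ => √(w.toFun ξ) • ((√(w.toFun ξ))⁻¹ • G ξ)) =ᵐ[volume] G := by
        filter_upwards [w.pos_ae] with ξ hξ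
        rw [smul_smul, mul_inv_cancel₀ (Real.sqrt_pos.2 hξ).ne', one_smul]
      obtain ⟨u, hu⟩ := exists_hat_eq (𝕜 := 𝕜) hw (g := fun ξ => (√(w.toFun ξ))⁻¹ • G ξ)
        ((Lp.memLp G).ae_eq hG'.symm) (by
          refine hG.imp id fun h => ?_
          filter_upwards [h] with ξ hξ
          simp [hξ, heven])
      refine ⟨u, Lp.ext (u.hat_memLp.coeFn_toLp.trans (EventuallyEq.trans ?_ hG'))⟩
      filter_upwards [hu] with ξ hξ
      rw [hξ]
  rw [hrange]
  by_cases hall : ∀ z : ℂ, z ∈ Set.range (algebraMap 𝕜 ℂ)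
  · convert isClosed_univ
    exact Set.eq_univ_of_forall fun G => Or.inl hall
  have hneg : MeasurePreserving (fun ξ : Eu d => -ξ) volume volume :=
    Measure.measurePreserving_neg volume
  have heq : {G : Lp ℂ 2 (volume : Measure (Eu d)) | IsHermitian 𝕜 (fun ξ => G ξ)} =
      {G | Lp.compMeasurePreserving _ hneg G =
        Complex.conjCLE.toContinuousLinearMap.compLp G} := by
    ext G
    simp only [IsHermitian, hall, false_or, Set.mem_ofPred_eq]
    rw [Lp.ext_iff]
    constructor
    · intro h
      filter_upwards [h, Lp.coeFn_compMeasurePreserving G hneg,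
        Complex.conjCLE.toContinuousLinearMap.coeFn_compLp G] with ξ h1 h2 h3
      rw [h2, h3]
      exact h1
    · intro h
      filter_upwards [h, Lp.coeFn_compMeasurePreserving G hneg,
        Complex.conjCLE.toContinuousLinearMap.coeFn_compLp G] with ξ h1 h2 h3
      rw [h2, h3] at h1
      exact h1
  rw [heq]
  refine isClosed_eq (Lp.isometry_compMeasurePreserving hneg).continuous ?_
  exact (Complex.conjCLE.toContinuousLinearMap.compLpL 2 volume).continuous

/-- Fourier multipliers between weighted spaces. -/
theorem exists_multiplier {w₁ w₂ : FourierWeight d} (hw : w₂.Tempered) {m : Eu d → ℂ}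
    (hm : Measurable m) (hmc : ∀ ξ, m (-ξ) = starRingEnd ℂ (m ξ)) {C : ℝ} (hC0 : 0 ≤ C)
    (hC : ∀ᵐ ξ, w₂.toFun ξ * ‖m ξ‖ ^ 2 ≤ C * w₁.toFun ξ) :
    ∃ M : FourierSpace 𝕜 w₁ →L[𝕜] FourierSpace 𝕜 w₂,
      ∀ u, (M u).hat =ᵐ[volume] fun ξ => m ξ * u.hat ξ := by
  have hpt : ∀ᵐ ξ, ∀ z : ℂ, (w₂.sqrt ξ * ‖m ξ * z‖ₑ) ^ 2 ≤
      ENNReal.ofReal C * (w₁.sqrt ξ * ‖z‖ₑ) ^ 2 := by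
    filter_upwards [hC, w₁.pos_ae, w₂.pos_ae] with ξ h h1 h2 z
    have hs : ∀ (w : FourierWeight d), 0 < w.toFun ξ → w.sqrt ξ ^ 2 = ENNReal.ofReal (w.toFun ξ) :=
      fun w hw => by
        rw [FourierWeight.sqrt, ← ENNReal.ofReal_pow (Real.sqrt_nonneg _), Real.sq_sqrt hw.le]
    rw [mul_pow, mul_pow, hs _ h1, hs _ h2, enorm_mul, mul_pow, ← mul_assoc, ← mul_assoc,
      ← ofReal_norm (m ξ), ← ENNReal.ofReal_pow (norm_nonneg _),
      ← ENNReal.ofReal_mul h2.le, ← ENNReal.ofReal_mul hC0]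
    gcongr
  have hbd : ∀ u : FourierSpace 𝕜 w₁, ∫⁻ ξ, (w₂.sqrt ξ * ‖m ξ * u.hat ξ‖ₑ) ^ 2 ≤
      ENNReal.ofReal C * ‖u‖ₑ ^ 2 := fun u => by
    rw [u.enorm_sq_eq EventuallyEq.rfl, ← lintegral_const_mul' _ _ ENNReal.ofReal_ne_top]
    exact lintegral_mono_ae (hpt.mono fun ξ h => h _)
  have hex : ∀ u : FourierSpace 𝕜 w₁, ∃ v : FourierSpace 𝕜 w₂,
      v.hat =ᵐ[volume] fun ξ => m ξ * u.hat ξ := fun u => by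
    refine exists_hat_eq hw (w₂.memLp_of_lintegral
      (hm.aestronglyMeasurable.mul u.aestronglyMeasurable_hat)
      ((hbd u).trans_lt (ENNReal.mul_lt_top ENNReal.ofReal_lt_top (by simp)))) ?_
    refine u.isHermitian_hat.imp id fun h => ?_
    filter_upwards [h] with ξ hξ
    rw [map_mul, hξ, hmc]
  choose M hM using hex
  refine ⟨LinearMap.mkContinuous
    { toFun := M
      map_add' := fun u v => ext_of_hat ?_
      map_smul' := fun c u => ext_of_hat ?_ } √(ENNReal.ofReal C).toReal fun u => ?_, hM⟩
  · filter_upwards [hM (u + v), hat_add u v, hat_add (M u) (M v), hM u, hM v] with ξ h1 h2 h3 h4 h5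
    rw [h1, h2, h3, h4, h5, mul_add]
  · filter_upwards [hM (c • u), hat_smul c u, hat_smul c (M u), hM u] with ξ h1 h2 h3 h4
    rw [h1, h2, RingHom.id_apply, h3, h4]
    ring
  · refine norm_le_mul_of_enorm_sq_le ENNReal.ofReal_ne_top ?_
    exact ((M u).enorm_sq_eq (hM u)).trans_le (hbd u)

end FourierSpace

/-! ### Pointwise values and products -/

theorem hsWeight_tempered {d : ℕ} {s r : ℝ} (hs : 0 ≤ s) :
    (hsWeight (d := d) s r).Tempered := by
  intro g hg
  have hm := (hsWeight (d := d) s r).aestronglyMeasurable_of_smul hg.1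
  have : MemLp g 2 volume := by
    refine hg.mono hm (Eventually.of_forall fun ξ => ?_)
    rw [norm_smul, Real.norm_of_nonneg (Real.sqrt_nonneg _)]
    refine le_mul_of_one_le_left (norm_nonneg _) (Real.one_le_sqrt.2 ?_)
    have h1 : 1 ≤ (1 + ‖ξ‖ ^ 2) ^ s := Real.one_le_rpow (by nlinarith [sq_nonneg ‖ξ‖]) hs
    have h2 : 0 ≤ ‖ξ‖ ^ (-2 * r) := by positivity
    simp only [hsWeight]
    linarith
  exact exists_represents_of_memLp this

section

variable {d : ℕ} [NeZero d] {t r δ : ℝ}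

/-- Cauchy–Schwarz against the integrable function (1 + |ξ|²)/ω. The choice h = 1 makes `u`
continuous, and h = |ξ| makes its gradient continuous. -/
theorem integrable_norm_mul_of_omega (hd : 2 ≤ d) (hδ : 0 < δ) (hdim : 1 + δ - 2 * r < d)
    (ht : (d : ℝ) / 2 + 1 < t) {g : Eu d → ℂ}
    (hg : MemLp (fun ξ => √((omega (d := d) t r δ).toFun ξ) • g ξ) 2 volume)
    {h : Eu d → ℝ} (hh : Measurable h) (hh1 : ∀ ξ, h ξ ^ 2 ≤ 1 + ‖ξ‖ ^ 2) :
    Integrable (fun ξ => h ξ * ‖g ξ‖) := by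
  have hm := (omega (d := d) t r δ).aestronglyMeasurable_of_smul hg.1
  refine ⟨hh.aestronglyMeasurable.mul hm.norm, ?_⟩
  have h2 := hg.2
  rw [eLpNorm_lt_top_iff_lintegral_rpow_enorm_lt_top (by norm_num) (by norm_num)] at h2
  simp only [FourierWeight.enorm_smul] at h2
  have hae : (fun ξ => ‖g ξ‖ₑ) =ᵐ[volume] fun ξ => ‖hm.mk g ξ‖ₑ := by
    filter_upwards [hm.ae_eq_mk] with ξ hξ
    rw [← hξ]
  have h3 : ∫⁻ ξ, ((omega (d := d) t r δ).sqrt ξ * ‖hm.mk g ξ‖ₑ) ^ 2 < ⊤ := by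
    refine lt_of_le_of_lt (le_of_eq (lintegral_congr_ae ?_)) h2
    filter_upwards [hae] with ξ hξ
    rw [← hξ]
    norm_num
  have h4 := sq_lintegral_le_of_weight (omega (d := d) t r δ) (h := fun ξ => ‖h ξ‖ₑ)
    (b := fun ξ => ‖hm.mk g ξ‖ₑ) (by fun_prop) hm.stronglyMeasurable_mk.measurable.enorm
  have h5 : ∫⁻ ξ : Eu d, ‖h ξ‖ₑ ^ 2 * ENNReal.ofReal (1 / (omega (d := d) t r δ).toFun ξ) < ⊤ := by
    refine lt_of_le_of_lt (lintegral_mono fun ξ => ?_)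
      (lintegral_one_add_norm_sq_div_omega_lt_top hd hδ hdim ht)
    rw [← ofReal_norm, ← ENNReal.ofReal_pow (norm_nonneg _), ← ENNReal.ofReal_mul (by positivity),
      mul_one_div]
    refine ENNReal.ofReal_le_ofReal (div_le_div_of_nonneg_right ?_ (omega_nonneg ξ))
    rw [Real.norm_eq_abs, sq_abs]
    exact hh1 ξ
  have h6 := h4.trans_lt (ENNReal.mul_lt_top h5 h3)
  rw [HasFiniteIntegral]
  refine lt_of_le_of_lt (le_of_eq (lintegral_congr_ae ?_))
    (ENNReal.pow_lt_top_iff.1 h6 |>.resolve_right (by norm_num))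
  filter_upwards [hae] with ξ hξ
  rw [enorm_mul, enorm_norm, ← hξ]

theorem integrable_of_omega (hd : 2 ≤ d) (hδ : 0 < δ) (hdim : 1 + δ - 2 * r < d)
    (ht : (d : ℝ) / 2 + 1 < t) {g : Eu d → ℂ}
    (hg : MemLp (fun ξ => √((omega (d := d) t r δ).toFun ξ) • g ξ) 2 volume) :
    Integrable g := by
  have hm := (omega (d := d) t r δ).aestronglyMeasurable_of_smul hg.1
  rw [← integrable_norm_iff hm]
  simpa using integrable_norm_mul_of_omega hd hδ hdim ht hg (h := fun _ => 1) measurable_const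
    fun ξ => by nlinarith [sq_nonneg ‖ξ‖]

theorem omega_tempered (hd : 2 ≤ d) (hδ : 0 < δ) (hdim : 1 + δ - 2 * r < d)
    (ht : (d : ℝ) / 2 + 1 < t) : (omega (d := d) t r δ).Tempered := fun _ hg =>
  exists_represents_of_memLp (memLp_one_iff_integrable.2 (integrable_of_omega hd hδ hdim ht hg))

theorem omega_neg (ξ : Eu d) :
    (omega (d := d) t r δ).toFun (-ξ) = (omega (d := d) t r δ).toFun ξ := by
  simp [omega]

end

theorem fourierInv_mem_range {𝕜 : Type*} [RCLike 𝕜] [NormedAlgebra 𝕜 ℂ] {d : ℕ} {g : Eu d → ℂ}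
    (hg : IsHermitian 𝕜 g) (x : Eu d) : 𝓕⁻ g x ∈ Set.range (algebraMap 𝕜 ℂ) := by
  rcases range_algebraMap_eq 𝕜 with h | h
  · exact h _
  rcases hg with h' | h'
  · exact h' _
  rw [h, ← Complex.conj_eq_iff_im, fourierInv_conj, Real.fourierInv_eq_fourier_neg, neg_neg,
    Real.fourierInv_eq_fourier_comp_neg]
  refine Real.fourier_congr_ae ?_ x
  filter_upwards [h'] with ξ hξ
  rw [hξ]

namespace FourierSpace

variable {𝕜 : Type*} [RCLike 𝕜] [NormedAlgebra 𝕜 ℂ] {d : ℕ} {w : FourierWeight d}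

/-- The continuous function represented by an element with integrable Fourier transform. -/
def val (u : FourierSpace 𝕜 w) : Eu d → ℂ := 𝓕⁻ u.hat

theorem val_eq_of_ae (u : FourierSpace 𝕜 w) {g : Eu d → ℂ} (h : u.hat =ᵐ[volume] g) :
    u.val = 𝓕⁻ g :=
  funext fun x => Real.fourierInv_congr_ae h x

theorem val_smul (c : 𝕜) (u : FourierSpace 𝕜 w) (x : Eu d) :
    (c • u).val x = algebraMap 𝕜 ℂ c * u.val x := by
  rw [val_eq_of_ae _ (hat_smul c u), val, Real.fourierInv_eq, Real.fourierInv_eq,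
    ← integral_const_mul]
  refine integral_congr_ae (Eventually.of_forall fun ξ => ?_)
  simp only [Circle.smul_def, smul_eq_mul]
  ring

theorem represents_val (hL1 : ∀ u : FourierSpace 𝕜 w, Integrable u.hat)
    (u : FourierSpace 𝕜 w) : Represents u.toDistr u.val :=
  u.hat_represents.fourierInv (hL1 u)

theorem continuous_val (hL1 : ∀ u : FourierSpace 𝕜 w, Integrable u.hat)
    (u : FourierSpace 𝕜 w) : Continuous u.val :=
  continuous_fourierInv_of_integrable (hL1 u)

theorem ext_of_val (hL1 : ∀ u : FourierSpace 𝕜 w, Integrable u.hat)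
    {u v : FourierSpace 𝕜 w} (h : ∀ x, u.val x = v.val x) : u = v :=
  Subtype.ext ((represents_val hL1 u).unique (represents_val hL1 v) (Eventually.of_forall h))

theorem val_add (hL1 : ∀ u : FourierSpace 𝕜 w, Integrable u.hat)
    (u v : FourierSpace 𝕜 w) (x : Eu d) : (u + v).val x = u.val x + v.val x := by
  rw [val_eq_of_ae _ (hat_add u v), val, val, Real.fourierInv_eq, Real.fourierInv_eq,
    Real.fourierInv_eq, ← integral_add]
  · simp
  · simpa using (Real.fourierIntegral_convergent_iff (-x)).2 (hL1 u)
  · simpa using (Real.fourierIntegral_convergent_iff (-x)).2 (hL1 v)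

theorem val_mem_range (u : FourierSpace 𝕜 w) (x : Eu d) :
    u.val x ∈ Set.range (algebraMap 𝕜 ℂ) :=
  fourierInv_mem_range u.isHermitian_hat x

end FourierSpace

theorem ae_sub_left {d : ℕ} {p : Eu d → Prop} (h : ∀ᵐ η, p η) (ξ : Eu d) : ∀ᵐ η, p (ξ - η) :=
  (Measure.measurePreserving_sub_left volume ξ).quasiMeasurePreserving.ae h

open scoped Convolution in
theorem enorm_convolution_le {d : ℕ} (f g : Eu d → ℂ) (ξ : Eu d) :
    ‖(f ⋆[ContinuousLinearMap.mul ℂ ℂ] g) ξ‖ₑ ≤ ∫⁻ η, ‖f η‖ₑ * ‖g (ξ - η)‖ₑ := by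
  refine (enorm_integral_le_lintegral_enorm _).trans_eq (lintegral_congr fun η => ?_)
  simp

open scoped Convolution in
theorem isHermitian_convolution {d : ℕ} {𝕜 : Type*} [RCLike 𝕜] [NormedAlgebra 𝕜 ℂ] {f g : Eu d → ℂ}
    (hf : IsHermitian 𝕜 f) (hg : IsHermitian 𝕜 g) :
    IsHermitian 𝕜 (f ⋆[ContinuousLinearMap.mul ℂ ℂ] g) := by
  rcases hf with h | hf
  · exact Or.inl h
  rcases hg with h | hg
  · exact Or.inl h
  refine Or.inr (Eventually.of_forall fun ξ => ?_)
  rw [convolution_def, convolution_def, ← integral_conj, ← integral_neg_eq_self]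
  refine integral_congr_ae ?_
  filter_upwards [hf, ae_sub_left hg ξ] with η h1 h2
  have h3 : -ξ - -η = -(ξ - η) := by abel
  simp only [ContinuousLinearMap.mul_apply', map_mul]
  rw [h1, h3, h2]

open scoped Convolution in
theorem lintegral_sq_convolution_le {d : ℕ} {w : FourierWeight d} {C : ℝ≥0∞}
    (hC : ∀ a b : Eu d → ℝ≥0∞, Measurable a → Measurable b →
      ∫⁻ ξ, (w.sqrt ξ * ∫⁻ η, a η * b (ξ - η)) ^ 2 ≤
        C * ((∫⁻ ξ, (w.sqrt ξ * a ξ) ^ 2) * ∫⁻ ξ, (w.sqrt ξ * b ξ) ^ 2))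
    {f g : Eu d → ℂ} (hf : AEStronglyMeasurable f volume) (hg : AEStronglyMeasurable g volume) :
    ∫⁻ ξ, (w.sqrt ξ * ‖(f ⋆[ContinuousLinearMap.mul ℂ ℂ] g) ξ‖ₑ) ^ 2 ≤
      C * ((∫⁻ ξ, (w.sqrt ξ * ‖f ξ‖ₑ) ^ 2) * ∫⁻ ξ, (w.sqrt ξ * ‖g ξ‖ₑ) ^ 2) := by
  have h := hC (fun ξ => ‖hf.mk f ξ‖ₑ) (fun ξ => ‖hg.mk g ξ‖ₑ)
    hf.stronglyMeasurable_mk.measurable.enorm hg.stronglyMeasurable_mk.measurable.enorm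
  have hmk : ∀ {k : Eu d → ℂ} (hk : AEStronglyMeasurable k volume),
      ∫⁻ ξ, (w.sqrt ξ * ‖hk.mk k ξ‖ₑ) ^ 2 = ∫⁻ ξ, (w.sqrt ξ * ‖k ξ‖ₑ) ^ 2 := fun hk => by
    refine lintegral_congr_ae ?_
    filter_upwards [hk.ae_eq_mk] with ξ hξ
    rw [← hξ]
  rw [hmk, hmk] at h
  refine le_trans (lintegral_mono fun ξ => ?_) h
  gcongr
  refine (enorm_convolution_le f g ξ).trans_eq (lintegral_congr_ae ?_)
  filter_upwards [hf.ae_eq_mk, ae_sub_left hg.ae_eq_mk ξ] with η h1 h2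
  rw [← h1, ← h2]

namespace FourierSpace

variable {𝕜 : Type*} [RCLike 𝕜] [NormedAlgebra 𝕜 ℂ] {d : ℕ} {w : FourierWeight d}

open scoped Convolution in
theorem fourierInv_convolution {f g : Eu d → ℂ} (hf : Integrable f) (hg : Integrable g)
    (x : Eu d) : 𝓕⁻ (f ⋆[ContinuousLinearMap.mul ℂ ℂ] g) x = 𝓕⁻ f x * 𝓕⁻ g x := by
  simp only [Real.fourierInv_eq_fourier_neg]
  exact Real.fourier_mul_convolution_eq hf hg (-x)

open scoped Convolution in
/-- Pointwise multiplication as a bounded bilinear map. -/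
theorem exists_mul (hw : w.Tempered) (hL1 : ∀ u : FourierSpace 𝕜 w, Integrable u.hat)
    {C : ℝ≥0∞} (hCt : C ≠ ⊤) (hC : ∀ a b : Eu d → ℝ≥0∞, Measurable a → Measurable b →
      ∫⁻ ξ, (w.sqrt ξ * ∫⁻ η, a η * b (ξ - η)) ^ 2 ≤
        C * ((∫⁻ ξ, (w.sqrt ξ * a ξ) ^ 2) * ∫⁻ ξ, (w.sqrt ξ * b ξ) ^ 2)) :
    ∃ B : FourierSpace 𝕜 w →L[𝕜] FourierSpace 𝕜 w →L[𝕜] FourierSpace 𝕜 w,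
      ∀ u v x, (B u v).val x = u.val x * v.val x := by
  have hbd : ∀ u v : FourierSpace 𝕜 w,
      ∫⁻ ξ, (w.sqrt ξ * ‖(u.hat ⋆[ContinuousLinearMap.mul ℂ ℂ] v.hat) ξ‖ₑ) ^ 2 ≤
        C * (‖u‖ₑ ^ 2 * ‖v‖ₑ ^ 2) := fun u v => by
    rw [u.enorm_sq_eq EventuallyEq.rfl, v.enorm_sq_eq EventuallyEq.rfl]
    exact lintegral_sq_convolution_le hC u.aestronglyMeasurable_hat v.aestronglyMeasurable_hat
  have hex : ∀ u v : FourierSpace 𝕜 w, ∃ z : FourierSpace 𝕜 w,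
      z.hat =ᵐ[volume] u.hat ⋆[ContinuousLinearMap.mul ℂ ℂ] v.hat := fun u v => by
    refine exists_hat_eq hw (w.memLp_of_lintegral
      ((hL1 u).integrable_convolution _ (hL1 v)).aestronglyMeasurable ?_)
      (isHermitian_convolution u.isHermitian_hat v.isHermitian_hat)
    exact (hbd u v).trans_lt (ENNReal.mul_lt_top hCt.lt_top
      (ENNReal.mul_lt_top (by simp) (by simp)))
  choose P hP using hex
  have hval : ∀ u v x, (P u v).val x = u.val x * v.val x := fun u v x => by
    rw [val_eq_of_ae _ (hP u v), fourierInv_convolution (hL1 u) (hL1 v)]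
    rfl
  -- Elements are determined by their values, so bilinearity reduces to that of multiplication in ℂ.
  refine ⟨LinearMap.mkContinuous₂ (LinearMap.mk₂ 𝕜 P (fun u v z => ext_of_val hL1 fun x => ?_)
    (fun c u v => ext_of_val hL1 fun x => ?_) (fun u v z => ext_of_val hL1 fun x => ?_)
    (fun c u v => ext_of_val hL1 fun x => ?_)) √C.toReal fun u v => ?_, hval⟩
  · rw [hval, val_add hL1, val_add hL1, hval, hval, add_mul]
  · rw [hval, val_smul, val_smul, hval, mul_assoc]
  · rw [hval, val_add hL1, val_add hL1, hval, hval, mul_add]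
  · rw [hval, val_smul, val_smul, hval]
    ring
  · have h1 : ‖P u v‖ₑ ^ 2 ≤ C * ‖(‖u‖ * ‖v‖ : ℝ)‖ₑ ^ 2 := by
      rw [enorm_mul, enorm_norm, enorm_norm, mul_pow]
      exact ((P u v).enorm_sq_eq (hP u v)).trans_le (hbd u v)
    have h2 := norm_le_mul_of_enorm_sq_le hCt h1
    rwa [Real.norm_of_nonneg (by positivity), ← mul_assoc] at h2

/-- Pointwise evaluation as a bounded linear functional. -/
theorem exists_eval (hL1 : ∀ u : FourierSpace 𝕜 w, Integrable u.hat)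
    {C : ℝ≥0∞} (hCt : C ≠ ⊤) (hC : ∫⁻ ξ, ENNReal.ofReal (1 / w.toFun ξ) ≤ C) :
    ∃ ev : Eu d → FourierSpace 𝕜 w →L[𝕜] 𝕜, (∀ x u, algebraMap 𝕜 ℂ (ev x u) = u.val x) ∧
      ∀ x u, ‖ev x u‖ ≤ √C.toReal * ‖u‖ := by
  have hbd : ∀ u : FourierSpace 𝕜 w, ∀ x, ‖u.val x‖ₑ ^ 2 ≤ C * ‖u‖ₑ ^ 2 := fun u x => by
    have hm := u.aestronglyMeasurable_hat
    have h1 : ‖u.val x‖ₑ ≤ ∫⁻ ξ, 1 * ‖hm.mk u.hat ξ‖ₑ := by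
      rw [val, Real.fourierInv_eq]
      refine (enorm_integral_le_lintegral_enorm _).trans_eq (lintegral_congr_ae ?_)
      filter_upwards [hm.ae_eq_mk] with ξ hξ
      rw [← hξ, one_mul, ← ofReal_norm, Circle.norm_smul, ofReal_norm]
    refine (pow_le_pow_left' h1 2).trans ((sq_lintegral_le_of_weight w measurable_const
      hm.stronglyMeasurable_mk.measurable.enorm).trans ?_)
    rw [u.enorm_sq_eq hm.ae_eq_mk]
    simp only [one_pow, one_mul]
    gcongr
  choose E hE using fun (x : Eu d) (u : FourierSpace 𝕜 w) => val_mem_range u x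
  have hinj := (algebraMap 𝕜 ℂ).injective
  have hEb : ∀ x u, ‖E x u‖ ≤ √C.toReal * ‖u‖ := fun x u => by
    rw [← norm_algebraMap_field, hE]
    exact norm_le_mul_of_enorm_sq_le hCt (hbd u x)
  refine ⟨fun x => LinearMap.mkContinuous
    { toFun := E x
      map_add' := fun u v => hinj ?_
      map_smul' := fun c u => hinj ?_ } √C.toReal (hEb x), hE, hEb⟩
  · rw [map_add, hE, hE, hE, val_add hL1]
  · rw [hE, val_smul, RingHom.id_apply, smul_eq_mul, map_mul, hE]

end FourierSpace

/-! ### Power series of multiplication operators -/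

section PowerSeries

variable {𝕜 : Type*} [RCLike 𝕜]

theorem exists_antideriv {ψ : 𝕜 → 𝕜} {q : FormalMultilinearSeries 𝕜 𝕜 𝕜} {R : ℝ≥0∞}
    (h : HasFPowerSeriesOnBall ψ q 0 R) :
    ∃ (Ψ : 𝕜 → 𝕜) (P : FormalMultilinearSeries 𝕜 𝕜 𝕜), HasFPowerSeriesOnBall Ψ P 0 R ∧ Ψ 0 = 0 ∧
      ∀ y, ‖y‖ₑ < R → HasDerivAt Ψ (ψ y) y := by
  -- Termwise integration. At `n = 0` the convention `0⁻¹ = 0` kills the constant term, which gives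
  -- `Ψ 0 = 0`.
  set P : FormalMultilinearSeries 𝕜 𝕜 𝕜 :=
    FormalMultilinearSeries.ofScalars 𝕜 (fun n => q.coeff (n - 1) * (n : 𝕜)⁻¹) with hP
  have hcoeff : ∀ n, P.coeff n = q.coeff (n - 1) * (n : 𝕜)⁻¹ := fun n =>
    FormalMultilinearSeries.coeff_ofScalars
  have hrad : R ≤ P.radius := by
    refine ENNReal.le_of_forall_nnreal_lt fun r hr => ?_
    obtain ⟨C, hC, hCb⟩ := q.norm_mul_pow_le_of_lt_radius (hr.trans_le h.r_le)
    refine P.le_radius_of_eventually_le (C * r) ?_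
    filter_upwards [eventually_ge_atTop 1] with n hn
    obtain ⟨k, rfl⟩ := Nat.exists_eq_add_of_le' hn
    rw [FormalMultilinearSeries.norm_apply_eq_norm_coef, hcoeff, pow_succ, ← mul_assoc, norm_mul,
      Nat.add_sub_cancel]
    have h1 : ‖(((k + 1 : ℕ) : 𝕜))⁻¹‖ ≤ 1 := by
      rw [norm_inv, RCLike.norm_natCast]
      exact inv_le_one_of_one_le₀ (by simp)
    have h2 := hCb k
    rw [FormalMultilinearSeries.norm_apply_eq_norm_coef] at h2
    gcongr
    calc _ ≤ ‖q.coeff k‖ * 1 * (r : ℝ) ^ k := by gcongr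
      _ ≤ C := by rwa [mul_one]
  have hΨ : HasFPowerSeriesOnBall P.sum P 0 R :=
    (P.hasFPowerSeriesOnBall (h.r_pos.trans_le hrad)).mono h.r_pos hrad
  refine ⟨P.sum, P, hΨ, ?_, fun y hy => ?_⟩
  · rw [← hΨ.coeff_zero 0, FormalMultilinearSeries.apply_eq_prod_smul_coeff, hcoeff]
    simp
  · have hy' : y ∈ Metric.eball (0 : 𝕜) R := by simpa [edist_zero_right] using hy
    have hd : DifferentiableAt 𝕜 P.sum y := (hΨ.analyticAt_of_mem hy').differentiableAt
    have h1 := hΨ.fderiv.hasSum hy'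
    rw [zero_add] at h1
    have h2 := (ContinuousLinearMap.apply 𝕜 𝕜 (1 : 𝕜)).hasSum h1
    have h3 := h.hasSum hy'
    rw [zero_add] at h3
    have h4 : ∀ n, ContinuousLinearMap.apply 𝕜 𝕜 (1 : 𝕜) (P.derivSeries n fun _ => y) =
        q n fun _ => y := fun n => by
      rw [FormalMultilinearSeries.apply_eq_pow_smul_coeff, map_smul,
        ContinuousLinearMap.apply_apply, FormalMultilinearSeries.derivSeries_coeff_one, hcoeff,
        FormalMultilinearSeries.apply_eq_pow_smul_coeff, Nat.add_sub_cancel]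
      congr 1
      have : ((n : 𝕜) + 1) ≠ 0 := by exact_mod_cast Nat.succ_ne_zero n
      simp only [nsmul_eq_mul, Nat.cast_add, Nat.cast_one]
      field_simp
    simp only [h4] at h2
    have h5 := h2.unique h3
    rw [ContinuousLinearMap.apply_apply] at h5
    rw [← h5, fderiv_eq_smul_deriv, one_smul]
    exact hd.hasDerivAt

variable {E : Type*} [NormedAddCommGroup E] [NormedSpace 𝕜 E]

theorem eval_pow {B : E →L[𝕜] E →L[𝕜] E} {ev : E →L[𝕜] 𝕜}
    (hev : ∀ u v, ev (B u v) = ev u * ev v) (u : E) (n : ℕ) :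
    ev ((B u ^ n) u) = ev u ^ (n + 1) := by
  induction n with
  | zero => simp
  | succ n ih => rw [pow_succ', mul_apply_eq_comp, hev, ih, ← pow_succ']

/-- Composition with a power series vanishing at the origin, in a space with a bounded product. -/
theorem exists_comp_powerSeries [CompleteSpace E] (B : E →L[𝕜] E →L[𝕜] E) {ζ : 𝕜 → 𝕜}
    {p : FormalMultilinearSeries 𝕜 𝕜 𝕜} {R : ℝ≥0∞} (hζ : HasFPowerSeriesOnBall ζ p 0 R)
    (hζ0 : ζ 0 = 0) {α : 𝕜} (hα : HasDerivAt ζ α 0) :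
    ∃ Φ : E → E, AnalyticAt 𝕜 Φ 0 ∧ Φ 0 = 0 ∧ HasFDerivAt Φ (α • ContinuousLinearMap.id 𝕜 E) 0 ∧
      ∀ᶠ u in 𝓝 (0 : E), ∀ ev : E →L[𝕜] 𝕜, (∀ u v, ev (B u v) = ev u * ev v) →
        ‖ev u‖ₑ < R → ev (Φ u) = ζ (ev u) := by
  -- `E` has no unit, and `B` is not assumed associative. Writing ζ(y) = g(y) y with g(y) = ∑ pₙ₊₁
  -- yⁿ, one evaluates g at `B u` in the unital Banach algebra of operators on `E` and sets Φ(u) =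
  -- g(B u) u. The derivative at 0 is then g(0) = ζ'(0) times the identity.
  set c : ℕ → 𝕜 := fun n => p.coeff (n + 1) with hc
  set q : FormalMultilinearSeries 𝕜 (E →L[𝕜] E) (E →L[𝕜] E) :=
    FormalMultilinearSeries.ofScalars (E →L[𝕜] E) c with hq
  obtain ⟨r, hr0, hrR⟩ := ENNReal.lt_iff_exists_nnreal_btwn.1 hζ.r_pos
  have hrad : (r : ℝ≥0∞) ≤ q.radius := by
    obtain ⟨C, hC, hCb⟩ := p.norm_mul_pow_le_of_lt_radius (hrR.trans_le hζ.r_le)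
    have hr' : (0 : ℝ) < r := by exact_mod_cast hr0
    refine q.le_radius_of_eventually_le (C / r) ?_
    filter_upwards [eventually_gt_atTop 0] with n hn
    have h1 := hCb (n + 1)
    rw [FormalMultilinearSeries.norm_apply_eq_norm_coef, pow_succ, ← mul_assoc] at h1
    rw [le_div_iff₀ hr']
    refine le_trans ?_ h1
    gcongr
    exact FormalMultilinearSeries.ofScalars_norm_le (E →L[𝕜] E) c n hn
  have hqs : HasFPowerSeriesOnBall q.sum q 0 q.radius :=
    q.hasFPowerSeriesOnBall (hr0.trans_le hrad)
  have hB0 : B 0 = 0 := map_zero B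
  have hgan : AnalyticAt 𝕜 (fun u => q.sum (B u)) 0 := by
    refine AnalyticAt.fun_comp ?_ (B.analyticAt 0)
    rw [hB0]
    exact hqs.analyticAt
  have hg0 : q.sum (B 0) = α • ContinuousLinearMap.id 𝕜 E := by
    have h1 := FormalMultilinearSeries.ofScalarsSum_zero (E := E →L[𝕜] E) c
    have h2 : c 0 = α := by
      have := hζ.hasFPowerSeriesAt.hasDerivAt.unique hα
      rw [← this]
      rfl
    rw [hB0, ← h2]
    exact h1
  have hΦan : AnalyticAt 𝕜 (fun u => q.sum (B u) u) 0 := by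
    -- `⊤ : WithTop ℕ∞` is the analytic exponent `ω`, not C^∞.
    have := (hgan.contDiffAt (n := (⊤ : WithTop ℕ∞))).clm_apply contDiffAt_id
    exact this.analyticAt
  refine ⟨fun u => q.sum (B u) u, hΦan, map_zero _, ?_, ?_⟩
  · have := hgan.differentiableAt.hasFDerivAt.clm_apply (hasFDerivAt_id (𝕜 := 𝕜) (0 : E))
    refine this.congr_fderiv ?_
    rw [hg0]
    ext h
    simp
  · have hnhds : ∀ᶠ u in 𝓝 (0 : E), B u ∈ Metric.eball (0 : E →L[𝕜] E) q.radius := by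
      refine B.continuous.continuousAt.eventually ?_
      rw [hB0]
      exact Metric.eball_mem_nhds _ hqs.r_pos
    filter_upwards [hnhds] with u hu ev hev hlt
    have h1 := hqs.hasSum hu
    rw [zero_add] at h1
    have h2 := (ev ∘L ContinuousLinearMap.apply 𝕜 E u).hasSum h1
    have hy' : ev u ∈ Metric.eball (0 : 𝕜) R := by simpa [edist_zero_right] using hlt
    have h3 := hζ.hasSum hy'
    -- The series of `ζ` is shifted by one to match that of g(B u) u; the dropped term is ζ(0) = 0.
    rw [zero_add, ← hasSum_nat_add_iff' 1] at h3
    have h4 : ∀ n, (ev ∘L ContinuousLinearMap.apply 𝕜 E u) (q n fun _ => B u) =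
        p (n + 1) fun _ => ev u := fun n => by
      rw [FormalMultilinearSeries.apply_eq_pow_smul_coeff, hq,
        FormalMultilinearSeries.ofScalars_apply_eq]
      have h7 := eval_pow hev u n
      rw [ContinuousLinearMap.comp_apply, map_smul, map_smul, ContinuousLinearMap.apply_apply, h7,
        smul_eq_mul, smul_eq_mul, mul_comm]
    simp only [h4] at h2
    have h5 := h2.unique h3
    rwa [Finset.sum_range_one, hζ.coeff_zero, hζ0, sub_zero] at h5

end PowerSeries

/-! ### The analytic inverse function theorem -/

/-- Uniqueness is injectivity on the source of the local homeomorphism, which survives intersection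
with `Ω`. The set `𝒰` is then shrunk so that the inverse maps it into the smaller `𝒱` and is
analytic at every point. -/
theorem exists_analytic_inverse {𝕜 : Type*} [RCLike 𝕜] {E F : Type*} [NormedAddCommGroup E]
    [NormedSpace 𝕜 E] [CompleteSpace E] [NormedAddCommGroup F] [NormedSpace 𝕜 F] {N : E → F}
    (hN : AnalyticAt 𝕜 N 0) (hN0 : N 0 = 0) (L : E ≃L[𝕜] F)
    (hL : HasFDerivAt N (L : E →L[𝕜] F) 0) {Ω : Set E} (hΩ : Ω ∈ 𝓝 (0 : E)) :
    ∃ (𝒰 : Set F) (𝒱 : Set E) (S : F → E), IsOpen 𝒰 ∧ 0 ∈ 𝒰 ∧ IsOpen 𝒱 ∧ 0 ∈ 𝒱 ∧ 𝒱 ⊆ Ω ∧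
      (∀ f ∈ 𝒰, ∀ u ∈ 𝒱, N u = f ↔ u = S f) ∧ (∀ f ∈ 𝒰, S f ∈ 𝒱) ∧ AnalyticOnNhd 𝕜 S 𝒰 := by
  have : CompleteSpace F := (completeSpace_congr (e := L.toEquiv) L.isUniformEmbedding).1 inferInstance
  have hcd : ContDiffAt 𝕜 (⊤ : WithTop ℕ∞) N 0 := hN.contDiffAt
  have htop : (⊤ : WithTop ℕ∞) ≠ 0 := by simp
  set e := hcd.toOpenPartialHomeomorph N hL htop with he
  have hesrc : (0 : E) ∈ e.source := hcd.mem_toOpenPartialHomeomorph_source hL htop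
  have hetgt : (0 : F) ∈ e.target := by
    have := hcd.image_mem_toOpenPartialHomeomorph_target hL htop
    rwa [hN0] at this
  have hcoe : ∀ u, e u = N u := fun u => rfl
  have hS0 : e.symm 0 = 0 := by
    have := e.left_inv hesrc
    rwa [hcoe, hN0] at this
  have hSan : AnalyticAt 𝕜 e.symm 0 := by
    have h1 := hcd.to_localInverse hL htop
    rw [hN0] at h1
    exact h1.analyticAt
  set 𝒱 : Set E := e.source ∩ interior Ω with h𝒱
  have h𝒱o : IsOpen 𝒱 := e.open_source.inter isOpen_interior
  have h0𝒱 : (0 : E) ∈ 𝒱 := ⟨hesrc, mem_interior_iff_mem_nhds.2 hΩ⟩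
  have hUn : ∀ᶠ f in 𝓝 (0 : F), f ∈ e.target ∧ e.symm f ∈ 𝒱 ∧ AnalyticAt 𝕜 e.symm f := by
    refine (e.open_target.eventually_mem hetgt).and (Eventually.and ?_ hSan.eventually_analyticAt)
    refine hSan.continuousAt.eventually ?_
    rw [hS0]
    exact h𝒱o.mem_nhds h0𝒱
  obtain ⟨𝒰, hsub, h𝒰o, h0𝒰⟩ := eventually_nhds_iff.1 hUn
  refine ⟨𝒰, 𝒱, e.symm, h𝒰o, h0𝒰, h𝒱o, h0𝒱, fun u hu => interior_subset hu.2,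
    fun f hf u hu => ⟨fun h => ?_, fun h => ?_⟩, fun f hf => (hsub f hf).2.1,
    fun f hf => (hsub f hf).2.2⟩
  · rw [← h, ← hcoe, e.left_inv hu.1]
  · rw [h, ← hcoe, e.right_inv (hsub f hf).1]

/-! ### The linear part -/

section Linear

variable {d : ℕ} [NeZero d] {s r δ : ℝ}

/-- Together with `omega_le_hsWeight_mul`, this identifies ω_{s+δ} up to constants with the target
weight times ξ₁² + |ξ|^{2δ}. For |ξ| < 1 the term |ξ|^{-2r} dominates the target weight; for |ξ| ≥ 1
the Sobolev term does, and ξ₁² is absorbed because δ > 1. -/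
theorem hsWeight_mul_le_omega (hs : 0 ≤ s) (hr : 0 ≤ r) (hδ : 1 < δ) (ξ : Eu d) (hξ : ξ ≠ 0) :
    (hsWeight (d := d) s r).toFun ξ * (ξ 0 ^ 2 + ‖ξ‖ ^ (2 * δ)) ≤
      (2 ^ s + 4) * (omega (d := d) (s + δ) r δ).toFun ξ := by
  have hn : 0 < ‖ξ‖ := norm_pos_iff.2 hξ
  have h2s : (0 : ℝ) ≤ 2 ^ s := by positivity
  have hA : 0 ≤ ξ 0 ^ 2 + ‖ξ‖ ^ (2 * δ) := by positivity
  simp only [hsWeight]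
  rcases lt_or_ge ‖ξ‖ 1 with h1 | h1
  · rw [omega_of_lt _ h1, div_eq_mul_inv, ← Real.rpow_neg hn.le, ← neg_mul,
      mul_comm _ (‖ξ‖ ^ (-2 * r)), ← mul_assoc]
    refine mul_le_mul_of_nonneg_right ?_ hA
    have h3 : (1 + ‖ξ‖ ^ 2) ^ s ≤ 2 ^ s := by
      gcongr
      nlinarith
    have h4 : 1 ≤ ‖ξ‖ ^ (-2 * r) := Real.one_le_rpow_of_pos_of_le_one_of_nonpos hn h1.le (by linarith)
    nlinarith
  · rw [omega_of_le _ h1, Real.rpow_add (by positivity)]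
    have h3 : 1 ≤ (1 + ‖ξ‖ ^ 2) ^ s := Real.one_le_rpow (by nlinarith) hs
    have h4 : ‖ξ‖ ^ (-2 * r) ≤ 1 := Real.rpow_le_one_of_one_le_of_nonpos h1 (by linarith)
    have h5 : ‖ξ‖ ^ (2 * δ) ≤ (1 + ‖ξ‖ ^ 2) ^ δ := by
      rw [Real.rpow_mul hn.le, Real.rpow_two]
      gcongr
      linarith
    have h6 : ξ 0 ^ 2 ≤ (1 + ‖ξ‖ ^ 2) ^ δ :=
      (coord_sq_le ξ).trans ((by linarith : ‖ξ‖ ^ 2 ≤ 1 + ‖ξ‖ ^ 2).trans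
        (Real.self_le_rpow_of_one_le (by nlinarith) hδ.le))
    calc ((1 + ‖ξ‖ ^ 2) ^ s + ‖ξ‖ ^ (-2 * r)) * (ξ 0 ^ 2 + ‖ξ‖ ^ (2 * δ))
        ≤ (2 * (1 + ‖ξ‖ ^ 2) ^ s) * (2 * (1 + ‖ξ‖ ^ 2) ^ δ) := by gcongr <;> linarith
      _ = 4 * ((1 + ‖ξ‖ ^ 2) ^ s * (1 + ‖ξ‖ ^ 2) ^ δ) := by ring
      _ ≤ _ := by
          gcongr
          linarith

theorem omega_le_hsWeight_mul (hδ : 1 < δ) (ξ : Eu d) (hξ : ξ ≠ 0) :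
    (omega (d := d) (s + δ) r δ).toFun ξ ≤
      2 ^ δ * ((hsWeight (d := d) s r).toFun ξ * (ξ 0 ^ 2 + ‖ξ‖ ^ (2 * δ))) := by
  have hn : 0 < ‖ξ‖ := norm_pos_iff.2 hξ
  have hA : 0 ≤ ξ 0 ^ 2 + ‖ξ‖ ^ (2 * δ) := by positivity
  have hw : 0 ≤ (1 + ‖ξ‖ ^ 2) ^ s := by positivity
  have hw' : 0 ≤ ‖ξ‖ ^ (-2 * r) := by positivity
  simp only [hsWeight]
  rcases lt_or_ge ‖ξ‖ 1 with h1 | h1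
  · rw [omega_of_lt _ h1, div_eq_mul_inv, ← Real.rpow_neg hn.le, ← neg_mul,
      mul_comm _ (‖ξ‖ ^ (-2 * r))]
    refine le_trans ?_ (le_mul_of_one_le_left (by positivity)
      (Real.one_le_rpow (by norm_num) (by linarith)))
    gcongr
    linarith
  · rw [omega_of_le _ h1, Real.rpow_add (by positivity)]
    calc (1 + ‖ξ‖ ^ 2) ^ s * (1 + ‖ξ‖ ^ 2) ^ δ
        ≤ (1 + ‖ξ‖ ^ 2) ^ s * (2 ^ δ * ‖ξ‖ ^ (2 * δ)) := by
          rw [Real.rpow_mul hn.le, Real.rpow_two, ← Real.mul_rpow (by norm_num) (by positivity)]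
          gcongr
          nlinarith
      _ = 2 ^ δ * ((1 + ‖ξ‖ ^ 2) ^ s * ‖ξ‖ ^ (2 * δ)) := by ring
      _ ≤ _ := by
          gcongr
          · linarith
          · nlinarith [sq_nonneg (ξ 0)]

theorem ae_ne_zero : ∀ᵐ ξ : Eu d, ξ ≠ 0 := by simp [ae_iff]

/-- The symbol `-2πi c ξ₁` of `-c ∂₁`. -/
def advectionSymbol (d : ℕ) [NeZero d] (c : ℝ) (ξ : Eu d) : ℂ :=
  -(c : ℂ) * (2 * Real.pi * Complex.I * (ξ 0 : ℂ))

/-- The symbol `(2π|ξ|)^δ` of `(-Δ)^{δ/2}`. -/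
def diffusionSymbol (d : ℕ) (δ : ℝ) (ξ : Eu d) : ℂ := (((2 * Real.pi * ‖ξ‖) ^ δ : ℝ) : ℂ)

theorem norm_diffusionSymbol_sq {d : ℕ} {δ : ℝ} (ξ : Eu d) :
    ‖diffusionSymbol d δ ξ‖ ^ 2 = (2 * Real.pi) ^ (2 * δ) * ‖ξ‖ ^ (2 * δ) := by
  have := Real.pi_pos
  rw [diffusionSymbol, Complex.norm_real, Real.norm_of_nonneg (by positivity),
    ← Real.mul_rpow (by positivity) (by positivity), ← Real.rpow_natCast,
    ← Real.rpow_mul (by positivity), mul_comm δ]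
  norm_num

/-- For real `c` the advection symbol is imaginary and the diffusion symbol is real, so they cannot
cancel. This is where the reality of γζ'(0) matters. -/
theorem norm_symbol_sq (c : ℝ) (ξ : Eu d) :
    ‖advectionSymbol d c ξ + diffusionSymbol d δ ξ‖ ^ 2 =
      (2 * Real.pi * c) ^ 2 * ξ 0 ^ 2 + (2 * Real.pi) ^ (2 * δ) * ‖ξ‖ ^ (2 * δ) := by
  rw [← norm_diffusionSymbol_sq, diffusionSymbol, Complex.norm_real, Real.norm_eq_abs, sq_abs,
    ← Complex.normSq_eq_norm_sq, Complex.normSq_apply]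
  simp only [advectionSymbol, Complex.add_re, Complex.add_im, Complex.mul_re, Complex.mul_im,
    Complex.neg_re, Complex.neg_im, Complex.ofReal_re, Complex.ofReal_im, Complex.I_re,
    Complex.I_im, Complex.re_ofNat, Complex.im_ofNat]
  ring

variable (𝕜 : Type*) [RCLike 𝕜] [NormedAlgebra 𝕜 ℂ]

theorem exists_advection (hs : 0 ≤ s) (hr : 0 ≤ r) (hδ : 1 < δ) (c : ℝ) :
    ∃ D : XSpace 𝕜 d (s + δ) r δ →L[𝕜] HSpace 𝕜 d s r,
      ∀ u, (D u).hat =ᵐ[volume] fun ξ => advectionSymbol d c ξ * u.hat ξ := by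
  refine FourierSpace.exists_multiplier (hsWeight_tempered hs)
    (C := (2 * Real.pi * c) ^ 2 * (2 ^ s + 4)) (by unfold advectionSymbol; fun_prop)
    (fun ξ => ?_) (by positivity) ?_
  · simp [advectionSymbol, Complex.conj_ofNat]
  · filter_upwards [ae_ne_zero] with ξ hξ
    have h1 : ‖advectionSymbol d c ξ‖ ^ 2 = (2 * Real.pi * c) ^ 2 * ξ 0 ^ 2 := by
      simp only [advectionSymbol, norm_mul, norm_neg, Complex.norm_real, Complex.norm_I,
        Complex.norm_ofNat, mul_pow, Real.norm_eq_abs, sq_abs]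
      ring
    have h2 := hsWeight_mul_le_omega hs hr hδ ξ hξ
    have h3 : 0 ≤ (hsWeight (d := d) s r).toFun ξ := by
      simp only [hsWeight]
      positivity
    rw [h1, mul_left_comm, mul_assoc ((2 * Real.pi * c) ^ 2)]
    refine mul_le_mul_of_nonneg_left (le_trans ?_ h2) (by positivity)
    refine mul_le_mul_of_nonneg_left ?_ h3
    exact le_add_of_nonneg_right (by positivity)

theorem exists_diffusion (hs : 0 ≤ s) (hr : 0 ≤ r) (hδ : 1 < δ) :
    ∃ F : XSpace 𝕜 d (s + δ) r δ →L[𝕜] HSpace 𝕜 d s r,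
      ∀ u, (F u).hat =ᵐ[volume] fun ξ => diffusionSymbol d δ ξ * u.hat ξ := by
  refine FourierSpace.exists_multiplier (hsWeight_tempered hs)
    (C := (2 * Real.pi) ^ (2 * δ) * (2 ^ s + 4)) (by unfold diffusionSymbol; fun_prop)
    (fun ξ => ?_) (by positivity) ?_
  · simp [diffusionSymbol]
  · filter_upwards [ae_ne_zero] with ξ hξ
    have h2 := hsWeight_mul_le_omega hs hr hδ ξ hξ
    have h3 : 0 ≤ (hsWeight (d := d) s r).toFun ξ := by
      simp only [hsWeight]
      positivity
    rw [norm_diffusionSymbol_sq, mul_assoc, mul_left_comm]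
    refine mul_le_mul_of_nonneg_left (le_trans ?_ h2) (by positivity)
    refine mul_le_mul_of_nonneg_left ?_ h3
    exact le_add_of_nonneg_left (by positivity)

theorem exists_symbol_inverse (hd : 2 ≤ d) (hδ : 1 < δ) (hdim : 1 + δ - 2 * r < d)
    (ht : (d : ℝ) / 2 + 1 < s + δ) {c : ℝ} (hc : c ≠ 0) :
    ∃ M : HSpace 𝕜 d s r →L[𝕜] XSpace 𝕜 d (s + δ) r δ, ∀ f, (M f).hat =ᵐ[volume]
      fun ξ => (advectionSymbol d c ξ + diffusionSymbol d δ ξ)⁻¹ * f.hat ξ := by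
  have hpi := Real.pi_pos
  -- The lower bound for the squared symbol relative to ξ₁² + |ξ|^{2δ}; it is positive because `c ≠
  -- 0`.
  set κ : ℝ := min ((2 * Real.pi * c) ^ 2) ((2 * Real.pi) ^ (2 * δ)) with hκ
  have hκ0 : 0 < κ := lt_min (by positivity) (by positivity)
  refine FourierSpace.exists_multiplier (omega_tempered hd (by linarith) hdim ht)
    (C := 2 ^ δ / κ) (by unfold advectionSymbol diffusionSymbol; fun_prop)
    (fun ξ => ?_) (by positivity) ?_
  · simp [advectionSymbol, diffusionSymbol, Complex.conj_ofNat]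
  · filter_upwards [ae_ne_zero] with ξ hξ
    have hn : 0 < ‖ξ‖ := norm_pos_iff.2 hξ
    have h1 : κ * (ξ 0 ^ 2 + ‖ξ‖ ^ (2 * δ)) ≤
        ‖advectionSymbol d c ξ + diffusionSymbol d δ ξ‖ ^ 2 := by
      rw [norm_symbol_sq, mul_add]
      gcongr
      · exact min_le_left _ _
      · exact min_le_right _ _
    have h2 := omega_le_hsWeight_mul (s := s) (r := r) hδ ξ hξ
    have hA : 0 < ξ 0 ^ 2 + ‖ξ‖ ^ (2 * δ) := by positivity
    have h3 : 0 ≤ (hsWeight (d := d) s r).toFun ξ := by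
      simp only [hsWeight]
      positivity
    rw [norm_inv, inv_pow, ← div_eq_mul_inv, div_le_iff₀ (lt_of_lt_of_le (by positivity) h1)]
    calc _ ≤ _ := h2
      _ = 2 ^ δ / κ * (hsWeight (d := d) s r).toFun ξ * (κ * (ξ 0 ^ 2 + ‖ξ‖ ^ (2 * δ))) := by
          field_simp
      _ ≤ _ := by gcongr

theorem exists_linearEquiv (hd : 2 ≤ d) (hδ : 1 < δ) (hdim : 1 + δ - 2 * r < d)
    (ht : (d : ℝ) / 2 + 1 < s + δ) {γ α : ℝ} (hγ : γ ≠ 0) (hα : α ≠ 0)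
    {D F : XSpace 𝕜 d (s + δ) r δ →L[𝕜] HSpace 𝕜 d s r}
    (hD : ∀ u, (D u).hat =ᵐ[volume] fun ξ => advectionSymbol d γ ξ * u.hat ξ)
    (hF : ∀ u, (F u).hat =ᵐ[volume] fun ξ => diffusionSymbol d δ ξ * u.hat ξ) :
    ∃ L : XSpace 𝕜 d (s + δ) r δ ≃L[𝕜] HSpace 𝕜 d s r,
      (L : XSpace 𝕜 d (s + δ) r δ →L[𝕜] HSpace 𝕜 d s r) = (α : 𝕜) • D + F := by
  obtain ⟨M, hM⟩ := exists_symbol_inverse 𝕜 hd hδ hdim ht (mul_ne_zero hγ hα)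
  have hL : ∀ u, (((α : 𝕜) • D + F) u).hat =ᵐ[volume]
      fun ξ => (advectionSymbol d (γ * α) ξ + diffusionSymbol d δ ξ) * u.hat ξ := fun u => by
    filter_upwards [hD u, hF u, FourierSpace.hat_add ((α : 𝕜) • D u) (F u),
      FourierSpace.hat_smul (α : 𝕜) (D u)] with ξ h1 h2 h3 h4
    have h5 : (((α : 𝕜) • D + F) u) = (α : 𝕜) • D u + F u := rfl
    rw [h5, h3, h4, h1, h2, algebraMap_ofReal, advectionSymbol, advectionSymbol]
    push_cast
    ring
  have hne : ∀ ξ : Eu d, ξ ≠ 0 → advectionSymbol d (γ * α) ξ + diffusionSymbol d δ ξ ≠ 0 :=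
    fun ξ hξ h => by
      have hn : 0 < ‖ξ‖ := norm_pos_iff.2 hξ
      have hpi := Real.pi_pos
      have h1 := norm_symbol_sq (δ := δ) (γ * α) ξ
      rw [h, norm_zero] at h1
      have h2 : 0 < (2 * Real.pi) ^ (2 * δ) * ‖ξ‖ ^ (2 * δ) := by positivity
      nlinarith [sq_nonneg (2 * Real.pi * (γ * α) * ξ 0)]
  refine ⟨ContinuousLinearEquiv.equivOfInverse ((α : 𝕜) • D + F) M
    (fun u => FourierSpace.ext_of_hat ?_) (fun f => FourierSpace.ext_of_hat ?_), rfl⟩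
  · filter_upwards [hM (((α : 𝕜) • D + F) u), hL u, ae_ne_zero] with ξ h1 h2 h3
    rw [h1, h2, inv_mul_cancel_left₀ (hne ξ h3)]
  · filter_upwards [hM f, hL (M f), ae_ne_zero] with ξ h1 h2 h3
    rw [h2, h1, mul_inv_cancel_left₀ (hne ξ h3)]

end Linear

/-! ### Derivatives -/

/-- The embedding is isometric and real-linear, so convergence of difference quotients passes both
ways. The chain rule for `Ψ` can thus be applied inside `𝕜`. -/
theorem hasDerivAt_algebraMap_iff {𝕜 : Type*} [RCLike 𝕜] [NormedAlgebra 𝕜 ℂ] {f : ℝ → 𝕜} {f' : 𝕜}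
    {x : ℝ} : HasDerivAt (fun t => algebraMap 𝕜 ℂ (f t)) (algebraMap 𝕜 ℂ f') x ↔
      HasDerivAt f f' x := by
  have hi : Isometry (algebraMap 𝕜 ℂ) :=
    AddMonoidHomClass.isometry_of_norm _ norm_algebraMap_field
  rw [hasDerivAt_iff_tendsto_slope_zero, hasDerivAt_iff_tendsto_slope_zero,
    hi.isEmbedding.tendsto_nhds_iff]
  refine iff_of_eq (congrArg (fun q => Tendsto q _ _) (funext fun t => ?_))
  rw [Function.comp_apply, map_real_smul (algebraMap 𝕜 ℂ) (algebraMapCLM 𝕜 ℂ).continuous, map_sub]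

theorem hasDerivAt_fourierInv_line {d : ℕ} {g : Eu d → ℂ} (hg : Integrable g)
    (hg' : Integrable fun ξ => ‖ξ‖ * ‖g ξ‖) (x : Eu d) (j : Fin d) :
    HasDerivAt (fun t : ℝ => 𝓕⁻ g (x + t • stdVec j))
      (𝓕⁻ (fun ξ => (2 * Real.pi * Complex.I * (ξ j : ℂ)) * g ξ) x) 0 := by
  have h1 := Real.hasFDerivAt_fourier hg hg' (-x)
  have hline : HasDerivAt (fun t : ℝ => -(x + t • stdVec j)) (-stdVec j) 0 := by
    have := (((hasDerivAt_id (0 : ℝ)).smul_const (stdVec j : Eu d)).const_add x).neg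
    rw [one_smul] at this
    exact this
  have h2 := HasFDerivAt.comp_hasDerivAt_of_eq (0 : ℝ) h1 hline (by simp)
  have hint : Integrable (VectorFourier.fourierSMulRight (innerSL ℝ) g) := by
    refine (hg'.const_mul (2 * Real.pi * ‖innerSL ℝ (E := Eu d)‖)).mono'
      (hg.aestronglyMeasurable.fourierSMulRight) (Eventually.of_forall fun ξ => ?_)
    rw [← mul_assoc]
    exact VectorFourier.norm_fourierSMulRight_le _ _ _
  rw [Real.fourier_continuousLinearMap_apply hint] at h2
  refine (h2.congr_deriv ?_).congr_of_eventuallyEq (Eventually.of_forall fun t => ?_)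
  · rw [Real.fourierInv_eq_fourier_neg]
    refine congrArg (fun q : Eu d → ℂ => 𝓕 q (-x)) (funext fun ξ => ?_)
    rw [VectorFourier.fourierSMulRight_apply]
    have : (innerSL ℝ ξ) (-stdVec j) = -ξ j := by
      simp [EuclideanSpace.inner_single_right]
    rw [this]
    simp [mul_assoc]
  · exact Real.fourierInv_eq_fourier_neg _ _

/-! ### Distributional identities -/

section Distributions

variable {d : ℕ}

theorem represents_fourier_sum {ι : Type*} (t : Finset ι) {T : ι → 𝓢'(Eu d, ℂ)}
    {g : ι → Eu d → ℂ} (h : ∀ i ∈ t, Represents (𝓕 (T i)) (g i)) :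
    Represents (𝓕 (∑ i ∈ t, T i)) (∑ i ∈ t, g i) := by
  classical
  induction t using Finset.induction_on with
  | empty =>
    have h0 : 𝓕 (0 : 𝓢'(Eu d, ℂ)) = 0 := by ext φ; rfl
    rw [Finset.sum_empty, Finset.sum_empty, h0]
    exact Represents.zero
  | insert a t ha ih =>
    rw [Finset.sum_insert ha, Finset.sum_insert ha, FourierTransform.fourier_add]
    exact (h a (Finset.mem_insert_self a t)).add
      (ih fun i hi => h i (Finset.mem_insert_of_mem hi))

theorem laplacian_represents {T : 𝓢'(Eu d, ℂ)} {g : Eu d → ℂ} (h : Represents (𝓕 T) g) :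
    Represents (𝓕 (∑ j : Fin d, ∂_{stdVec j} (∂_{stdVec j} T)))
      (fun ξ => -(((2 * Real.pi * ‖ξ‖) ^ 2 : ℝ) : ℂ) * g ξ) := by
  have h1 := represents_fourier_sum Finset.univ (T := fun j : Fin d => ∂_{stdVec j} (∂_{stdVec j} T))
    fun j _ => fourier_lineDeriv_represents (fourier_lineDeriv_represents h j) j
  convert h1 using 1
  funext ξ
  rw [Finset.sum_apply, mul_pow, EuclideanSpace.norm_sq_eq]
  push_cast
  rw [Finset.mul_sum, ← Finset.sum_neg_distrib, Finset.sum_mul]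
  refine Finset.sum_congr rfl fun j _ => ?_
  rw [Real.norm_eq_abs, ← Complex.ofReal_pow, sq_abs]
  push_cast
  linear_combination (-(2 * Real.pi * (ξ j : ℂ)) ^ 2 * g ξ) * Complex.I_sq

theorem IsFracLaplacian.unique {a : ℝ} {T W W' : 𝓢'(Eu d, ℂ)} (h : IsFracLaplacian a T W)
    (h' : IsFracLaplacian a T W') : W = W' := by
  obtain ⟨g, hg, hW⟩ := h
  obtain ⟨g', hg', hW'⟩ := h'
  refine fourier_injective (hW.unique hW' ?_)
  filter_upwards [hg.ae_eq hg'] with ξ hξ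
  rw [hξ]

variable [NeZero d] {𝕜 : Type*} [RCLike 𝕜] [NormedAlgebra 𝕜 ℂ] {w w' : FourierWeight d} {δ : ℝ}

/-- Away from ξ = 0, (2π|ξ|)^{δ-2} · (-(2π|ξ|)²) = -(2π|ξ|)^δ, whence the minus sign. -/
theorem isFracLaplacian_of_diffusion {v : FourierSpace 𝕜 w} {f : FourierSpace 𝕜 w'}
    (hf : f.hat =ᵐ[volume] fun ξ => diffusionSymbol d δ ξ * v.hat ξ) :
    IsFracLaplacian (δ / 2 - 1) (∑ j : Fin d, ∂_{stdVec j} (∂_{stdVec j} v.toDistr)) (-f.toDistr) := by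
  refine ⟨_, laplacian_represents v.hat_represents, ?_⟩
  have h1 : 𝓕 (-f.toDistr) = (-1 : ℂ) • (𝓕 f.toDistr : 𝓢'(Eu d, ℂ)) := by
    ext φ
    exact (neg_one_smul ℂ (f.toDistr (𝓕 φ))).symm
  rw [h1]
  refine (f.hat_represents.smul (-1 : ℂ)).congr ?_
  filter_upwards [hf, ae_ne_zero] with ξ hξ h0
  have hn : 0 < ‖ξ‖ := norm_pos_iff.2 h0
  have hpi := Real.pi_pos
  have h2 : (2 * Real.pi * ‖ξ‖) ^ δ =
      (2 * Real.pi * ‖ξ‖) ^ (2 * (δ / 2 - 1)) * (2 * Real.pi * ‖ξ‖) ^ 2 := by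
    rw [← Real.rpow_two, ← Real.rpow_add (by positivity)]
    ring_nf
  rw [Pi.smul_apply, hξ, diffusionSymbol, h2]
  push_cast
  rw [smul_eq_mul]
  ring

theorem advection_sub_eq {γ : ℝ} {z : FourierSpace 𝕜 w} {f g h : FourierSpace 𝕜 w'}
    (hf : f.hat =ᵐ[volume] fun ξ => advectionSymbol d γ ξ * z.hat ξ) (hh : h = f + g) :
    -(γ : ℂ) • ∂_{stdVec (0 : Fin d)} z.toDistr - -g.toDistr = h.toDistr := by
  have h1 : -(γ : ℂ) • ∂_{stdVec (0 : Fin d)} z.toDistr = f.toDistr := by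
    refine fourier_injective (Represents.unique ?_ f.hat_represents hf.symm)
    rw [fourier_smul_field]
    refine ((fourier_lineDeriv_represents z.hat_represents 0).smul (-(γ : ℂ))).congr
      (Eventually.of_forall fun ξ => ?_)
    simp only [Pi.smul_apply, smul_eq_mul, advectionSymbol, mul_assoc]
  rw [h1, sub_neg_eq_add, hh]
  rfl

end Distributions

/-! ### The nonlinear equation -/

section Equation

variable {𝕜 : Type*} [RCLike 𝕜] [NormedAlgebra 𝕜 ℂ] {d : ℕ} {w w' : FourierWeight d}

/-- `G` is at once the distributional gradient that `Solves` refers to and the classical one, to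
which the chain rule applies. -/
theorem FourierSpace.exists_gradient (hL1 : ∀ u : FourierSpace 𝕜 w, Integrable u.hat)
    (hgrad : ∀ u : FourierSpace 𝕜 w, Integrable fun ξ => ‖ξ‖ * ‖u.hat ξ‖)
    (u : FourierSpace 𝕜 w) : ∃ G : Fin d → Eu d → 𝕜,
      (∀ j, Represents (∂_{stdVec j} u.toDistr) fun x => algebraMap 𝕜 ℂ (G j x)) ∧
      ∀ j x, HasDerivAt (fun t : ℝ => u.val (x + t • stdVec j)) (algebraMap 𝕜 ℂ (G j x)) 0 := by
  have hherm : ∀ j : Fin d,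
      IsHermitian 𝕜 fun ξ => (2 * Real.pi * Complex.I * (ξ j : ℂ)) * u.hat ξ := fun j => by
    refine u.isHermitian_hat.imp id fun h => ?_
    filter_upwards [h] with ξ hξ
    simp [hξ, Complex.conj_ofNat]
  choose G hG using fun (j : Fin d) (x : Eu d) => fourierInv_mem_range (hherm j) x
  have hint : ∀ j : Fin d,
      Integrable fun ξ => (2 * Real.pi * Complex.I * (ξ j : ℂ)) * u.hat ξ := fun j => by
    refine ((hgrad u).const_mul (2 * Real.pi)).mono' (AEStronglyMeasurable.mul
      (by fun_prop) u.aestronglyMeasurable_hat) (Eventually.of_forall fun ξ => ?_)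
    have hpi := Real.pi_pos
    rw [norm_mul, ← mul_assoc]
    gcongr
    simp only [norm_mul, Complex.norm_ofNat, Complex.norm_real, Complex.norm_I, mul_one,
      Real.norm_eq_abs, abs_of_pos hpi]
    gcongr
    exact abs_coord_le_norm ξ j
  refine ⟨G, fun j => ?_, fun j x => ?_⟩
  · simp only [hG]
    exact (fourier_lineDeriv_represents u.hat_represents j).fourierInv (hint j)
  · rw [hG]
    exact hasDerivAt_fourierInv_line (hL1 u) (hgrad u) x j

variable [NeZero d]

/-- Every object quantified in `Solves` is determined by `u`, at least almost everywhere: `Z` is the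
distribution of `z`, and `V j` is ∂_j v by the chain rule for v = u + Ψ(u). The equation thus
becomes an identity between `f` and the multipliers applied to `z` and `v`. -/
theorem solves_iff {γ δ : ℝ} {R : ℝ≥0∞} {ζ ψ Ψ : 𝕜 → 𝕜} {f : 𝓢'(Eu d, ℂ)}
    (hL1 : ∀ u : FourierSpace 𝕜 w, Integrable u.hat)
    (hgrad : ∀ u : FourierSpace 𝕜 w, Integrable fun ξ => ‖ξ‖ * ‖u.hat ξ‖)
    {u z v : FourierSpace 𝕜 w} {U : Eu d → 𝕜} (hU : ∀ x, algebraMap 𝕜 ℂ (U x) = u.val x)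
    (hUR : ∀ x, ‖U x‖ₑ < R) (hΨ : ∀ y, ‖y‖ₑ < R → HasDerivAt Ψ (ψ y) y)
    (hz : ∀ x, z.val x = algebraMap 𝕜 ℂ (ζ (U x)))
    (hv : ∀ x, v.val x = algebraMap 𝕜 ℂ (U x + Ψ (U x)))
    {a b h : FourierSpace 𝕜 w'}
    (ha : a.hat =ᵐ[volume] fun ξ => advectionSymbol d γ ξ * z.hat ξ)
    (hb : b.hat =ᵐ[volume] fun ξ => diffusionSymbol d δ ξ * v.hat ξ) (hh : h = a + b) :
    Solves γ δ R ζ ψ f u.toDistr ↔ h.toDistr = f := by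
  have hi : Isometry (algebraMap 𝕜 ℂ) :=
    AddMonoidHomClass.isometry_of_norm _ norm_algebraMap_field
  have hUc : Continuous U := by
    rw [hi.isEmbedding.continuous_iff]
    have : algebraMap 𝕜 ℂ ∘ U = u.val := funext hU
    rw [this]
    exact FourierSpace.continuous_val hL1 u
  have hUrep : Represents u.toDistr (fun x => algebraMap 𝕜 ℂ (U x)) := by
    simp only [hU]
    exact FourierSpace.represents_val hL1 u
  have hzrep : Represents z.toDistr (fun x => algebraMap 𝕜 ℂ (ζ (U x))) := by
    simp only [← hz]
    exact FourierSpace.represents_val hL1 z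
  obtain ⟨G, hGrep, hGder⟩ := u.exists_gradient hL1 hgrad
  obtain ⟨K, hKrep, hKder⟩ := v.exists_gradient hL1 hgrad
  have hK : ∀ j x, K j x = (1 + ψ (U x)) * G j x := fun j x => by
    have h1 : HasDerivAt (fun t : ℝ => U (x + t • stdVec j)) (G j x) 0 := by
      rw [← hasDerivAt_algebraMap_iff]
      simp only [hU]
      exact hGder j x
    have h2 : HasDerivAt (fun y => y + Ψ y) (1 + ψ (U x)) (U x) :=
      (hasDerivAt_id _).add (hΨ _ (hUR x))
    have h3 := HasDerivAt.comp_of_eq (0 : ℝ) h2 h1 (by simp)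
    refine HasDerivAt.unique ?_ h3
    rw [← hasDerivAt_algebraMap_iff]
    simp only [Function.comp_apply, ← hv]
    exact hKder j x
  have hlap := isFracLaplacian_of_diffusion hb
  have hfin := advection_sub_eq ha hh
  constructor
  · rintro ⟨U', G', Z, W, V, hU'c, -, hU', hG', hZ, hV, hW, heq⟩
    -- Both functions represent `u`, so they agree almost everywhere, and by continuity everywhere.
    have hUU : U' = U := by
      refine (hU'c.ae_eq_iff_eq volume hUc).1 ?_
      filter_upwards [hU'.ae_eq hUrep] with x hx
      exact hi.injective hx
    subst hUU
    have hZ' : Z = z.toDistr := hZ.unique hzrep (EventuallyEq.refl _ _)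
    have hV' : ∀ j, V j = ∂_{stdVec j} v.toDistr := fun j => by
      refine (hV j).unique (hKrep j) ?_
      filter_upwards [(hG' j).ae_eq (hGrep j)] with x hx
      rw [hK, hi.injective hx]
    simp only [hV'] at hW
    rw [← heq, ← hfin, hZ', hW.unique hlap]
  · rintro rfl
    refine ⟨U, G, z.toDistr, -b.toDistr, fun j => ∂_{stdVec j} v.toDistr, hUc, hUR, hUrep, hGrep,
      hzrep, fun j => ?_, hlap, hfin⟩
    simp only [← hK]
    exact hKrep j

end Equation

end AnisoSobolev

end

/-! ### The main theorem -/

theorem mainTheorem11 {𝕜 : Type*} [RCLike 𝕜] [NormedAlgebra 𝕜 ℂ] {d : ℕ} [NeZero d]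
    (hd : 2 ≤ d) (s r δ γ α β : ℝ) (hs0 : 0 ≤ s) (hr0 : 0 ≤ r) (hr1 : r ≤ 1) (hδ : 1 < δ)
    (hdim : 1 + δ - 2 * r < d) (hs : (d : ℝ) / 2 < s) (hd2 : d = 2 → δ ≤ 2) (hγ : γ ≠ 0)
    (R : ℝ≥0∞) (ζ ψ : 𝕜 → 𝕜) (p q : FormalMultilinearSeries 𝕜 𝕜 𝕜)
    (hζ : HasFPowerSeriesOnBall ζ p 0 R) (hψ : HasFPowerSeriesOnBall ψ q 0 R)
    (hζ0 : ζ 0 = 0) (hψ0 : ψ 0 = 0)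
    (hα : α ≠ 0) (hβ : β ≠ 0)
    (hζ' : HasDerivAt ζ (α : 𝕜) 0) (hψ' : HasDerivAt ψ (β : 𝕜) 0) :
    ∃ (𝒰 : Set (AnisoSobolev.HSpace 𝕜 d s r)) (𝒱 : Set (AnisoSobolev.XSpace 𝕜 d (s + δ) r δ))
      (S : AnisoSobolev.HSpace 𝕜 d s r → AnisoSobolev.XSpace 𝕜 d (s + δ) r δ),
      IsOpen 𝒰 ∧ 0 ∈ 𝒰 ∧ IsOpen 𝒱 ∧ 0 ∈ 𝒱 ∧
      (∀ f ∈ 𝒰, ∀ u ∈ 𝒱,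
        AnisoSobolev.Solves γ δ R ζ ψ f.toDistr u.toDistr ↔ u = S f) ∧
      (∀ f ∈ 𝒰, S f ∈ 𝒱) ∧
      AnalyticOnNhd 𝕜 S 𝒰 := by
  open AnisoSobolev in
  have ht : (d : ℝ) / 2 + 1 < s + δ := by linarith
  have hδ0 : 0 < δ := by linarith
  have htemp := omega_tempered hd hδ0 hdim ht
  have hcomplete : CompleteSpace (XSpace 𝕜 d (s + δ) r δ) :=
    FourierSpace.completeSpace htemp omega_neg
  have hL1 : ∀ u : XSpace 𝕜 d (s + δ) r δ, Integrable u.hat := fun u =>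
    integrable_of_omega hd hδ0 hdim ht u.hat_memLp
  have hgrad : ∀ u : XSpace 𝕜 d (s + δ) r δ, Integrable fun ξ => ‖ξ‖ * ‖u.hat ξ‖ := fun u =>
    integrable_norm_mul_of_omega hd hδ0 hdim ht u.hat_memLp measurable_norm fun ξ => by linarith
  obtain ⟨Cm, hCm, hconv⟩ := lintegral_sq_omega_conv_le hd hr0 hr1 hδ hdim hd2 ht
  obtain ⟨B, hB⟩ := FourierSpace.exists_mul (𝕜 := 𝕜) htemp hL1 hCm hconv
  obtain ⟨ev, hev, hevb⟩ := FourierSpace.exists_eval hL1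
    (C := ∫⁻ ξ, ENNReal.ofReal ((1 + ‖ξ‖ ^ 2) / (omega (d := d) (s + δ) r δ).toFun ξ))
    (lintegral_one_add_norm_sq_div_omega_lt_top hd hδ0 hdim ht).ne (lintegral_mono fun ξ =>
      ENNReal.ofReal_le_ofReal (div_le_div_of_nonneg_right
        (by nlinarith [sq_nonneg ‖ξ‖]) (omega_nonneg ξ)))
  have hinj := (algebraMap 𝕜 ℂ).injective
  have hevm : ∀ x u v, ev x (B u v) = ev x u * ev x v := fun x u v => hinj <| by
    rw [map_mul, hev, hev, hev, hB]
  obtain ⟨Ψ, P, hΨ, hΨ0, hΨd⟩ := exists_antideriv hψ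
  -- Ψ'(0) = ψ(0) = 0, so Ψ(u) does not contribute to the linearization.
  have hΨ' : HasDerivAt Ψ 0 0 := by
    have := hΨd 0 (by simpa using hψ.r_pos)
    rwa [hψ0] at this
  obtain ⟨Φ, hΦan, hΦ0, hΦd, hΦev⟩ := exists_comp_powerSeries B hζ hζ0 hζ'
  obtain ⟨Θ, hΘan, hΘ0, hΘd, hΘev⟩ := exists_comp_powerSeries B hΨ hΨ0 hΨ'
  obtain ⟨D, hD⟩ := exists_advection (d := d) (r := r) 𝕜 hs0 hr0 hδ γ
  obtain ⟨F, hF⟩ := exists_diffusion (d := d) (r := r) 𝕜 hs0 hr0 hδ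
  obtain ⟨L, hL⟩ := exists_linearEquiv 𝕜 hd hδ hdim ht hγ hα hD hF
  -- Evaluations are bounded uniformly in `x`, so all values of a small `u` lie in B(0, R).
  have hball : ∀ᶠ u in 𝓝 (0 : XSpace 𝕜 d (s + δ) r δ), ∀ x, ‖ev x u‖ₑ < R := by
    obtain ⟨c, hc⟩ : ∃ c : ℝ, ∀ x u, ‖ev x u‖ ≤ c * ‖u‖ := ⟨_, hevb⟩
    have h1 : Tendsto (fun u : XSpace 𝕜 d (s + δ) r δ => ENNReal.ofReal (c * ‖u‖)) (𝓝 0) (𝓝 0) := by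
      have : Continuous fun u : XSpace 𝕜 d (s + δ) r δ => ENNReal.ofReal (c * ‖u‖) :=
        ENNReal.continuous_ofReal.comp (by fun_prop)
      simpa using this.tendsto 0
    filter_upwards [h1.eventually_lt_const hψ.r_pos] with u hu x
    rw [← ofReal_norm]
    exact (ENNReal.ofReal_le_ofReal (hc x u)).trans_lt hu
  have hNan : AnalyticAt 𝕜 (fun u => D (Φ u) + F (u + Θ u)) 0 :=
    ((D.analyticAt _).comp hΦan).add ((F.analyticAt _).comp (analyticAt_id.add hΘan))
  have hNd : HasFDerivAt (fun u => D (Φ u) + F (u + Θ u)) (L : _ →L[𝕜] _) 0 := by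
    have h1 := (D.hasFDerivAt.comp (0 : XSpace 𝕜 d (s + δ) r δ) hΦd).add
      (F.hasFDerivAt.comp (0 : XSpace 𝕜 d (s + δ) r δ) ((hasFDerivAt_id _).add hΘd))
    refine h1.congr_fderiv ?_
    rw [hL]
    ext u
    simp
  obtain ⟨𝒰, 𝒱, S, h𝒰, h0𝒰, h𝒱, h0𝒱, hsub, hS, hSm, hSan⟩ := exists_analytic_inverse hNan
    (by simp [hΦ0, hΘ0]) L hNd (hball.and (hΦev.and hΘev))
  refine ⟨𝒰, 𝒱, S, h𝒰, h0𝒰, h𝒱, h0𝒱, fun f hf u hu => ?_, hSm, hSan⟩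
  obtain ⟨huR, huΦ, huΘ⟩ := hsub hu
  rw [← hS f hf u hu]
  refine (solves_iff hL1 hgrad (fun x => hev x u) huR hΨd (z := Φ u) (v := u + Θ u)
    (fun x => ?_) (fun x => ?_) (hD (Φ u)) (hF (u + Θ u)) rfl).trans
    ⟨fun h => Subtype.ext h, fun h => congrArg FourierSpace.toDistr h⟩
  · rw [← hev, huΦ (ev x) (hevm x) (huR x)]
  · rw [← hev, map_add, huΘ (ev x) (hevm x) (huR x)]
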